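/- **Setting.** Let $\mathcal X\subset\mathbb R^d$ be a finite action set and $T\ge 2$ a horizon. In round $t=1,\dots,T$ the environment generates losses $(\ell_{t,x})_{x\in\mathcal X}\in[-1,1]^{\mathcal X}$ with $\mathbb E_t[\ell_{t,x}]=\langle x,\ell_t\rangle$ for some $\ell_t\in\mathbb R^d$, where $\mathbb E_t$ is expectation given everything that happened before round $t$ and $\ell_t$ may depend arbitrarily on this past. The learner plays $A_t\in\mathcal X$, drawn independently of the losses of round $t$ given the past, and observes only $\ell_{t,A_t}$. The regret against $u\in\mathcal X$ is $\mathrm{Reg}(u)=\mathbb E\big[\sum_{t=1}^T(\ell_{t,A_t}-\ell_{t,u})\big]$. This is the adversarial regime. The corrupted stochastic regime requires in addition that there are $x^\star\in\mathcal X$, $\Delta>0$ and numbers $C_t\ge 0$ with $\mathbb E_t[\ell_{t,x}-\ell_{t,x^\star}]\ge\Delta-C_t$ for all $t$ and all $x\ne x^\star$; put $C=\sum_{t=1}^T C_t$. **Base algorithm (LSB-logdet), with candidate $\widehat x\in\mathcal X$.** Put $D=d+1$ and identify $\widehat x$ with $\binom{\mathbf 0}{1}\in\mathbb R^{D}$ and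 every other $x\in\mathcal X$ with $\binom{x}{0}\in\mathbb R^{D}$. For a distribution $\alpha$ on $\mathcal X$ let $\mu_\alpha$ and $\mathrm{Cov}(\alpha)=\mathbb E_{x\sim\alpha}[xx^\top]-\mu_\alpha\mu_\alpha^\top$ be its mean and covariance in $\mathbb R^D$; determinant and inverse of $\mathrm{Cov}(\alpha)$ are taken on the direction space of the affine hull of the transformed actions (which is $\mathbb R^D$ if they affinely span), and $-\log\det=+\infty$ where the determinant vanishes. Let $\pi$ be John's exploration over $\mathcal X\setminus\{\widehat x\}$, i.e. the distribution given by John's decomposition for the minimum volume ellipsoid (within the affine hull) enclosing $\mathcal X\setminus\{\widehat x\}$, and $\delta_{\widehat x}$ the point mass at $\widehat x$. In each of its rounds $t$, with $\tau<t$ ranging over its earlier rounds since initialization, the algorithm sets $$\eta_t=\min\Big\{\tfrac1{4D},\sqrt{\tfrac{\log T}{\sum_{\tau<t}(1-p_{\tau,\widehat x})}}\Big\}\quad(\text{the root is }+\infty\text{ if the sum vanishes}),$$ $$p_t\in\operatorname*{argmin}_{\alpha\in\Delta(\mathcal X)}\Big\langle\mu_\alpha,\sum_{\tau<t}\widehat\ell_\tau\Big\rangle-\tfrac1{\eta_t}\log\det\mathrm{Cov}(\alpha),\qquad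 \widetilde p_t=(1-\eta_tD)p_t+\eta_tD\big((1-p_{t,\widehat x})\pi+p_{t,\widehat x}\delta_{\widehat x}\big),$$ samples $A_t\sim\widetilde p_t$, and forms $\widehat\ell_t=\mathrm{Cov}(\widetilde p_t)^{-1}(A_t-\mu_{\widetilde p_t})\,\ell_{t,A_t}$ (actions in their transformed form). **Combined algorithm, with parameter $c_2=\kappa(d+1)^2$.** Set $T_1=0$, $T_0=-c_2\log T$ and draw $\widehat x_1$ uniformly from $\mathcal X$. In epoch $k=1,2,\dots$ initialize the base algorithm with candidate $\widehat x_k$ and run it in rounds $t=T_k+1,T_k+2,\dots$, where $N_k(x)$ counts the plays of $x$ in epoch $k$. If after round $t$ one has $t-T_k\ge 2(T_k-T_{k-1})$ and some $x\in\mathcal X\setminus\{\widehat x_k\}$ has $N_k(x)\ge\frac{t-T_k}2$, then set $\widehat x_{k+1}=x$, $T_{k+1}=t$ and start epoch $k+1$. The run stops after round $T$. Ties (between minimizers, and between possible new candidates) are broken arbitrarily. **Claim.** For every $\kappa>0$ there is a constant $K>0$, depending only on $\kappa$, such that for all $d$, $T\ge2$ and $\mathcal X$ this one algorithm satisfies simultaneously: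 1. in the adversarial regime, $\mathrm{Reg}(u)\le K\,d\sqrt{T\log T}$ for all $u\in\mathcal X$; 2. in the corrupted stochastic regime, for all $x^\star,\Delta,(C_t)$ as above, $\mathrm{Reg}(u)\le K\Big(\dfrac{d^2\log T}{\Delta}+d\sqrt{\dfrac{C\log T}{\Delta}}\Big)$ for all $u\in\mathcal X$. -/

import Mathlib

open MeasureTheory

noncomputable section

namespace LinBandit

/-- The space `ℝ^ι` with its Euclidean structure. -/
abbrev Pt (ι : Type) [Fintype ι] : Type := EuclideanSpace ℝ ι

/-- `w` is a probability distribution on the finite set `S` (as a weight function, zero off `S`). -/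
structure IsDist {α : Type*} (S : Finset α) (w : α → ℝ) : Prop where
  nonneg : ∀ x ∈ S, 0 ≤ w x
  sum_eq_one : ∑ x ∈ S, w x = 1
  zero_off : ∀ x, x ∉ S → w x = 0

section Moments

variable {α : Type*} {ι : Type} [Fintype ι] [DecidableEq ι]

/-- The mean `μ_w = E_{x ∼ w}[φ x]`. -/
def mean (φ : α → Pt ι) (S : Finset α) (w : α → ℝ) : Pt ι := ∑ x ∈ S, w x • φ x

/-- The second moment matrix `H(w) = E_{x ∼ w}[(φ x)(φ x)ᵀ]`. -/
def secondMoment (φ : α → Pt ι) (S : Finset α) (w : α → ℝ) : Matrix ι ι ℝ :=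
  ∑ x ∈ S, w x • Matrix.vecMulVec (φ x).ofLp (φ x).ofLp

/-- The covariance matrix `H(w) - μ_w μ_wᵀ`. -/
def covMat (φ : α → Pt ι) (S : Finset α) (w : α → ℝ) : Matrix ι ι ℝ :=
  secondMoment φ S w - Matrix.vecMulVec (mean φ S w).ofLp (mean φ S w).ofLp

/-- The direction space of the affine hull of the points `φ x`, `x ∈ S`. -/
def hullDir (φ : α → Pt ι) (S : Finset α) : Submodule ℝ (Pt ι) :=
  vectorSpan ℝ (φ '' (S : Set α))

/-- Matrix of the orthogonal projection onto the orthogonal complement of `hullDir φ S`.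
It is `0` when the points affinely span the whole space. -/
def perpMat (φ : α → Pt ι) (S : Finset α) : Matrix ι ι ℝ :=
  Matrix.of fun i j => ((hullDir φ S)ᗮ.starProjection (EuclideanSpace.single j 1)) i

/-- The covariance matrix, read as an operator on the direction space of the affine hull of the
points and completed by the identity on the orthogonal complement.  Its determinant is the
determinant of the covariance on `hullDir φ S`, and on `hullDir φ S` its inverse is the
pseudo-inverse of the covariance.  It equals `covMat` when the points affinely span the space. -/
def hullCov (φ : α → Pt ι) (S : Finset α) (w : α → ℝ) : Matrix ι ι ℝ :=
  covMat φ S w + perpMat φ S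

theorem hullCov_eq_covMat (φ : α → Pt ι) (S : Finset α) (w : α → ℝ) (h : hullDir φ S = ⊤) :
    hullCov φ S w = covMat φ S w := by
  ext i j
  simp [hullCov, perpMat, h, Submodule.top_orthogonal_eq_bot, Submodule.starProjection_bot]

/-- The ellipsoid `{x | (x - c)ᵀ M (x - c) ≤ 1}`, inside the affine hull of `S`, contains `S`.
The matrix is normalised to be the identity orthogonally to the hull, so that its volume inside
the hull is proportional to `(det M)^(-1/2)`. -/
structure IsEnclosingEllipsoid (S : Finset (Pt ι)) (c : Pt ι) (M : Matrix ι ι ℝ) : Prop where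
  posDef : M.PosDef
  center_mem : c ∈ affineSpan ℝ (S : Set (Pt ι))
  perp : ∀ v ∈ (hullDir id S)ᗮ, M.mulVec v.ofLp = v.ofLp
  encloses : ∀ x ∈ S, (x - c).ofLp ⬝ᵥ M.mulVec (x - c).ofLp ≤ 1

/-- `w` is John's exploration over `S`: the distribution on `S` given by John's decomposition of
the identity for the minimum volume ellipsoid enclosing `S`.  With `r` the dimension of the
affine hull, its mean is the centre `c` and `r · E[(x-c)(x-c)ᵀ]` is inverse to `M` on the hull.
(If `r > 0`, it follows that `w` lives on the contact points `(x - c)ᵀ M (x - c) = 1`.) -/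
def IsJohnExploration (S : Finset (Pt ι)) (w : Pt ι → ℝ) : Prop :=
  IsDist S w ∧ ∃ (c : Pt ι) (M : Matrix ι ι ℝ),
    IsEnclosingEllipsoid S c M ∧
    (∀ (c' : Pt ι) (M' : Matrix ι ι ℝ), IsEnclosingEllipsoid S c' M' → M'.det ≤ M.det) ∧
    mean id S w = c ∧
    ((Module.finrank ℝ (hullDir id S) : ℝ) • covMat id S w + perpMat id S) * M = 1

end Moments

/-- The transformed action set: the candidate `xhat` becomes `(0, 1)` and every other action `x`
becomes `(x, 0)` in `ℝ^(d+1)`. -/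
def lift {d : ℕ} (xhat x : Pt (Fin d)) : Pt (Fin d ⊕ Unit) :=
  open Classical in
  if x = xhat then WithLp.toLp 2 (Sum.elim 0 1) else WithLp.toLp 2 (Sum.elim x.ofLp 0)

/-- One trajectory of the learner; rounds are numbered `0, 1, 2, …`.
`act t` is the action played in round `t`, `obs t` its observed loss, `cand t` the candidate in
force in round `t`, `start t` the number of rounds before the current epoch, `prevLen t` the length
of the previous epoch, and `p t` the distribution computed by the base algorithm. -/
structure Trajectory (d : ℕ) where
  act : ℕ → Pt (Fin d)
  obs : ℕ → ℝ
  cand : ℕ → Pt (Fin d)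
  start : ℕ → ℕ
  prevLen : ℕ → ℝ
  p : ℕ → Pt (Fin d) → ℝ

namespace Trajectory

variable {d : ℕ}

/-- `∑ (1 - p_{τ, xhat})` over the earlier rounds `τ` of the current epoch. -/
def offMass (tr : Trajectory d) (t : ℕ) : ℝ :=
  ∑ τ ∈ Finset.Ico (tr.start t) t, (1 - tr.p τ (tr.cand t))

/-- The learning rate `min {1 / (4 D), √(log T / ∑ (1 - p_{τ, xhat}))}` with `D = d + 1`, where the
second entry is infinite when the sum vanishes. -/
def eta (tr : Trajectory d) (T t : ℕ) : ℝ :=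
  open Classical in
  if tr.offMass t = 0 then 1 / (4 * ((d : ℝ) + 1))
  else min (1 / (4 * ((d : ℝ) + 1))) (Real.sqrt (Real.log T / tr.offMass t))

/-- The sampling distribution
`(1 - η_t D) p_t + η_t D ((1 - p_{t, xhat}) π + p_{t, xhat} δ_{xhat})`, where `π = J xhat` is John's
exploration over the actions other than `xhat`. -/
def samp (tr : Trajectory d) (J : Pt (Fin d) → Pt (Fin d) → ℝ) (T t : ℕ) (x : Pt (Fin d)) : ℝ :=
  open Classical in
  let e := tr.eta T t * ((d : ℝ) + 1)
  let b := tr.p t (tr.cand t)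
  (1 - e) * tr.p t x + e * ((1 - b) * J (tr.cand t) x + b * (if x = tr.cand t then 1 else 0))

/-- The loss estimator of round `t`, a vector of `ℝ^(d+1)` representing the functional
`a ↦ aᵀ (H(p̃_t) - μ μᵀ)⁻¹ (a_t - μ) ℓ_t(a_t)`. -/
def est (tr : Trajectory d) (X : Finset (Pt (Fin d))) (J : Pt (Fin d) → Pt (Fin d) → ℝ)
    (T t : ℕ) : Pt (Fin d ⊕ Unit) :=
  let φ := lift (tr.cand t)
  let w := tr.samp J T t
  tr.obs t • WithLp.toLp 2 ((hullCov φ X w)⁻¹.mulVec (φ (tr.act t) - mean φ X w).ofLp)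

/-- The objective `⟨μ_w, ∑ ℓ̂_τ⟩ - (1/η_t) log det (H(w) - μ_w μ_wᵀ)` of round `t`, the sum running
over the earlier rounds of the current epoch. -/
def objective (tr : Trajectory d) (X : Finset (Pt (Fin d))) (J : Pt (Fin d) → Pt (Fin d) → ℝ)
    (T t : ℕ) (w : Pt (Fin d) → ℝ) : ℝ :=
  inner ℝ (mean (lift (tr.cand t)) X w) (∑ τ ∈ Finset.Ico (tr.start t) t, tr.est X J T τ)
    - 1 / tr.eta T t * Real.log (hullCov (lift (tr.cand t)) X w).det

/-- Feasible points of the minimisation: `-log det` is `+∞` where the determinant vanishes. -/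
def Feasible (tr : Trajectory d) (X : Finset (Pt (Fin d))) (t : ℕ) (w : Pt (Fin d) → ℝ) : Prop :=
  IsDist X w ∧ 0 < (hullCov (lift (tr.cand t)) X w).det

/-- The number of plays of `x` in the current epoch, up to and including round `t`. -/
def plays (tr : Trajectory d) (t : ℕ) (x : Pt (Fin d)) : ℕ :=
  open Classical in
  ((Finset.Ico (tr.start t) (t + 1)).filter fun τ => tr.act τ = x).card

/-- The length of the current epoch up to and including round `t`. -/
def elapsed (tr : Trajectory d) (t : ℕ) : ℝ := (t : ℝ) + 1 - tr.start t

/-- After round `t` the epoch may be ended in favour of the new candidate `x`. -/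
def CanSwitch (tr : Trajectory d) (X : Finset (Pt (Fin d))) (t : ℕ) (x : Pt (Fin d)) : Prop :=
  2 * tr.prevLen t ≤ tr.elapsed t ∧ x ∈ X ∧ x ≠ tr.cand t ∧ tr.elapsed t / 2 ≤ tr.plays t x

/-- The trajectory obeys the rules of the reduction (with parameter `c₂`) run on the base algorithm
LSB-logdet over `T` rounds.  Ties between minimisers, and between possible new candidates, may be
broken in any way. -/
structure Follows (tr : Trajectory d) (X : Finset (Pt (Fin d)))
    (J : Pt (Fin d) → Pt (Fin d) → ℝ) (c₂ : ℝ) (T : ℕ) : Prop where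
  cand_zero : tr.cand 0 ∈ X
  start_zero : tr.start 0 = 0
  prevLen_zero : tr.prevLen 0 = c₂ * Real.log T
  p_feasible : ∀ t < T, tr.Feasible X t (tr.p t)
  p_argmin : ∀ t < T, ∀ w, tr.Feasible X t w →
    tr.objective X J T t (tr.p t) ≤ tr.objective X J T t w
  act_mem : ∀ t < T, tr.act t ∈ X
  switch : ∀ t < T, (∃ x, tr.CanSwitch X t x) →
    tr.CanSwitch X t (tr.cand (t + 1)) ∧ tr.start (t + 1) = t + 1 ∧
      tr.prevLen (t + 1) = tr.elapsed t
  stay : ∀ t < T, (¬ ∃ x, tr.CanSwitch X t x) →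
    tr.cand (t + 1) = tr.cand t ∧ tr.start (t + 1) = tr.start t ∧
      tr.prevLen (t + 1) = tr.prevLen t

end Trajectory

section Random

variable {d : ℕ} {Ω : Type*} {mΩ : MeasurableSpace Ω}

/-- A (possibly adaptive) linear bandit environment.  `ℱ t` is everything that has happened before
round `t`; in round `t` the environment generates losses `loss t · x ∈ [-1, 1]` whose mean given
the past is the inner product of `x` and `θ t`, for an arbitrary vector `θ t` that may depend on the past. -/
structure IsLinearEnv (μ : Measure Ω) (ℱ : Filtration ℕ mΩ) (T : ℕ) (X : Finset (Pt (Fin d)))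
    (loss : ℕ → Ω → Pt (Fin d) → ℝ) (θ : ℕ → Ω → Pt (Fin d)) : Prop where
  loss_mem : ∀ t < T, ∀ ω, ∀ x ∈ X, loss t ω x ∈ Set.Icc (-1 : ℝ) 1
  loss_meas : ∀ t < T, ∀ x ∈ X, Measurable[ℱ (t + 1)] fun ω => loss t ω x
  theta_meas : ∀ t < T, Measurable[ℱ t] (θ t)
  loss_mean : ∀ t < T, ∀ x ∈ X, μ[fun ω => loss t ω x | ℱ t] =ᵐ[μ] fun ω => inner ℝ x (θ t ω)

/-- The random trajectory `tr` is the reduction with base algorithm LSB-logdet, run against the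
losses `loss` with bandit feedback: the first candidate is uniform, and in every round the action
is drawn from the sampling distribution, given the past and the losses of the round. -/
structure IsRun (μ : Measure Ω) (ℱ : Filtration ℕ mΩ) (T : ℕ) (X : Finset (Pt (Fin d)))
    (loss : ℕ → Ω → Pt (Fin d) → ℝ) (c₂ : ℝ) (J : Pt (Fin d) → Pt (Fin d) → ℝ)
    (tr : Ω → Trajectory d) : Prop where
  john : ∀ xhat ∈ X, (X.erase xhat).Nonempty → IsJohnExploration (X.erase xhat) (J xhat)
  follows : ∀ ω, (tr ω).Follows X J c₂ T
  obs_eq : ∀ t < T, ∀ ω, (tr ω).obs t = loss t ω ((tr ω).act t)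
  cand_meas : ∀ t ≤ T, Measurable[ℱ t] fun ω => (tr ω).cand t
  p_meas : ∀ t < T, ∀ x ∈ X, Measurable[ℱ t] fun ω => (tr ω).p t x
  act_meas : ∀ t < T, Measurable[ℱ (t + 1)] fun ω => (tr ω).act t
  cand_unif : ∀ x ∈ X, μ.real {ω | (tr ω).cand 0 = x} = 1 / (X.card : ℝ)
  act_law : ∀ t < T, ∀ x ∈ X,
    μ[Set.indicator {ω | (tr ω).act t = x} (fun _ => (1 : ℝ)) |
        ℱ t ⊔ ⨆ y ∈ X, MeasurableSpace.comap (fun ω => loss t ω y) inferInstance]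
      =ᵐ[μ] fun ω => (tr ω).samp J T t x

/-- The pseudo-regret `E[∑_{t<T} (ℓ_{t,A_t} - ℓ_{t,u})]` against the fixed action `u`. -/
def regret (μ : Measure Ω) (T : ℕ) (loss : ℕ → Ω → Pt (Fin d) → ℝ) (tr : Ω → Trajectory d)
    (u : Pt (Fin d)) : ℝ :=
  ∫ ω, ∑ t ∈ Finset.range T, (loss t ω ((tr ω).act t) - loss t ω u) ∂μ

/-- The corrupted stochastic regime: `xstar` beats every other action by `Δ - C t` in conditional
mean in round `t`, where `C t ≥ 0` is the corruption of round `t`. -/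
structure IsCorruptedStochastic (μ : Measure Ω) (ℱ : Filtration ℕ mΩ) (T : ℕ)
    (X : Finset (Pt (Fin d))) (loss : ℕ → Ω → Pt (Fin d) → ℝ)
    (xstar : Pt (Fin d)) (Δ : ℝ) (C : ℕ → ℝ) : Prop where
  xstar_mem : xstar ∈ X
  gap_pos : 0 < Δ
  corr_nonneg : ∀ t < T, 0 ≤ C t
  gap : ∀ t < T, ∀ x ∈ X, x ≠ xstar →
    ∀ᵐ ω ∂μ, Δ - C t ≤ (μ[fun ω => loss t ω x - loss t ω xstar | ℱ t]) ω

end Random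

end LinBandit

end

/-!
Geometry. Measured from the candidate `xh`, every action is a displacement vector `y x` with
`y xh = 0`, and there is a vector `e` whose inner product with `y x` is `1` for every `x ≠ xh`
(`Frame`, `liftFrame`). Hence the covariance is the second moment `Mom w` of the displacements
corrected by a rank-one term, and `det Cov w = det (Mom w) * w xh` (`Frame.det_cov`): the barrier
`-log det Cov` is the sum of a matrix barrier and of `-log w(xh)`. Diagonalizing two second moment
matrices simultaneously turns its Bregman divergence into a sum of scalar terms `s - 1 - log s`
(`exists_simultaneous_diagonalization`, `Frame.IsMin.add_bregman_le`).

One round. With `q = 1 - p(xh)`, the change of the regularised leader against a linear perturbation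
`v` costs at most `3 η q ‖v‖²`, the norm being that of `Mom p` (`Frame.IsMin.step`). The factor `q`
comes from the Cauchy-Schwarz inequality against `e`, whose squared norm is `q`. When the candidate
itself is played and `q` is large, the barrier `-log w(xh)` is used in place of the matrix barrier
(`Frame.IsMin.step_base`). John's exploration keeps the estimators small enough for these steps
(`explores_liftFrame`, `Frame.IsRound.obj_add_le`), and the mean stability term is of order
`η (d + 1) q` (`Frame.IsRound.sum_mul_stab_le`).

One epoch. The regularised leader telescopes (`Trajectory.IsPlay.sum_gap_le`), and with the adaptive
learning rate the regret of an epoch is of order `S √M + S²`, where `S = (d + 1) √(log T)` and `M` is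
the mass placed off the candidate (`Trajectory.IsPlay.sum_epoch_le`).

The whole run. Epoch lengths at least double, so the epochs together cost `S √T`
(`Trajectory.EpochBound.sum_le_sqrt_horizon`). Let `x⋆` be a fixed action and `W` the number of
rounds in which it is not played. An epoch whose candidate is not `x⋆` is short compared to `W`,
since otherwise `x⋆` would have replaced the candidate; this yields a bound in terms of `√W`
(`Trajectory.EpochBound.sum_le_sqrt_misses`).

Expectations. These bounds hold on every trajectory, with each stability term reduced by a bound for
its mean. Unbiasedness of the estimators then bounds the regret by the expectation of the pathwise
bound (`IsGame.regret_le_of_sum_increment_le`). The estimators are integrable because the iterates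
stay away from the boundary, uniformly over all trajectories (`Trajectory.exists_lower_bound`).

Self-bounding. In the corrupted stochastic regime `Δ E[W] ≤ Reg(x⋆) + C`
(`IsGame.gap_mul_misses_le`), which turns a bound for `Reg(x⋆)` in terms of `√E[W]` into the claimed
one (`le_of_self_bounding`). If `C ≥ Δ T / 2`, the bound for the adversarial regime suffices.
-/

open MeasureTheory

noncomputable section

namespace LinBandit

set_option linter.unusedSectionVars false

open Matrix

/-! ### Scalar inequalities for the logarithmic barrier -/

/-- The Bregman divergence `t - 1 - log t` of `-log` at `1` dominates a function that is quadratic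
near `1` and linear far away. -/
theorem sq_div_le_sub_one_sub_log {t : ℝ} (ht : 0 < t) :
    (t - 1) ^ 2 / (2 * (1 + |t - 1|)) ≤ t - 1 - Real.log t := by
  rcases le_total 1 t with h | h
  · have h1 : Real.log t ≤ (t - t⁻¹) / 2 := by
      rw [← Real.sinh_log ht]
      exact Real.self_le_sinh_iff.2 (Real.log_nonneg h)
    rw [abs_of_nonneg (by linarith)]
    have h2 : (t - 1) ^ 2 / (2 * (1 + (t - 1))) = t - 1 - (t - t⁻¹) / 2 := by
      field_simp
      ring
    linarith
  · have h1 := Real.le_log_one_add_of_nonneg (x := (1 - t) / t) (div_nonneg (by linarith) ht.le)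
    have h2 : 1 + (1 - t) / t = t⁻¹ := by field_simp; ring
    have h3 : 2 * ((1 - t) / t) / ((1 - t) / t + 2) = 2 * (1 - t) / (1 + t) := by
      field_simp
      ring
    rw [h2, h3, Real.log_inv] at h1
    rw [abs_of_nonpos (by linarith)]
    have h4 : (t - 1) ^ 2 / (2 * (1 + -(t - 1))) ≤ (t - 1) ^ 2 / (1 + t) := by
      apply div_le_div_of_nonneg_left (sq_nonneg _) (by linarith) (by linarith)
    have h5 : (t - 1) ^ 2 / (1 + t) = t - 1 + 2 * (1 - t) / (1 + t) := by
      field_simp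
      ring
    linarith

theorem sub_one_sub_log_nonneg {t : ℝ} (ht : 0 < t) : 0 ≤ t - 1 - Real.log t := by
  have := Real.log_le_sub_one_of_pos ht
  linarith

/-- A linear term of slope `a` is absorbed by the lower bound of `sq_div_le_sub_one_sub_log` up to
`3 a²`; the bound on `a` makes the discriminant of the resulting quadratic nonpositive. -/
theorem mul_le_sq_div_add {a R : ℝ} (ha : 0 ≤ a) (ha' : a ^ 2 ≤ 1 / 6) (hR : 0 ≤ R) :
    a * R ≤ R ^ 2 / (2 * (1 + R)) + 3 * a ^ 2 := by
  have ha2 : a ≤ 5 / 12 := by nlinarith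
  have h : 0 ≤ R ^ 2 / (2 * (1 + R)) + 3 * a ^ 2 - a * R := by
    have : R ^ 2 / (2 * (1 + R)) + 3 * a ^ 2 - a * R =
        (R ^ 2 * (1 - 2 * a) - 2 * a * R + 6 * a ^ 2 + 6 * a ^ 2 * R) / (2 * (1 + R)) := by
      field_simp
      ring
    rw [this]
    apply div_nonneg _ (by linarith)
    nlinarith [sq_nonneg (R - 6 * a), mul_nonneg (mul_nonneg ha ha) hR,
      mul_nonneg (sub_nonneg.2 ha2) (sq_nonneg R)]
  linarith

/-- For a family `s` of positive numbers the divergences `sᵢ - 1 - log sᵢ` jointly dominate the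
same function of the Euclidean distance of `s` from `1`. -/
theorem sq_div_le_sum_sub_one_sub_log {n : Type*} [Fintype n] {s : n → ℝ} (hs : ∀ i, 0 < s i)
    {R : ℝ} (hR : 0 ≤ R) (hR2 : R ^ 2 = ∑ i, (s i - 1) ^ 2) :
    R ^ 2 / (2 * (1 + R)) ≤ ∑ i, (s i - 1 - Real.log (s i)) := by
  rw [hR2, Finset.sum_div]
  refine Finset.sum_le_sum fun i _ => le_trans ?_ (sq_div_le_sub_one_sub_log (hs i))
  have h : |s i - 1| ≤ R := by
    refine abs_le_of_sq_le_sq ?_ hR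
    rw [hR2]
    exact Finset.single_le_sum (f := fun i => (s i - 1) ^ 2) (fun _ _ => sq_nonneg _)
      (Finset.mem_univ i)
  apply div_le_div_of_nonneg_left (sq_nonneg _) (by positivity) (by linarith)

/-! ### Simultaneous diagonalization of two positive definite matrices -/

section Diag

variable {n : Type*} [Fintype n]

theorem posDef_quad {A : Matrix n n ℝ} (hA : A.PosDef) {v : n → ℝ} (hv : v ≠ 0) :
    0 < v ⬝ᵥ A *ᵥ v := by
  simpa using hA.dotProduct_mulVec_pos hv

theorem posSemidef_quad {A : Matrix n n ℝ} (hA : A.PosSemidef) (v : n → ℝ) :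
    0 ≤ v ⬝ᵥ A *ᵥ v := by
  simpa using hA.dotProduct_mulVec_nonneg v

theorem dotProduct_mul_transpose_mulVec {A Q : Matrix n n ℝ} (hA : A = Q * Qᵀ) (u v : n → ℝ) :
    u ⬝ᵥ A *ᵥ v = ∑ i, (Qᵀ *ᵥ u) i * (Qᵀ *ᵥ v) i := by
  rw [hA, ← mulVec_mulVec, dotProduct_mulVec, ← mulVec_transpose]
  rfl

variable [DecidableEq n]

open scoped MatrixOrder Matrix.Norms.L2Operator in
/-- With `A = Cᵀ C`, take an orthogonal diagonalization of `C⁻ᵀ B C⁻¹`. -/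
theorem exists_simultaneous_diagonalization {A B : Matrix n n ℝ} (hA : A.PosDef)
    (hB : B.PosDef) :
    ∃ (Q : Matrix n n ℝ) (s : n → ℝ), IsUnit Q.det ∧ (∀ i, 0 < s i) ∧ A = Q * Qᵀ ∧
      B = Q * diagonal s * Qᵀ := by
  obtain ⟨C, hC⟩ : ∃ C : Matrix n n ℝ, A = Cᵀ * C := by
    obtain ⟨C, hC⟩ := CStarAlgebra.nonneg_iff_eq_star_mul_self.mp hA.posSemidef.nonneg
    exact ⟨C, by simpa [star_eq_conjTranspose] using hC⟩
  have hCdet : IsUnit C.det := by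
    have h := hA.det_pos
    rw [hC, det_mul, det_transpose] at h
    exact isUnit_iff_ne_zero.2 fun h0 => by simp [h0] at h
  have hCinv : C * C⁻¹ = 1 := mul_nonsing_inv C hCdet
  have hCinv' : C⁻¹ * C = 1 := nonsing_inv_mul C hCdet
  have hCt : Cᵀ * (C⁻¹)ᵀ = 1 := by rw [← transpose_mul, hCinv', transpose_one]
  have hS : ((C⁻¹)ᵀ * B * C⁻¹).PosDef := by
    refine Matrix.posDef_iff_dotProduct_mulVec.2 ⟨?_, fun v hv => ?_⟩
    · have := hB.isHermitian
      simp only [IsHermitian, conjTranspose_eq_transpose_of_trivial] at this ⊢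
      rw [transpose_mul, transpose_mul, transpose_transpose, this, Matrix.mul_assoc]
    · have hv' : C⁻¹ *ᵥ v ≠ 0 := by
        intro h
        apply hv
        have : C *ᵥ (C⁻¹ *ᵥ v) = v := by rw [mulVec_mulVec, hCinv, one_mulVec]
        rw [← this, h, mulVec_zero]
      have := posDef_quad hB hv'
      simpa [Matrix.mul_assoc, ← mulVec_mulVec, dotProduct_mulVec, vecMul_transpose] using this
  set S := (C⁻¹)ᵀ * B * C⁻¹ with hSdef
  set U : Matrix n n ℝ := (hS.isHermitian.eigenvectorUnitary : Matrix n n ℝ) with hU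
  have hUU : U * Uᵀ = 1 := by
    have := Unitary.mul_star_self_of_mem hS.isHermitian.eigenvectorUnitary.2
    simpa [star_eq_conjTranspose] using this
  have hspec : S = U * diagonal hS.isHermitian.eigenvalues * Uᵀ := by
    have := hS.isHermitian.spectral_theorem
    rw [Unitary.conjStarAlgAut_apply] at this
    simpa [star_eq_conjTranspose, Function.comp_def] using this
  refine ⟨Cᵀ * U, hS.isHermitian.eigenvalues, ?_, hS.eigenvalues_pos, ?_, ?_⟩
  · rw [det_mul, det_transpose]
    refine hCdet.mul ?_
    have := congrArg det hUU
    rw [det_mul, det_one] at this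
    exact IsUnit.of_mul_eq_one _ this
  · rw [transpose_mul, transpose_transpose, Matrix.mul_assoc, ← Matrix.mul_assoc U, hUU,
      Matrix.one_mul, hC]
  · rw [transpose_mul, transpose_transpose]
    calc B = (Cᵀ * (C⁻¹)ᵀ) * B * (C⁻¹ * C) := by rw [hCt, hCinv']; simp
      _ = Cᵀ * S * C := by simp only [hSdef, Matrix.mul_assoc]
      _ = _ := by
        conv_lhs => rw [hspec]
        simp only [Matrix.mul_assoc]

variable {A B Q : Matrix n n ℝ} {s : n → ℝ}

theorem dotProduct_diag_mulVec (hB : B = Q * diagonal s * Qᵀ) (u v : n → ℝ) :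
    u ⬝ᵥ B *ᵥ v = ∑ i, s i * ((Qᵀ *ᵥ u) i * (Qᵀ *ᵥ v) i) := by
  rw [hB, ← mulVec_mulVec, ← mulVec_mulVec, dotProduct_mulVec, ← mulVec_transpose]
  simp only [dotProduct, mulVec_diagonal]
  exact Finset.sum_congr rfl fun i _ => by ring

theorem log_det_simultaneous (hQ : IsUnit Q.det) (hs : ∀ i, 0 < s i) (hA : A = Q * Qᵀ)
    (hB : B = Q * diagonal s * Qᵀ) :
    Real.log B.det = Real.log A.det + ∑ i, Real.log (s i) := by
  have hq : Q.det ≠ 0 := hQ.ne_zero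
  have hp : ∏ i, s i ≠ 0 := (Finset.prod_pos fun i _ => hs i).ne'
  rw [hA, hB, det_mul, det_mul, det_mul, det_transpose, det_diagonal,
    ← Real.log_prod (fun i _ => (hs i).ne'), mul_right_comm, Real.log_mul (by positivity) hp]

theorem convexComb_simultaneous (hA : A = Q * Qᵀ) (hB : B = Q * diagonal s * Qᵀ) (ε : ℝ) :
    (1 - ε) • A + ε • B = Q * diagonal (fun i => 1 + ε * (s i - 1)) * Qᵀ := by
  have : diagonal (fun i => 1 + ε * (s i - 1)) = (1 - ε) • (1 : Matrix n n ℝ) + ε • diagonal s := by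
    rw [← diagonal_one, ← diagonal_smul, ← diagonal_smul, diagonal_add]
    congr 1
    ext i
    simp
    ring
  rw [this, hA, hB, Matrix.mul_add, Matrix.add_mul]
  simp

/-- The change `(B - A) u` is controlled, in every direction `v`, by the distance of the relative
spectrum `s` from `1`. -/
theorem abs_dotProduct_sub_le (hA : A = Q * Qᵀ) (hB : B = Q * diagonal s * Qᵀ) (u v : n → ℝ)
    {R : ℝ} (hR : 0 ≤ R) (hR2 : R ^ 2 = ∑ i, (s i - 1) ^ 2) :
    |v ⬝ᵥ B *ᵥ u - v ⬝ᵥ A *ᵥ u| ≤ R * Real.sqrt ((u ⬝ᵥ A *ᵥ u) * (v ⬝ᵥ A *ᵥ v)) := by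
  rw [dotProduct_diag_mulVec hB, dotProduct_mul_transpose_mulVec hA,
    dotProduct_mul_transpose_mulVec hA, dotProduct_mul_transpose_mulVec hA,
    ← Finset.sum_sub_distrib]
  set a := Qᵀ *ᵥ u
  set b := Qᵀ *ᵥ v
  have h1 : (∑ i, (s i * (b i * a i) - b i * a i)) ^ 2 ≤
      R ^ 2 * ((∑ i, a i * a i) * ∑ i, b i * b i) := by
    have e1 : ∑ i, (s i * (b i * a i) - b i * a i) = ∑ i, (s i - 1) * (b i * a i) :=
      Finset.sum_congr rfl fun i _ => by ring
    rw [e1, hR2]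
    refine (Finset.sum_mul_sq_le_sq_mul_sq _ _ _).trans ?_
    refine mul_le_mul_of_nonneg_left ?_ (Finset.sum_nonneg fun _ _ => sq_nonneg _)
    rw [Finset.sum_mul]
    refine Finset.sum_le_sum fun i _ => ?_
    have : b i * b i ≤ ∑ i, b i * b i :=
      Finset.single_le_sum (f := fun i => b i * b i) (fun _ _ => mul_self_nonneg _)
        (Finset.mem_univ i)
    nlinarith [mul_self_nonneg (a i)]
  refine abs_le_of_sq_le_sq ?_ (by positivity)
  rw [mul_pow, Real.sq_sqrt]
  · exact h1
  · exact mul_nonneg (Finset.sum_nonneg fun _ _ => mul_self_nonneg _)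
      (Finset.sum_nonneg fun _ _ => mul_self_nonneg _)

end Diag

/-! ### Pointed frames: the barrier in coordinates centred at the candidate -/

/-- The actions seen from the candidate `xh`: `y x` is the displacement of `x` from `xh`, the
vector `e` represents the functional that is `1` on every action but `xh`, and `P` is the
orthogonal projection onto the complement of the span of the displacements. -/
structure Frame {α : Type*} (X : Finset α) (xh : α) (n : Type*) [Fintype n] where
  y : α → n → ℝ
  e : n → ℝ
  P : Matrix n n ℝ
  base_mem : xh ∈ X
  y_base : y xh = 0
  y_e : ∀ x ∈ X, x ≠ xh → y x ⬝ᵥ e = 1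
  posSemidef : P.PosSemidef
  proj : P * P = P
  P_y : ∀ x ∈ X, P *ᵥ y x = 0
  P_e : P *ᵥ e = 0

namespace Frame

variable {α : Type*} {X : Finset α} {xh : α} {n : Type*} [Fintype n]
  (F : Frame X xh n)

/-- The second moment matrix of the displacements, completed by `P`. -/
def mom (w : α → ℝ) : Matrix n n ℝ := ∑ x ∈ X, w x • vecMulVec (F.y x) (F.y x) + F.P

/-- The covariance of the actions in terms of the displacements; `mom w *ᵥ e` is the mean
displacement. -/
def cov (w : α → ℝ) : Matrix n n ℝ :=
  F.mom w - vecMulVec (F.mom w *ᵥ F.e) (F.mom w *ᵥ F.e)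

theorem mom_mulVec (w : α → ℝ) (v : n → ℝ) :
    F.mom w *ᵥ v = ∑ x ∈ X, (w x * (F.y x ⬝ᵥ v)) • F.y x + F.P *ᵥ v := by
  rw [mom, add_mulVec, sum_mulVec]
  congr 1
  refine Finset.sum_congr rfl fun x _ => ?_
  rw [smul_mulVec, vecMulVec_mulVec, op_smul_eq_smul, smul_smul]

theorem dotProduct_mom_mulVec (w : α → ℝ) (u v : n → ℝ) :
    u ⬝ᵥ F.mom w *ᵥ v = ∑ x ∈ X, w x * ((F.y x ⬝ᵥ u) * (F.y x ⬝ᵥ v)) + u ⬝ᵥ F.P *ᵥ v := by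
  rw [mom_mulVec, dotProduct_add, dotProduct_sum]
  congr 1
  refine Finset.sum_congr rfl fun x _ => ?_
  rw [dotProduct_smul, smul_eq_mul, dotProduct_comm u]
  ring

theorem quad_mom (w : α → ℝ) (v : n → ℝ) :
    v ⬝ᵥ F.mom w *ᵥ v = ∑ x ∈ X, w x * (F.y x ⬝ᵥ v) ^ 2 + v ⬝ᵥ F.P *ᵥ v := by
  rw [dotProduct_mom_mulVec]
  simp only [sq]

theorem mom_mulVec_e (w : α → ℝ) : F.mom w *ᵥ F.e = ∑ x ∈ X, w x • F.y x := by
  rw [mom_mulVec, F.P_e, add_zero]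
  refine Finset.sum_congr rfl fun x hx => ?_
  by_cases h : x = xh
  · simp [h, F.y_base]
  · simp [F.y_e x hx h]

theorem sum_mul_y_e (w : α → ℝ) : ∑ x ∈ X, w x * (F.y x ⬝ᵥ F.e) = ∑ x ∈ X, w x - w xh := by
  classical
  rw [← Finset.add_sum_erase X _ F.base_mem, ← Finset.add_sum_erase X w F.base_mem, F.y_base]
  simp only [zero_dotProduct, mul_zero, zero_add, add_sub_cancel_left]
  refine Finset.sum_congr rfl fun x hx => ?_
  rw [F.y_e x (Finset.mem_of_mem_erase hx) (Finset.ne_of_mem_erase hx), mul_one]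

theorem e_mom_e (w : α → ℝ) : F.e ⬝ᵥ F.mom w *ᵥ F.e = ∑ x ∈ X, w x - w xh := by
  rw [mom_mulVec_e, dotProduct_sum, ← F.sum_mul_y_e]
  refine Finset.sum_congr rfl fun x _ => ?_
  rw [dotProduct_smul, smul_eq_mul, dotProduct_comm]

theorem e_mom_e_of_isDist {w : α → ℝ} (hw : IsDist X w) :
    F.e ⬝ᵥ F.mom w *ᵥ F.e = 1 - w xh := by
  rw [e_mom_e, hw.sum_eq_one]

theorem posSemidef_mom {w : α → ℝ} (hw : ∀ x ∈ X, 0 ≤ w x) : (F.mom w).PosSemidef := by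
  refine PosSemidef.add (posSemidef_sum _ fun x hx => ?_) F.posSemidef
  have : (vecMulVec (F.y x) (F.y x)).PosSemidef := by
    simpa using posSemidef_vecMulVec_self_star (F.y x)
  exact this.smul (hw x hx)

theorem mom_add_smul (p β : α → ℝ) (ε : ℝ) :
    F.mom (fun x => (1 - ε) * p x + ε * β x) = (1 - ε) • F.mom p + ε • F.mom β := by
  simp only [mom, smul_add, Finset.smul_sum, add_smul, Finset.sum_add_distrib, mul_smul]
  have : F.P = (1 - ε) • F.P + ε • F.P := by rw [← add_smul]; simp
  conv_lhs => rw [this]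
  abel

/-- Monotonicity of the second moment in the weights, as quadratic forms. -/
theorem mul_quad_mom_le {w w' : α → ℝ} {c : ℝ} (hc : c ≤ 1) (h : ∀ x ∈ X, x ≠ xh →
    c * w' x ≤ w x) (v : n → ℝ) : c * (v ⬝ᵥ F.mom w' *ᵥ v) ≤ v ⬝ᵥ F.mom w *ᵥ v := by
  rw [quad_mom, quad_mom, mul_add, Finset.mul_sum]
  have hP := posSemidef_quad F.posSemidef v
  refine add_le_add (Finset.sum_le_sum fun x hx => ?_) (by nlinarith)
  by_cases hx' : x = xh
  · simp [hx', F.y_base]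
  · nlinarith [h x hx hx', sq_nonneg (F.y x ⬝ᵥ v)]

theorem posDef_mom_of_le {w w' : α → ℝ} (hw : ∀ x ∈ X, 0 ≤ w x) (hw' : (F.mom w').PosDef)
    {c : ℝ} (hc0 : 0 < c) (hc : c ≤ 1) (h : ∀ x ∈ X, x ≠ xh → c * w' x ≤ w x) :
    (F.mom w).PosDef := by
  refine Matrix.posDef_iff_dotProduct_mulVec.2 ⟨(F.posSemidef_mom hw).isHermitian, fun v hv => ?_⟩
  have := F.mul_quad_mom_le hc h v
  have h2 := mul_pos hc0 (posDef_quad hw' hv)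
  simpa using h2.trans_le this

/-- Where there is a second action, `e` is not zero. -/
theorem e_ne_zero {x : α} (hx : x ∈ X) (hne : x ≠ xh) : F.e ≠ 0 := by
  intro h
  have := F.y_e x hx hne
  simp [h] at this

theorem base_lt_one {w : α → ℝ} (hw : IsDist X w) (hM : (F.mom w).PosDef) {x : α}
    (hx : x ∈ X) (hne : x ≠ xh) : w xh < 1 := by
  have := posDef_quad hM (F.e_ne_zero hx hne)
  rw [F.e_mom_e_of_isDist hw] at this
  linarith

theorem isSymm_mom {w : α → ℝ} (hM : (F.mom w).PosDef) : (F.mom w)ᵀ = F.mom w := by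
  have := hM.isHermitian
  simpa [IsHermitian] using this

theorem cov_mulVec {w : α → ℝ} (v : n → ℝ) :
    F.cov w *ᵥ v = F.mom w *ᵥ v - ((F.mom w *ᵥ F.e) ⬝ᵥ v) • (F.mom w *ᵥ F.e) := by
  rw [cov, sub_mulVec, vecMulVec_mulVec, op_smul_eq_smul]

theorem y_P {x : α} (hx : x ∈ X) (v : n → ℝ) : F.y x ⬝ᵥ F.P *ᵥ v = 0 := by
  have hs : F.Pᵀ = F.P := by simpa [IsHermitian] using F.posSemidef.isHermitian
  rw [dotProduct_mulVec, ← mulVec_transpose, hs, F.P_y x hx, zero_dotProduct]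

theorem mom_mul_P (w : α → ℝ) : F.mom w * F.P = F.P := by
  have hs : F.Pᵀ = F.P := by simpa [IsHermitian] using F.posSemidef.isHermitian
  rw [mom, Matrix.add_mul, F.proj, Finset.sum_mul]
  rw [Finset.sum_eq_zero, zero_add]
  intro x hx
  rw [Matrix.smul_mul, vecMulVec_mul, ← mulVec_transpose, hs, F.P_y x hx]
  simp

theorem cov_mulVec_P (w : α → ℝ) (v : n → ℝ) :
    F.cov w *ᵥ (F.P *ᵥ v) = F.P *ᵥ v := by
  rw [cov_mulVec, mulVec_mulVec, mom_mul_P]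
  have h : (F.mom w *ᵥ F.e) ⬝ᵥ F.P *ᵥ v = 0 := by
    rw [mom_mulVec_e, sum_dotProduct]
    exact Finset.sum_eq_zero fun x hx => by rw [smul_dotProduct, F.y_P hx, smul_zero]
  rw [h, zero_smul, sub_zero]

variable [DecidableEq n]

/-- The barrier splits into a part for the second moments and a part for the mass of the candidate. -/
theorem det_cov (w : α → ℝ) (hw : IsDist X w) : (F.cov w).det = (F.mom w).det * w xh := by
  have h : F.cov w = F.mom w * (1 + replicateCol Unit (-F.e) *
      replicateRow Unit (F.mom w *ᵥ F.e)) := by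
    rw [Matrix.mul_add, Matrix.mul_one, ← vecMulVec_eq, mul_vecMulVec, mulVec_neg, neg_vecMulVec,
      cov, sub_eq_add_neg]
  rw [h, det_mul, det_one_add_replicateCol_mul_replicateRow]
  congr 1
  rw [dotProduct_neg, dotProduct_comm, F.e_mom_e_of_isDist hw]
  ring

/-- The determinant of the covariance is positive exactly on the interior of the barrier's
domain. -/
theorem det_cov_pos_iff {w : α → ℝ} (hw : IsDist X w) :
    0 < (F.cov w).det ↔ (F.mom w).PosDef ∧ 0 < w xh := by
  rw [F.det_cov w hw]
  have hs := F.posSemidef_mom hw.nonneg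
  constructor
  · intro h
    have h1 : (F.mom w).det ≠ 0 := fun h0 => by simp [h0] at h
    have h2 := hs.posDef_iff_det_ne_zero.2 h1
    exact ⟨h2, (pos_iff_pos_of_mul_pos h).1 h2.det_pos⟩
  · rintro ⟨h1, h2⟩
    exact mul_pos h1.det_pos h2

theorem isUnit_det_cov {w : α → ℝ} (hw : IsDist X w) (hM : (F.mom w).PosDef)
    (h0 : 0 < w xh) : IsUnit (F.cov w).det :=
  isUnit_iff_ne_zero.2 ((F.det_cov_pos_iff hw).2 ⟨hM, h0⟩).ne'

/-! ### The estimator -/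

/-- The direction `Cov⁻¹ (y a - μ)` of the loss estimator when the action `a` is played. -/
def dir (w : α → ℝ) (a : α) : n → ℝ := (F.cov w)⁻¹ *ᵥ (F.y a - F.mom w *ᵥ F.e)

/-- The estimator of the loss difference between `x` and the candidate, per unit of observed loss,
when the action `a` is played. -/
def kap (w : α → ℝ) (a x : α) : ℝ := F.y x ⬝ᵥ F.dir w a

theorem inv_mulVec_eq_of_mulVec_eq {A : Matrix n n ℝ} (hA : IsUnit A.det) {u v : n → ℝ}
    (h : A *ᵥ u = v) : A⁻¹ *ᵥ v = u := by
  rw [← h, mulVec_mulVec, nonsing_inv_mul A hA, one_mulVec]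

/-- For an action other than the candidate the two rank-one corrections cancel, and the covariance
may be replaced by the second moment. -/
theorem dir_of_ne {w : α → ℝ} (hw : IsDist X w) (hM : (F.mom w).PosDef) (h0 : 0 < w xh)
    {a : α} (ha : a ∈ X) (hne : a ≠ xh) : F.dir w a = (F.mom w)⁻¹ *ᵥ F.y a := by
  have hu : IsUnit (F.mom w).det := isUnit_iff_ne_zero.2 hM.det_pos.ne'
  apply inv_mulVec_eq_of_mulVec_eq (F.isUnit_det_cov hw hM h0)
  have h1 : F.mom w *ᵥ ((F.mom w)⁻¹ *ᵥ F.y a) = F.y a := by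
    rw [mulVec_mulVec, mul_nonsing_inv _ hu, one_mulVec]
  rw [cov_mulVec, h1]
  congr 1
  have h2 : (F.mom w *ᵥ F.e) ⬝ᵥ ((F.mom w)⁻¹ *ᵥ F.y a) = 1 := by
    have : F.mom w *ᵥ F.e = F.e ᵥ* F.mom w := by
      conv_lhs => rw [← F.isSymm_mom hM]
      rw [mulVec_transpose]
    rw [this, ← dotProduct_mulVec, h1, dotProduct_comm, F.y_e a ha hne]
  rw [h2, one_smul]

theorem dir_base {w : α → ℝ} (hw : IsDist X w) (hM : (F.mom w).PosDef) (h0 : 0 < w xh) :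
    F.dir w xh = -(1 / w xh) • F.e := by
  apply inv_mulVec_eq_of_mulVec_eq (F.isUnit_det_cov hw hM h0)
  rw [cov_mulVec, F.y_base, mulVec_smul, dotProduct_smul, dotProduct_comm,
    F.e_mom_e_of_isDist hw, ← sub_smul, zero_sub]
  rw [← neg_one_smul ℝ (F.mom w *ᵥ F.e)]
  congr 1
  simp only [smul_eq_mul]
  field_simp
  ring

/-- Unbiasedness: in the mean over the played action `a ∼ w`, the estimator recovers differences of
every affine loss function. -/
theorem sum_mul_kap {w : α → ℝ} (hw : IsDist X w) (hM : (F.mom w).PosDef) (h0 : 0 < w xh)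
    {f : α → ℝ} {f₀ : ℝ} {θ : n → ℝ} (hf : ∀ x ∈ X, f x = f₀ + F.y x ⬝ᵥ θ) {x : α}
    (hx : x ∈ X) : ∑ a ∈ X, w a * f a * F.kap w a x = F.y x ⬝ᵥ θ := by
  have hu := F.isUnit_det_cov hw hM h0
  have h1 : ∑ a ∈ X, (w a * f a) • (F.y a - F.mom w *ᵥ F.e) = F.cov w *ᵥ (θ - F.P *ᵥ θ) := by
    rw [mulVec_sub, cov_mulVec_P F w, cov_mulVec, mom_mulVec_e, mom_mulVec]
    set z := ∑ x ∈ X, w x • F.y x with hz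
    have h2 : ∑ a ∈ X, (w a * f a) • (F.y a - z) = ∑ a ∈ X, ((w a * (F.y a ⬝ᵥ θ)) • F.y a
        + f₀ • (w a • F.y a) - (w a * (F.y a ⬝ᵥ θ)) • z - (f₀ * w a) • z) := by
      refine Finset.sum_congr rfl fun a ha => ?_
      rw [hf a ha]
      module
    rw [h2, Finset.sum_sub_distrib, Finset.sum_sub_distrib, Finset.sum_add_distrib,
      ← Finset.smul_sum, ← Finset.sum_smul, ← Finset.sum_smul, ← Finset.mul_sum,
      hw.sum_eq_one, ← hz]
    have h3 : ∑ a ∈ X, w a * (F.y a ⬝ᵥ θ) = z ⬝ᵥ θ := by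
      rw [hz, sum_dotProduct]
      exact Finset.sum_congr rfl fun a _ => by rw [smul_dotProduct, smul_eq_mul]
    rw [h3]
    module
  have h4 : ∑ a ∈ X, w a * f a * F.kap w a x =
      F.y x ⬝ᵥ ((F.cov w)⁻¹ *ᵥ ∑ a ∈ X, (w a * f a) • (F.y a - F.mom w *ᵥ F.e)) := by
    rw [mulVec_sum, dotProduct_sum]
    refine Finset.sum_congr rfl fun a _ => ?_
    rw [mulVec_smul, dotProduct_smul, smul_eq_mul, kap, dir]
  rw [h4, h1, mulVec_mulVec, nonsing_inv_mul _ hu, one_mulVec, dotProduct_sub, F.y_P hx, sub_zero]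

/-- The mean squared local norm of the estimator is at most the dimension. -/
theorem sum_mul_kap_self_le {w : α → ℝ} (hM : (F.mom w).PosDef) :
    ∑ x ∈ X, w x * (F.y x ⬝ᵥ (F.mom w)⁻¹ *ᵥ F.y x) ≤ Fintype.card n := by
  have hu : IsUnit (F.mom w).det := isUnit_iff_ne_zero.2 hM.det_pos.ne'
  have h1 : ∑ x ∈ X, w x * (F.y x ⬝ᵥ (F.mom w)⁻¹ *ᵥ F.y x) =
      ((F.mom w)⁻¹ * (F.mom w - F.P)).trace := by
    have : F.mom w - F.P = ∑ x ∈ X, w x • vecMulVec (F.y x) (F.y x) := by rw [mom]; abel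
    rw [this, Finset.mul_sum, trace_sum]
    refine Finset.sum_congr rfl fun x _ => ?_
    rw [Matrix.mul_smul, mul_vecMulVec, trace_smul, trace_vecMulVec, smul_eq_mul,
      dotProduct_comm]
  have h2 : (F.mom w)⁻¹ * F.P = F.P := by
    conv_lhs => rw [← F.mom_mul_P w]
    rw [← Matrix.mul_assoc, nonsing_inv_mul _ hu, Matrix.one_mul]
  rw [h1, Matrix.mul_sub, nonsing_inv_mul _ hu, h2, trace_sub, trace_one]
  have := F.posSemidef.trace_nonneg
  linarith

/-! ### Optimality and stability of the barrier-regularised minimiser -/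

/-- The regularised objective `⟨w, c⟩ - η⁻¹ log det Cov(w)` with cost vector `c`. -/
def obj (c : α → ℝ) (η : ℝ) (w : α → ℝ) : ℝ :=
  ∑ x ∈ X, w x * c x - 1 / η * Real.log (F.cov w).det

/-- `p` minimises the regularised objective over the feasible distributions. -/
structure IsMin (c : α → ℝ) (η : ℝ) (p : α → ℝ) : Prop where
  isDist : IsDist X p
  posDef : (F.mom p).PosDef
  base_pos : 0 < p xh
  le : ∀ w, IsDist X w → 0 < (F.cov w).det → F.obj c η p ≤ F.obj c η w

theorem log_det_cov {w : α → ℝ} (hw : IsDist X w) (hM : (F.mom w).PosDef) (h0 : 0 < w xh) :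
    Real.log (F.cov w).det = Real.log (F.mom w).det + Real.log (w xh) := by
  rw [F.det_cov w hw, Real.log_mul hM.det_pos.ne' h0.ne']

theorem isDist_convexComb {α : Type*} {X : Finset α} {p β : α → ℝ} (hp : IsDist X p)
    (hβ : IsDist X β) {ε : ℝ} (h0 : 0 ≤ ε) (h1 : ε ≤ 1) :
    IsDist X (fun x => (1 - ε) * p x + ε * β x) where
  nonneg x hx := add_nonneg (mul_nonneg (by linarith) (hp.nonneg x hx))
    (mul_nonneg h0 (hβ.nonneg x hx))
  sum_eq_one := by
    rw [Finset.sum_add_distrib, ← Finset.mul_sum, ← Finset.mul_sum, hp.sum_eq_one, hβ.sum_eq_one]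
    ring
  zero_off x hx := by rw [hp.zero_off x hx, hβ.zero_off x hx]; ring

/-- A function vanishing at `0` and nonnegative to the right has nonnegative derivative there. -/
theorem deriv_nonneg_of_nonneg_right {f : ℝ → ℝ} {f' : ℝ} (hf : HasDerivAt f f' 0) (h0 : f 0 = 0)
    (hpos : ∀ t, 0 < t → t < 1 → 0 ≤ f t) : 0 ≤ f' := by
  have h := hf.tendsto_slope_zero_right
  refine ge_of_tendsto h ?_
  filter_upwards [Ioo_mem_nhdsGT (show (0 : ℝ) < 1 by norm_num)] with t ht
  simp only [zero_add, h0, sub_zero, smul_eq_mul]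
  exact mul_nonneg (inv_nonneg.2 ht.1.le) (hpos t ht.1 ht.2)

/-- The first-order optimality condition, in the coordinates that diagonalise the second moments
of `p` and `β` simultaneously. -/
theorem IsMin.first_order {c : α → ℝ} {η : ℝ} {p β : α → ℝ} (hp : F.IsMin c η p)
    (hβ : IsDist X β) {Q : Matrix n n ℝ} {s : n → ℝ} (hQ : IsUnit Q.det) (hs : ∀ i, 0 < s i)
    (hA : F.mom p = Q * Qᵀ) (hB : F.mom β = Q * diagonal s * Qᵀ) (hβ0 : 0 < β xh) :
    1 / η * (∑ i, (s i - 1) + (β xh / p xh - 1)) ≤ ∑ x ∈ X, (β x - p x) * c x := by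
  set b := β xh / p xh with hb
  have hb0 : 0 < b := div_pos hβ0 hp.base_pos
  set f : ℝ → ℝ := fun ε => ε * (∑ x ∈ X, (β x - p x) * c x) -
    1 / η * (∑ i, Real.log (1 + ε * (s i - 1)) + Real.log (1 + ε * (b - 1))) with hf
  have hpos1 : ∀ (a : ℝ), 0 < a → ∀ t : ℝ, 0 < t → t < 1 → 0 < 1 + t * (a - 1) := by
    intro a ha t ht0 ht1
    nlinarith [mul_pos ht0 ha]
  have hder : HasDerivAt f ((∑ x ∈ X, (β x - p x) * c x) -
      1 / η * (∑ i, (s i - 1) + (b - 1))) 0 := by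
    have hl : ∀ a : ℝ, HasDerivAt (fun ε : ℝ => Real.log (1 + ε * a)) a 0 := by
      intro a
      have h1 : HasDerivAt (fun ε : ℝ => 1 + ε * a) a 0 := by
        simpa using ((hasDerivAt_id (0 : ℝ)).mul_const a).const_add 1
      simpa using h1.log (by simp)
    have h2 : HasDerivAt (fun ε : ℝ => ∑ i, Real.log (1 + ε * (s i - 1))) (∑ i, (s i - 1)) 0 := by
      have := HasDerivAt.fun_sum (u := Finset.univ) fun i (_ : i ∈ Finset.univ) => hl (s i - 1)
      simpa using this
    have h3 := (h2.add (hl (b - 1))).const_mul (1 / η)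
    have h4 : HasDerivAt (fun ε : ℝ => ε * ∑ x ∈ X, (β x - p x) * c x)
        (∑ x ∈ X, (β x - p x) * c x) 0 := by
      simpa using (hasDerivAt_id (0 : ℝ)).mul_const (∑ x ∈ X, (β x - p x) * c x)
    exact h4.sub h3
  have := deriv_nonneg_of_nonneg_right hder (by simp [hf]) ?_
  · linarith
  intro t ht0 ht1
  set w : α → ℝ := fun x => (1 - t) * p x + t * β x with hw
  have hwd : IsDist X w := isDist_convexComb hp.isDist hβ ht0.le ht1.le
  have hwM : (F.mom w).PosDef := F.posDef_mom_of_le hwd.nonneg hp.posDef (c := 1 - t)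
    (by linarith) (by linarith)
    fun x hx _ => by have := mul_nonneg ht0.le (hβ.nonneg x hx); simp only [hw]; linarith
  have hw0 : w xh = p xh * (1 + t * (b - 1)) := by
    have := hp.base_pos.ne'
    simp only [hw, hb]
    field_simp
    ring
  have hw0' : 0 < w xh := by rw [hw0]; exact mul_pos hp.base_pos (hpos1 b hb0 t ht0 ht1)
  have hle := hp.le w hwd ((F.det_cov_pos_iff hwd).2 ⟨hwM, hw0'⟩)
  have hdetw : Real.log (F.mom w).det = Real.log (F.mom p).det +
      ∑ i, Real.log (1 + t * (s i - 1)) := by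
    refine log_det_simultaneous hQ (fun i => hpos1 _ (hs i) t ht0 ht1) hA ?_
    rw [hw, mom_add_smul, convexComb_simultaneous hA hB]
  rw [obj, obj, F.log_det_cov hwd hwM hw0', F.log_det_cov hp.isDist hp.posDef hp.base_pos, hdetw,
    hw0, Real.log_mul hp.base_pos.ne' (hpos1 b hb0 t ht0 ht1).ne'] at hle
  have hlin : ∑ x ∈ X, w x * c x = ∑ x ∈ X, p x * c x + t * ∑ x ∈ X, (β x - p x) * c x := by
    rw [Finset.mul_sum, ← Finset.sum_add_distrib]
    exact Finset.sum_congr rfl fun x _ => by simp only [hw]; ring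
  rw [hlin] at hle
  simp only [hf]
  linarith

/-- Strong optimality: the objective at a competitor exceeds the minimum by the Bregman divergence
of the barrier, here split into its two logarithmic parts. -/
theorem IsMin.add_bregman_le {c : α → ℝ} {η : ℝ} {p β : α → ℝ} (hp : F.IsMin c η p)
    (hβ : IsDist X β) (hMβ : (F.mom β).PosDef) {Q : Matrix n n ℝ} {s : n → ℝ}
    (hQ : IsUnit Q.det) (hs : ∀ i, 0 < s i)
    (hA : F.mom p = Q * Qᵀ) (hB : F.mom β = Q * diagonal s * Qᵀ) (hβ0 : 0 < β xh) :
    F.obj c η p + 1 / η * (∑ i, (s i - 1 - Real.log (s i)) +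
      (β xh / p xh - 1 - Real.log (β xh / p xh))) ≤ F.obj c η β := by
  have h := hp.first_order F hβ hQ hs hA hB hβ0
  rw [obj, obj, F.log_det_cov hβ hMβ hβ0, F.log_det_cov hp.isDist hp.posDef hp.base_pos,
    log_det_simultaneous hQ hs hA hB, Real.log_div hβ0.ne' hp.base_pos.ne',
    Finset.sum_sub_distrib]
  have hlin : ∑ x ∈ X, β x * c x = ∑ x ∈ X, p x * c x + ∑ x ∈ X, (β x - p x) * c x := by
    rw [← Finset.sum_add_distrib]
    exact Finset.sum_congr rfl fun x _ => by ring
  rw [hlin]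
  linarith

/-- One step of the regularised leader against a linear perturbation `v` of small local norm. -/
theorem IsMin.step {c : α → ℝ} {η : ℝ} (hη : 0 < η) {p β : α → ℝ} (hp : F.IsMin c η p)
    (hβ : IsDist X β) (hMβ : (F.mom β).PosDef) (hβ0 : 0 < β xh) {v : n → ℝ}
    (hv : η ^ 2 * ((1 - p xh) * (v ⬝ᵥ F.mom p *ᵥ v)) ≤ 1 / 6) :
    F.obj c η p + ∑ x ∈ X, (p x - β x) * (F.y x ⬝ᵥ v) ≤
      F.obj c η β + 3 * η * ((1 - p xh) * (v ⬝ᵥ F.mom p *ᵥ v)) := by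
  obtain ⟨Q, s, hQ, hs, hA, hB⟩ := exists_simultaneous_diagonalization hp.posDef hMβ
  have h1 := hp.add_bregman_le F hβ hMβ hQ hs hA hB hβ0
  have h2 := sub_one_sub_log_nonneg (div_pos hβ0 hp.base_pos)
  set R := Real.sqrt (∑ i, (s i - 1) ^ 2) with hR
  have hR0 : 0 ≤ R := Real.sqrt_nonneg _
  have hR2 : R ^ 2 = ∑ i, (s i - 1) ^ 2 :=
    Real.sq_sqrt (Finset.sum_nonneg fun _ _ => sq_nonneg _)
  have h3 := sq_div_le_sum_sub_one_sub_log hs hR0 hR2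
  have h4 := abs_dotProduct_sub_le hA hB F.e v hR0 hR2
  rw [F.e_mom_e_of_isDist hp.isDist] at h4
  have hnn : 0 ≤ (1 - p xh) * (v ⬝ᵥ F.mom p *ᵥ v) := by
    refine mul_nonneg ?_ (posSemidef_quad hp.posDef.posSemidef v)
    rw [← F.e_mom_e_of_isDist hp.isDist]
    exact posSemidef_quad hp.posDef.posSemidef _
  set m := (1 - p xh) * (v ⬝ᵥ F.mom p *ᵥ v) with hm
  have h5 : ∑ x ∈ X, (p x - β x) * (F.y x ⬝ᵥ v) =
      -(v ⬝ᵥ F.mom β *ᵥ F.e - v ⬝ᵥ F.mom p *ᵥ F.e) := by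
    rw [mom_mulVec_e, mom_mulVec_e, dotProduct_sum, dotProduct_sum, ← Finset.sum_sub_distrib,
      ← Finset.sum_neg_distrib]
    refine Finset.sum_congr rfl fun x _ => ?_
    rw [dotProduct_smul, dotProduct_smul, smul_eq_mul, smul_eq_mul, dotProduct_comm v]
    ring
  have ha2 : (η * Real.sqrt m) ^ 2 = η ^ 2 * m := by rw [mul_pow, Real.sq_sqrt hnn]
  have h6 := mul_le_sq_div_add (a := η * Real.sqrt m) (by positivity) (by rw [ha2]; exact hv) hR0
  rw [ha2] at h6
  have h7 : ∑ x ∈ X, (p x - β x) * (F.y x ⬝ᵥ v) ≤ R * Real.sqrt m := by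
    rw [h5]
    exact (neg_le_abs _).trans h4
  have h8 : R * Real.sqrt m ≤ 1 / η * (∑ i, (s i - 1 - Real.log (s i))) + 3 * η * m := by
    have : R * Real.sqrt m = 1 / η * (η * Real.sqrt m * R) := by field_simp
    rw [this]
    have h9 : 1 / η * (η * Real.sqrt m * R) ≤
        1 / η * ((∑ i, (s i - 1 - Real.log (s i))) + 3 * (η ^ 2 * m)) :=
      mul_le_mul_of_nonneg_left (by linarith) (by positivity)
    refine h9.trans (le_of_eq ?_)
    field_simp
  have h10 : 0 ≤ 1 / η * (β xh / p xh - 1 - Real.log (β xh / p xh)) := by positivity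
  rw [mul_add] at h1
  linarith

/-- One step of the regularised leader against a perturbation that only distinguishes the candidate
from the other actions: the part `-log w(xh)` of the barrier suffices. -/
theorem IsMin.step_base {c : α → ℝ} {η : ℝ} (hη : 0 < η) {p β : α → ℝ} (hp : F.IsMin c η p)
    (hβ : IsDist X β) (hMβ : (F.mom β).PosDef) (hβ0 : 0 < β xh) {r : ℝ}
    (hr : (η * (r * p xh)) ^ 2 ≤ 1 / 6) :
    F.obj c η p + ∑ x ∈ X, (p x - β x) * (F.y x ⬝ᵥ (r • F.e)) ≤
      F.obj c η β + 3 * η * (r * p xh) ^ 2 := by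
  obtain ⟨Q, s, hQ, hs, hA, hB⟩ := exists_simultaneous_diagonalization hp.posDef hMβ
  have h1 := hp.add_bregman_le F hβ hMβ hQ hs hA hB hβ0
  have h2 : 0 ≤ ∑ i, (s i - 1 - Real.log (s i)) :=
    Finset.sum_nonneg fun i _ => sub_one_sub_log_nonneg (hs i)
  have h3 := sq_div_le_sub_one_sub_log (div_pos hβ0 hp.base_pos)
  set b := β xh / p xh with hb
  have h5 : ∑ x ∈ X, (p x - β x) * (F.y x ⬝ᵥ (r • F.e)) = r * p xh * (b - 1) := by
    have h6 := F.sum_mul_y_e fun x => p x - β x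
    rw [Finset.sum_sub_distrib, hp.isDist.sum_eq_one, hβ.sum_eq_one] at h6
    have h7 : ∑ x ∈ X, (p x - β x) * (F.y x ⬝ᵥ (r • F.e)) =
        r * ∑ x ∈ X, (p x - β x) * (F.y x ⬝ᵥ F.e) := by
      rw [Finset.mul_sum]
      refine Finset.sum_congr rfl fun x _ => ?_
      rw [dotProduct_smul, smul_eq_mul]
      ring
    have := hp.base_pos.ne'
    rw [h7, h6, hb]
    field_simp
    ring
  have h6 := mul_le_sq_div_add (a := η * |r * p xh|) (by positivity)
    (by rw [mul_pow, sq_abs, ← mul_pow]; exact hr) (abs_nonneg (b - 1))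
  rw [sq_abs, mul_pow, sq_abs] at h6
  have h8 : r * p xh * (b - 1) ≤ 1 / η * (b - 1 - Real.log b) + 3 * η * (r * p xh) ^ 2 := by
    have h9 : r * p xh * (b - 1) ≤ |r * p xh| * |b - 1| := by
      rw [← abs_mul]; exact le_abs_self _
    refine h9.trans ?_
    have : |r * p xh| * |b - 1| = 1 / η * (η * |r * p xh| * |b - 1|) := by field_simp
    rw [this]
    have h9 : 1 / η * (η * |r * p xh| * |b - 1|) ≤
        1 / η * ((b - 1 - Real.log b) + 3 * (η ^ 2 * (r * p xh) ^ 2)) :=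
      mul_le_mul_of_nonneg_left (by linarith) (by positivity)
    refine h9.trans (le_of_eq ?_)
    field_simp
  have h10 : 0 ≤ 1 / η * ∑ i, (s i - 1 - Real.log (s i)) := by positivity
  rw [mul_add] at h1
  rw [h5]
  linarith

end Frame

/-! ### The sampling distribution -/

/-- The mixture `(1 - ε) p + ε ((1 - p(xh)) π + p(xh) δ_xh)`. -/
def mix {α : Type*} (xh : α) (p π : α → ℝ) (ε : ℝ) (x : α) : ℝ :=
  open Classical in
  (1 - ε) * p x + ε * ((1 - p xh) * π x + p xh * (if x = xh then 1 else 0))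

theorem IsDist.le_one {α : Type*} {S : Finset α} {w : α → ℝ} (hw : IsDist S w) {x : α}
    (hx : x ∈ S) : w x ≤ 1 := by
  rw [← hw.sum_eq_one]
  exact Finset.single_le_sum hw.nonneg hx

section Mix

variable {α : Type*} [DecidableEq α] {X : Finset α} {xh : α} {p π : α → ℝ} {ε : ℝ}

theorem mix_base (hπ : IsDist (X.erase xh) π) : mix xh p π ε xh = p xh := by
  simp [mix, hπ.zero_off xh (Finset.notMem_erase _ _)]
  ring

theorem isDist_mix (hxh : xh ∈ X) (hp : IsDist X p) (hπ : IsDist (X.erase xh) π) (h0 : 0 ≤ ε)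
    (h1 : ε ≤ 1) : IsDist X (mix xh p π ε) where
  nonneg x hx := by
    have hπx : 0 ≤ π x := by
      by_cases h : x = xh
      · rw [hπ.zero_off x (by simp [h])]
      · exact hπ.nonneg x (Finset.mem_erase.2 ⟨h, hx⟩)
    have := hp.nonneg x hx
    have := hp.nonneg xh hxh
    have := hp.le_one hxh
    unfold mix
    refine add_nonneg (mul_nonneg (by linarith) (by assumption)) (mul_nonneg h0
      (add_nonneg (mul_nonneg (by linarith) hπx) (mul_nonneg (by assumption) ?_)))
    split_ifs <;> norm_num
  sum_eq_one := by
    have h2 : ∑ x ∈ X, π x = 1 := by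
      rw [← hπ.sum_eq_one, ← Finset.add_sum_erase X _ hxh,
        hπ.zero_off xh (Finset.notMem_erase _ _), zero_add]
    unfold mix
    rw [Finset.sum_add_distrib, ← Finset.mul_sum, ← Finset.mul_sum, Finset.sum_add_distrib,
      ← Finset.mul_sum, ← Finset.mul_sum, hp.sum_eq_one, h2]
    have h3 : ∑ x ∈ X, (if x = xh then (1 : ℝ) else 0) = 1 := by simp [hxh]
    convert (by rw [h3]; ring : (1 - ε) * 1 + ε * ((1 - p xh) * 1 +
      p xh * ∑ x ∈ X, (if x = xh then (1 : ℝ) else 0)) = 1)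
  zero_off x hx := by
    have hne : x ≠ xh := fun h => hx (h ▸ hxh)
    simp [mix, hp.zero_off x hx, hπ.zero_off x (fun h => hx (Finset.mem_of_mem_erase h)), hne]

theorem mul_le_mix (hp : IsDist X p) (hπ : IsDist (X.erase xh) π) (hxh : xh ∈ X) (h0 : 0 ≤ ε)
    {x : α} (hx : x ∈ X) (hne : x ≠ xh) : (1 - ε) * p x ≤ mix xh p π ε x := by
  have := hp.le_one hxh
  have := hπ.nonneg x (Finset.mem_erase.2 ⟨hne, hx⟩)
  simp only [mix, hne, if_false, mul_zero, add_zero]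
  have : 0 ≤ ε * ((1 - p xh) * π x) := mul_nonneg h0 (mul_nonneg (by linarith) (by assumption))
  linarith

theorem mul_le_mix' (hp : IsDist X p) (h1 : ε ≤ 1) {x : α} (hx : x ∈ X) (hne : x ≠ xh) :
    ε * (1 - p xh) * π x ≤ mix xh p π ε x := by
  have : 0 ≤ (1 - ε) * p x := mul_nonneg (by linarith) (hp.nonneg x hx)
  simp only [mix, hne, if_false, mul_zero, add_zero]
  linarith

/-- Mixing moves mass only among the actions other than the candidate. -/
theorem sum_abs_mix_sub_le (hxh : xh ∈ X) (hp : IsDist X p) (hπ : IsDist (X.erase xh) π)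
    (h0 : 0 ≤ ε) : ∑ x ∈ X, |mix xh p π ε x - p x| ≤ 2 * (ε * (1 - p xh)) := by
  have hq : 0 ≤ 1 - p xh := by linarith [hp.le_one hxh]
  rw [← Finset.add_sum_erase X _ hxh, mix_base hπ, sub_self, abs_zero, zero_add]
  have h2 : ∑ x ∈ X.erase xh, p x = 1 - p xh := by
    rw [← hp.sum_eq_one, ← Finset.add_sum_erase X _ hxh]; ring
  calc ∑ x ∈ X.erase xh, |mix xh p π ε x - p x|
      ≤ ∑ x ∈ X.erase xh, (ε * p x + ε * (1 - p xh) * π x) := by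
        refine Finset.sum_le_sum fun x hx => ?_
        have hpx := hp.nonneg x (Finset.mem_of_mem_erase hx)
        have hπx := hπ.nonneg x hx
        have e1 : mix xh p π ε x - p x = -(ε * p x) + ε * (1 - p xh) * π x := by
          simp only [mix, Finset.ne_of_mem_erase hx, if_false]; ring
        rw [e1]
        refine (abs_add_le _ _).trans (le_of_eq ?_)
        rw [abs_neg, abs_of_nonneg (by positivity), abs_of_nonneg (by positivity)]
    _ = 2 * (ε * (1 - p xh)) := by
        rw [Finset.sum_add_distrib, ← Finset.mul_sum, ← Finset.mul_sum, h2, hπ.sum_eq_one]; ring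

end Mix

namespace Frame

variable {α : Type*} [DecidableEq α] {X : Finset α} {xh : α} {n : Type*} [Fintype n]
  [DecidableEq n] (F : Frame X xh n)

/-- The exploration `π` reaches every action other than the candidate, in every direction `v`, with
variance at least a fraction `1 / dim` of the squared displacement. -/
def Explores (π : α → ℝ) : Prop :=
  IsDist (X.erase xh) π ∧
    ∀ x ∈ X, x ≠ xh → ∀ v, (F.y x ⬝ᵥ v) ^ 2 ≤ Fintype.card n * (v ⬝ᵥ F.mom π *ᵥ v)

/-- The data of one round: a candidate, the regularised minimiser `p`, an exploration `π`, and a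
learning rate `η ≤ 1 / (4 dim)`. -/
structure IsRound (η : ℝ) (p π : α → ℝ) : Prop where
  isDist : IsDist X p
  posDef : (F.mom p).PosDef
  base_pos : 0 < p xh
  explores : F.Explores π
  eta_pos : 0 < η
  eta_le : η * Fintype.card n ≤ 1 / 4
  two_le_card : 2 ≤ Fintype.card n

/-- The sampling distribution of a round. -/
abbrev sampling (_ : Frame X xh n) (η : ℝ) (p π : α → ℝ) : α → ℝ :=
  mix xh p π (η * Fintype.card n)

namespace IsRound

variable {F} {η : ℝ} {p π : α → ℝ}

theorem eta_le_eighth (h : F.IsRound η p π) : η ≤ 1 / 8 := by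
  have h2 : (2 : ℝ) ≤ Fintype.card n := by exact_mod_cast h.two_le_card
  nlinarith [h.eta_le, h.eta_pos]

theorem mixing_nonneg (h : F.IsRound η p π) : 0 ≤ η * Fintype.card n :=
  mul_nonneg h.eta_pos.le (Nat.cast_nonneg _)

theorem off_pos (h : F.IsRound η p π) {x : α} (hx : x ∈ X) (hne : x ≠ xh) : 0 < 1 - p xh := by
  have := F.base_lt_one h.isDist h.posDef hx hne
  linarith

theorem off_nonneg (h : F.IsRound η p π) : 0 ≤ 1 - p xh := by
  linarith [h.isDist.le_one F.base_mem]

theorem isDist_sampling (h : F.IsRound η p π) : IsDist X (F.sampling η p π) :=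
  isDist_mix F.base_mem h.isDist h.explores.1 h.mixing_nonneg (h.eta_le.trans (by norm_num))

theorem sampling_base (h : F.IsRound η p π) : F.sampling η p π xh = p xh :=
  mix_base h.explores.1

theorem quad_le (h : F.IsRound η p π) (v : n → ℝ) :
    3 / 4 * (v ⬝ᵥ F.mom p *ᵥ v) ≤ v ⬝ᵥ F.mom (F.sampling η p π) *ᵥ v := by
  refine F.mul_quad_mom_le (by norm_num) (fun x hx hne => ?_) v
  refine le_trans ?_ (mul_le_mix h.isDist h.explores.1 F.base_mem h.mixing_nonneg hx hne)
  exact mul_le_mul_of_nonneg_right (by linarith [h.eta_le]) (h.isDist.nonneg x hx)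

theorem posDef_sampling (h : F.IsRound η p π) : (F.mom (F.sampling η p π)).PosDef := by
  refine F.posDef_mom_of_le h.isDist_sampling.nonneg h.posDef (c := 3 / 4) (by norm_num)
    (by norm_num) fun x hx hne => ?_
  refine le_trans ?_ (mul_le_mix h.isDist h.explores.1 F.base_mem h.mixing_nonneg hx hne)
  exact mul_le_mul_of_nonneg_right (by linarith [h.eta_le]) (h.isDist.nonneg x hx)

/-- Exploration bounds displacements by the second moment of the sampling distribution. -/
theorem sq_le (h : F.IsRound η p π) {x : α} (hx : x ∈ X) (hne : x ≠ xh) (v : n → ℝ) :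
    (F.y x ⬝ᵥ v) ^ 2 ≤
      1 / (η * (1 - p xh)) * (v ⬝ᵥ F.mom (F.sampling η p π) *ᵥ v) := by
  have hq := h.off_pos hx hne
  have hη := h.eta_pos
  have hp0 := h.base_pos
  have hle := h.eta_le
  have hc : (0 : ℝ) < Fintype.card n := by
    have := h.two_le_card
    exact_mod_cast (by omega : 0 < Fintype.card n)
  have h1 := F.mul_quad_mom_le (w := F.sampling η p π) (w' := π)
    (c := η * Fintype.card n * (1 - p xh)) (by nlinarith)
    (fun x hx hne => mul_le_mix' h.isDist (by linarith) hx hne) v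
  refine (h.explores.2 x hx hne v).trans ?_
  rw [one_div_mul_eq_div, le_div_iff₀ (by positivity)]
  linarith

theorem dir_of_ne (h : F.IsRound η p π) {a : α} (ha : a ∈ X) (hne : a ≠ xh) :
    F.dir (F.sampling η p π) a = (F.mom (F.sampling η p π))⁻¹ *ᵥ F.y a :=
  F.dir_of_ne h.isDist_sampling h.posDef_sampling (by rw [h.sampling_base]; exact h.base_pos) ha hne

theorem dir_base (h : F.IsRound η p π) :
    F.dir (F.sampling η p π) xh = -(1 / p xh) • F.e := by
  rw [F.dir_base h.isDist_sampling h.posDef_sampling (by rw [h.sampling_base]; exact h.base_pos),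
    h.sampling_base]

/-- The local norm of the estimator. -/
theorem quad_dir (h : F.IsRound η p π) {a : α} (ha : a ∈ X) (hne : a ≠ xh) :
    F.dir (F.sampling η p π) a ⬝ᵥ F.mom (F.sampling η p π) *ᵥ F.dir (F.sampling η p π) a =
      F.kap (F.sampling η p π) a a := by
  have hu : IsUnit (F.mom (F.sampling η p π)).det :=
    isUnit_iff_ne_zero.2 h.posDef_sampling.det_pos.ne'
  rw [kap, h.dir_of_ne ha hne, mulVec_mulVec, mul_nonsing_inv _ hu, one_mulVec, dotProduct_comm]

theorem kap_self_nonneg (h : F.IsRound η p π) {a : α} (ha : a ∈ X) (hne : a ≠ xh) :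
    0 ≤ F.kap (F.sampling η p π) a a := by
  rw [← h.quad_dir ha hne]
  exact posSemidef_quad h.posDef_sampling.posSemidef _

theorem kap_self_le (h : F.IsRound η p π) {a : α} (ha : a ∈ X) (hne : a ≠ xh) :
    F.kap (F.sampling η p π) a a ≤ 1 / (η * (1 - p xh)) := by
  have h1 := h.sq_le ha hne (F.dir (F.sampling η p π) a)
  rw [h.quad_dir ha hne] at h1
  change F.kap (F.sampling η p π) a a ^ 2 ≤ _ at h1
  have h2 := h.kap_self_nonneg ha hne
  rcases h2.eq_or_lt with h3 | h3
  · rw [← h3]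
    exact one_div_nonneg.2 (mul_nonneg h.eta_pos.le h.off_nonneg)
  · rw [sq] at h1
    exact le_of_mul_le_mul_right h1 h3

theorem abs_kap_le (h : F.IsRound η p π) {a x : α} (ha : a ∈ X) (hx : x ∈ X) :
    |F.kap (F.sampling η p π) a x| ≤ 1 / (η * (1 - p xh)) + 1 / p xh := by
  have h0 : 0 ≤ 1 / (η * (1 - p xh)) :=
    one_div_nonneg.2 (mul_nonneg h.eta_pos.le h.off_nonneg)
  have h0' : 0 ≤ 1 / p xh := one_div_nonneg.2 h.base_pos.le
  by_cases hxx : x = xh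
  · simp only [kap, hxx, F.y_base, zero_dotProduct, abs_zero]
    positivity
  by_cases hne : a = xh
  · subst hne
    rw [kap, h.dir_base, dotProduct_smul, F.y_e x hx hxx, smul_eq_mul, mul_one, abs_neg,
      abs_of_nonneg h0']
    linarith
  · have h1 := h.sq_le hx hxx (F.dir (F.sampling η p π) a)
    rw [h.quad_dir ha hne] at h1
    have h2 : F.kap (F.sampling η p π) a x ^ 2 ≤ (1 / (η * (1 - p xh))) ^ 2 := by
      rw [sq (1 / _)]
      exact h1.trans (mul_le_mul_of_nonneg_left (h.kap_self_le ha hne) h0)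
    have := abs_le_of_sq_le_sq h2 h0
    linarith

/-- Bound on the stability term of a round in which the action `a` is played. -/
def stab (F : Frame X xh n) (η : ℝ) (p π : α → ℝ) (a : α) : ℝ :=
  if a = xh then 6 * η * (1 - p xh)
  else 4 * η * (1 - p xh) * F.kap (F.sampling η p π) a a

theorem stab_nonneg (h : F.IsRound η p π) {a : α} (ha : a ∈ X) : 0 ≤ stab F η p π a := by
  have h1 := h.off_nonneg
  have h2 := h.eta_pos
  unfold stab
  split_ifs with hne
  · positivity
  · have := h.kap_self_nonneg ha hne
    positivity

theorem stab_le (h : F.IsRound η p π) {a : α} (ha : a ∈ X) : stab F η p π a ≤ 4 := by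
  have h1 := h.off_nonneg
  have h2 := h.eta_pos
  have h3 := h.eta_le_eighth
  have h4 := h.base_pos
  unfold stab
  split_ifs with hne
  · nlinarith
  · have h5 := h.off_pos ha hne
    calc 4 * η * (1 - p xh) * F.kap (F.sampling η p π) a a
        ≤ 4 * η * (1 - p xh) * (1 / (η * (1 - p xh))) :=
          mul_le_mul_of_nonneg_left (h.kap_self_le ha hne) (by positivity)
      _ = 4 := by field_simp

/-- The stability inequality: one step of the regularised leader against the loss estimator. -/
theorem obj_add_le (h : F.IsRound η p π) {c : α → ℝ} (hp : F.IsMin c η p) {β : α → ℝ}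
    (hβ : IsDist X β) (hMβ : (F.mom β).PosDef) (hβ0 : 0 < β xh) {a : α} (ha : a ∈ X) {o : ℝ}
    (ho : |o| ≤ 1) :
    F.obj c η p + ∑ x ∈ X, (p x - β x) * (o * F.kap (F.sampling η p π) a x) ≤
      F.obj c η β + stab F η p π a := by
  have hη := h.eta_pos
  have hη8 := h.eta_le_eighth
  have hb := h.base_pos
  have hq := h.off_nonneg
  have ho2 : o ^ 2 ≤ 1 := (sq_le_one_iff_abs_le_one o).2 ho
  have hkap : ∀ x, o * F.kap (F.sampling η p π) a x =
      F.y x ⬝ᵥ (o • F.dir (F.sampling η p π) a) := fun x => by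
    rw [dotProduct_smul, smul_eq_mul, kap]
  simp only [hkap]
  by_cases hne : a = xh
  · subst hne
    have hdir : o • F.dir (F.sampling η p π) a = (-o / p a) • F.e := by
      rw [h.dir_base, smul_smul]
      congr 1
      ring
    rw [hdir, stab, if_pos rfl]
    -- Near the vertex `δ_a` the first part of the barrier would cost a factor `1 / p a`;
    -- there the second part is used instead.
    rcases le_total (1 - p a) (1 / 2) with hhalf | hhalf
    · have hquad : (-o / p a) • F.e ⬝ᵥ F.mom p *ᵥ ((-o / p a) • F.e) =
          o ^ 2 * (1 - p a) / p a ^ 2 := by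
        rw [mulVec_smul, dotProduct_smul, smul_dotProduct, F.e_mom_e_of_isDist h.isDist]
        simp only [smul_eq_mul]
        field_simp
      have hval : (1 - p a) * ((-o / p a) • F.e ⬝ᵥ F.mom p *ᵥ ((-o / p a) • F.e)) ≤
          2 * (1 - p a) := by
        rw [hquad, ← mul_div_assoc, div_le_iff₀ (by positivity)]
        have : o ^ 2 * ((1 - p a) * (1 - p a)) ≤ 1 * ((1 - p a) * (1 / 2)) :=
          mul_le_mul ho2 (mul_le_mul_of_nonneg_left hhalf hq) (by positivity) (by norm_num)
        nlinarith [mul_nonneg hq (by nlinarith : 0 ≤ p a ^ 2 - 1 / 4)]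
      have hs := hp.step F hη hβ hMβ hβ0 (v := (-o / p a) • F.e) (by nlinarith)
      refine hs.trans ?_
      nlinarith
    · have hval : (-o / p a * p a) ^ 2 = o ^ 2 := by
        rw [div_mul_cancel₀ _ hb.ne', neg_sq]
      have hs := hp.step_base F hη hβ hMβ hβ0 (r := -o / p a) (by
        rw [mul_pow, hval]; nlinarith)
      rw [hval] at hs
      refine hs.trans ?_
      nlinarith [mul_nonneg hη.le (sub_nonneg.2 ho2), mul_nonneg hη.le (sub_nonneg.2 hhalf)]
  · rw [stab, if_neg hne]
    have hq' := h.off_pos ha hne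
    have h1 := h.quad_le (o • F.dir (F.sampling η p π) a)
    have h2 : o • F.dir (F.sampling η p π) a ⬝ᵥ
        F.mom (F.sampling η p π) *ᵥ (o • F.dir (F.sampling η p π) a) ≤
        F.kap (F.sampling η p π) a a := by
      rw [mulVec_smul, dotProduct_smul, smul_dotProduct, h.quad_dir ha hne]
      simp only [smul_eq_mul]
      nlinarith [h.kap_self_nonneg ha hne]
    have h3 := h.kap_self_le ha hne
    rw [le_div_iff₀ (by positivity)] at h3
    set m := o • F.dir (F.sampling η p π) a ⬝ᵥ F.mom p *ᵥ (o • F.dir (F.sampling η p π) a)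
    set k := F.kap (F.sampling η p π) a a
    have h4 : (1 - p xh) * m ≤ 4 / 3 * ((1 - p xh) * k) := by nlinarith
    have hs := hp.step F hη hβ hMβ hβ0 (v := o • F.dir (F.sampling η p π) a) (by
      calc η ^ 2 * ((1 - p xh) * m) ≤ η ^ 2 * (4 / 3 * ((1 - p xh) * k)) :=
            mul_le_mul_of_nonneg_left h4 (sq_nonneg _)
        _ = 4 / 3 * η * (k * (η * (1 - p xh))) := by ring
        _ ≤ 4 / 3 * η * 1 := mul_le_mul_of_nonneg_left h3 (by positivity)
        _ ≤ 1 / 6 := by linarith)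
    refine hs.trans ?_
    nlinarith

/-- The expected stability term is of order `η · dim · (1 - p(xh))`. -/
theorem sum_mul_stab_le (h : F.IsRound η p π) :
    ∑ a ∈ X, F.sampling η p π a * stab F η p π a ≤
      10 * (η * Fintype.card n * (1 - p xh)) := by
  have hη := h.eta_pos
  have hq := h.off_nonneg
  have hc : (1 : ℝ) ≤ Fintype.card n := by
    have := h.two_le_card
    exact_mod_cast (by omega : 1 ≤ Fintype.card n)
  have hw := h.isDist_sampling
  have h1 : ∀ a ∈ X, F.sampling η p π a * stab F η p π a ≤
      4 * η * (1 - p xh) * (F.sampling η p π a *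
        (F.y a ⬝ᵥ (F.mom (F.sampling η p π))⁻¹ *ᵥ F.y a)) +
      6 * η * (1 - p xh) * F.sampling η p π a := by
    intro a ha
    have hwa := hw.nonneg a ha
    unfold stab
    split_ifs with hne
    · subst hne
      rw [F.y_base, zero_dotProduct]
      linarith
    · rw [kap, h.dir_of_ne ha hne]
      have : 0 ≤ 6 * η * (1 - p xh) * F.sampling η p π a := by positivity
      linarith
  refine (Finset.sum_le_sum h1).trans ?_
  rw [Finset.sum_add_distrib, ← Finset.mul_sum, ← Finset.mul_sum, hw.sum_eq_one]
  have h2 := F.sum_mul_kap_self_le h.posDef_sampling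
  have h3 : 0 ≤ η * (1 - p xh) := by positivity
  nlinarith

end IsRound

end Frame

/-! ### The frame of the transformed action set -/

section Perp

variable {α : Type*} {ι : Type} [Fintype ι] [DecidableEq ι] (φ : α → Pt ι) (S : Finset α)

theorem inner_eq_dotProduct (u v : Pt ι) : inner ℝ u v = u.ofLp ⬝ᵥ v.ofLp := by
  rw [EuclideanSpace.inner_eq_star_dotProduct, dotProduct_comm]
  simp

theorem perpMat_mulVec (v : ι → ℝ) :
    perpMat φ S *ᵥ v = ((hullDir φ S)ᗮ.starProjection (WithLp.toLp 2 v)).ofLp := by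
  have h : (WithLp.toLp 2 v : Pt ι) = ∑ j, v j • EuclideanSpace.single j (1 : ℝ) := by
    ext i
    simp [Finset.sum_apply, Pi.single_apply]
  ext i
  rw [h, map_sum]
  simp only [mulVec, dotProduct, perpMat, of_apply, map_smul, WithLp.ofLp_sum, Finset.sum_apply,
    WithLp.ofLp_smul, Pi.smul_apply, smul_eq_mul]
  exact Finset.sum_congr rfl fun j _ => mul_comm _ _

theorem dotProduct_perpMat_mulVec (u v : ι → ℝ) :
    u ⬝ᵥ perpMat φ S *ᵥ v =
      inner ℝ (WithLp.toLp 2 u : Pt ι) ((hullDir φ S)ᗮ.starProjection (WithLp.toLp 2 v)) := by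
  rw [perpMat_mulVec, inner_eq_dotProduct]

theorem perpMat_mulVec_of_mem {v : Pt ι} (hv : v ∈ hullDir φ S) : perpMat φ S *ᵥ v.ofLp = 0 := by
  rw [perpMat_mulVec, WithLp.toLp_ofLp,
    Submodule.starProjection_orthogonal_apply_eq_zero hv]
  rfl

theorem transpose_perpMat : (perpMat φ S)ᵀ = perpMat φ S := by
  ext i j
  have h : ∀ i j, perpMat φ S i j = Pi.single i 1 ⬝ᵥ perpMat φ S *ᵥ Pi.single j 1 := fun i j => by
    simp
  rw [transpose_apply, h, h, dotProduct_perpMat_mulVec, dotProduct_perpMat_mulVec,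
    ← Submodule.inner_starProjection_left_eq_right, real_inner_comm]

theorem posSemidef_perpMat : (perpMat φ S).PosSemidef := by
  refine Matrix.posSemidef_iff_dotProduct_mulVec.2 ⟨?_, fun v => ?_⟩
  · simpa [IsHermitian] using transpose_perpMat φ S
  · rw [star_trivial, dotProduct_perpMat_mulVec, real_inner_comm]
    exact Submodule.re_inner_starProjection_nonneg (𝕜 := ℝ) (K := (hullDir φ S)ᗮ) _

theorem perpMat_mul_perpMat : perpMat φ S * perpMat φ S = perpMat φ S := by
  refine Matrix.ext_of_mulVec_single fun j => ?_
  rw [← mulVec_mulVec, perpMat_mulVec, perpMat_mulVec, WithLp.toLp_ofLp,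
    Submodule.starProjection_eq_self_iff.2 (Submodule.starProjection_apply_mem _ _)]

theorem sub_mem_hullDir {a b : α} (ha : a ∈ S) (hb : b ∈ S) : φ a - φ b ∈ hullDir φ S :=
  vsub_mem_vectorSpan ℝ (Set.mem_image_of_mem φ ha) (Set.mem_image_of_mem φ hb)

end Perp

section Lift

variable {d : ℕ} {X : Finset (Pt (Fin d))} {xh : Pt (Fin d)}

/-- The displacement of `x` from the candidate in the transformed action set. -/
def disp (xh x : Pt (Fin d)) : Fin d ⊕ Unit → ℝ := (lift xh x - lift xh xh).ofLp

theorem disp_of_ne {x : Pt (Fin d)} (h : x ≠ xh) :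
    disp xh x = Sum.elim x.ofLp (fun _ => -1) := by
  ext i
  rcases i with i | i <;> simp [disp, lift, h]

theorem disp_dotProduct_elim {x : Pt (Fin d)} (h : x ≠ xh) (v : Fin d ⊕ Unit → ℝ) :
    disp xh x ⬝ᵥ v = x.ofLp ⬝ᵥ (v ∘ Sum.inl) - v (Sum.inr ()) := by
  rw [disp_of_ne h]
  simp [dotProduct, sub_eq_add_neg]

/-- The vector representing, on displacements, the functional that is `1` on every action but the
candidate: the projection of `(0, -1)` to the direction space of the affine hull. -/
def offVec (X : Finset (Pt (Fin d))) (xh : Pt (Fin d)) : Pt (Fin d ⊕ Unit) :=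
  (hullDir (lift xh) X).starProjection (WithLp.toLp 2 (Sum.elim 0 (fun _ => -1)))

theorem disp_dotProduct_offVec (hxh : xh ∈ X) {x : Pt (Fin d)} (hx : x ∈ X) (hne : x ≠ xh) :
    disp xh x ⬝ᵥ (offVec X xh).ofLp = 1 := by
  have h1 : (hullDir (lift xh) X).starProjection (lift xh x - lift xh xh) =
      lift xh x - lift xh xh :=
    Submodule.starProjection_eq_self_iff.2 (sub_mem_hullDir (lift xh) X hx hxh)
  have h2 : disp xh x ⬝ᵥ (offVec X xh).ofLp =
      disp xh x ⬝ᵥ (Sum.elim 0 (fun _ => -1) : Fin d ⊕ Unit → ℝ) := by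
    rw [disp, ← inner_eq_dotProduct, offVec, ← Submodule.inner_starProjection_left_eq_right, h1,
      inner_eq_dotProduct]
  rw [h2, disp_dotProduct_elim hne]
  simp [dotProduct]

theorem perpMat_mulVec_disp (hxh : xh ∈ X) {x : Pt (Fin d)} (hx : x ∈ X) :
    perpMat (lift xh) X *ᵥ disp xh x = 0 :=
  perpMat_mulVec_of_mem (lift xh) X (sub_mem_hullDir (lift xh) X hx hxh)

theorem perpMat_mulVec_offVec : perpMat (lift xh) X *ᵥ (offVec X xh).ofLp = 0 :=
  perpMat_mulVec_of_mem (lift xh) X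
    (Submodule.starProjection_apply_mem (hullDir (lift xh) X) _)

/-- The frame of the action set `X` transformed with candidate `xh`. -/
def liftFrame (X : Finset (Pt (Fin d))) (xh : Pt (Fin d)) (hxh : xh ∈ X) :
    Frame X xh (Fin d ⊕ Unit) where
  y := disp xh
  e := (offVec X xh).ofLp
  P := perpMat (lift xh) X
  base_mem := hxh
  y_base := by simp [disp]
  y_e _ hx hne := disp_dotProduct_offVec hxh hx hne
  posSemidef := posSemidef_perpMat (lift xh) X
  proj := perpMat_mul_perpMat (lift xh) X
  P_y _ hx := perpMat_mulVec_disp hxh hx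
  P_e := perpMat_mulVec_offVec

theorem liftFrame_y (hxh : xh ∈ X) (x : Pt (Fin d)) : (liftFrame X xh hxh).y x = disp xh x := rfl

theorem mean_sub_eq (hxh : xh ∈ X) {w : Pt (Fin d) → ℝ} (hw : IsDist X w) :
    (mean (lift xh) X w - lift xh xh).ofLp =
      (liftFrame X xh hxh).mom w *ᵥ (liftFrame X xh hxh).e := by
  rw [Frame.mom_mulVec_e]
  have h : mean (lift xh) X w - lift xh xh = ∑ x ∈ X, w x • (lift xh x - lift xh xh) := by
    simp only [smul_sub, Finset.sum_sub_distrib, ← Finset.sum_smul, hw.sum_eq_one, one_smul, mean]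
  rw [h, WithLp.ofLp_sum]
  rfl

theorem hullCov_eq_cov (hxh : xh ∈ X) {w : Pt (Fin d) → ℝ} (hw : IsDist X w) :
    hullCov (lift xh) X w = (liftFrame X xh hxh).cov w := by
  rw [hullCov, Frame.cov, ← mean_sub_eq hxh hw, Frame.mom, add_sub_right_comm]
  change _ = _ + perpMat (lift xh) X
  congr 1
  ext i j
  set c := lift xh xh
  have hmean : ∀ k, (mean (lift xh) X w).ofLp k = ∑ x ∈ X, w x * (lift xh x).ofLp k := fun k => by
    simp [mean]
  simp only [covMat, secondMoment, Matrix.sub_apply, Matrix.sum_apply, Matrix.smul_apply,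
    vecMulVec_apply, smul_eq_mul, liftFrame_y, disp, WithLp.ofLp_sub, Pi.sub_apply]
  have h1 : ∑ x ∈ X, w x * (((lift xh x).ofLp i - c.ofLp i) * ((lift xh x).ofLp j - c.ofLp j)) =
      ∑ x ∈ X, w x * ((lift xh x).ofLp i * (lift xh x).ofLp j)
        - c.ofLp j * ∑ x ∈ X, w x * (lift xh x).ofLp i
        - c.ofLp i * ∑ x ∈ X, w x * (lift xh x).ofLp j + c.ofLp i * c.ofLp j * ∑ x ∈ X, w x := by
    rw [Finset.mul_sum, Finset.mul_sum, Finset.mul_sum, ← Finset.sum_sub_distrib,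
      ← Finset.sum_sub_distrib, ← Finset.sum_add_distrib]
    exact Finset.sum_congr rfl fun x _ => by ring
  rw [h1, hmean, hmean, hw.sum_eq_one]
  ring

/-- The loss estimator of the algorithm, as a functional on displacements. -/
theorem disp_dotProduct_inv_hullCov (hxh : xh ∈ X) {w : Pt (Fin d) → ℝ} (hw : IsDist X w)
    (a x : Pt (Fin d)) :
    disp xh x ⬝ᵥ (hullCov (lift xh) X w)⁻¹ *ᵥ (lift xh a - mean (lift xh) X w).ofLp =
      (liftFrame X xh hxh).kap w a x := by
  have h : (lift xh a - mean (lift xh) X w).ofLp =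
      disp xh a - (mean (lift xh) X w - lift xh xh).ofLp := by
    rw [disp, WithLp.ofLp_sub, WithLp.ofLp_sub, WithLp.ofLp_sub, sub_sub_sub_cancel_right]
  rw [h, mean_sub_eq hxh hw, hullCov_eq_cov hxh hw, Frame.kap, Frame.dir, liftFrame_y,
    liftFrame_y]

/-- A linear loss on the actions is affine in the displacement. -/
theorem inner_eq_add_disp (x θ : Pt (Fin d)) :
    inner ℝ x θ = inner ℝ xh θ + disp xh x ⬝ᵥ
      Sum.elim θ.ofLp (fun _ => (inner ℝ xh θ : ℝ)) := by
  by_cases h : x = xh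
  · have h0 : disp xh x = 0 := by rw [h, disp, sub_self, WithLp.ofLp_zero]
    rw [h0, zero_dotProduct, add_zero, h]
  · rw [disp_dotProduct_elim h, inner_eq_dotProduct x]
    have : (Sum.elim θ.ofLp (fun _ => (inner ℝ xh θ : ℝ)) : Fin d ⊕ Unit → ℝ) ∘ Sum.inl =
      θ.ofLp := rfl
    rw [this, Sum.elim_inr]
    ring

theorem sq_dotProduct_mulVec_le {n : Type*} [Fintype n] [DecidableEq n] {M : Matrix n n ℝ}
    (hM : M.PosDef) (u v : n → ℝ) :
    (u ⬝ᵥ M *ᵥ v) ^ 2 ≤ (u ⬝ᵥ M *ᵥ u) * (v ⬝ᵥ M *ᵥ v) := by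
  obtain ⟨Q, s, -, -, hQ, -⟩ := exists_simultaneous_diagonalization hM hM
  rw [dotProduct_mul_transpose_mulVec hQ, dotProduct_mul_transpose_mulVec hQ,
    dotProduct_mul_transpose_mulVec hQ]
  simpa only [← sq] using Finset.sum_mul_sq_le_sq_mul_sq Finset.univ (Qᵀ *ᵥ u) (Qᵀ *ᵥ v)

theorem dotProduct_covMat_mulVec {ι : Type} [Fintype ι] [DecidableEq ι] {S : Finset (Pt ι)}
    {w : Pt ι → ℝ} (hw : IsDist S w) (u : ι → ℝ) :
    u ⬝ᵥ covMat id S w *ᵥ u = ∑ x ∈ S, w x * ((x - mean id S w).ofLp ⬝ᵥ u) ^ 2 := by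
  have hm : (mean id S w).ofLp ⬝ᵥ u = ∑ x ∈ S, w x * (x.ofLp ⬝ᵥ u) := by
    simp [mean, sum_dotProduct]
  have h1 : u ⬝ᵥ covMat id S w *ᵥ u = ∑ x ∈ S, w x * (x.ofLp ⬝ᵥ u) ^ 2
      - ((mean id S w).ofLp ⬝ᵥ u) ^ 2 := by
    rw [covMat, secondMoment, sub_mulVec, dotProduct_sub, sum_mulVec, dotProduct_sum]
    congr 1
    · refine Finset.sum_congr rfl fun x _ => ?_
      rw [smul_mulVec, vecMulVec_mulVec, op_smul_eq_smul, dotProduct_smul, dotProduct_smul,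
        dotProduct_comm u]
      simp only [id, smul_eq_mul]
      ring
    · rw [vecMulVec_mulVec, op_smul_eq_smul, dotProduct_smul, dotProduct_comm u]
      simp only [smul_eq_mul]
      ring
  have h2 : ∑ x ∈ S, w x * ((x - mean id S w).ofLp ⬝ᵥ u) ^ 2 =
      ∑ x ∈ S, w x * (x.ofLp ⬝ᵥ u) ^ 2
        - 2 * ((mean id S w).ofLp ⬝ᵥ u) * ∑ x ∈ S, w x * (x.ofLp ⬝ᵥ u)
        + ((mean id S w).ofLp ⬝ᵥ u) ^ 2 * ∑ x ∈ S, w x := by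
    rw [Finset.mul_sum, Finset.mul_sum, ← Finset.sum_sub_distrib, ← Finset.sum_add_distrib]
    refine Finset.sum_congr rfl fun x _ => ?_
    rw [WithLp.ofLp_sub, sub_dotProduct]
    ring
  rw [h1, h2, hw.sum_eq_one, ← hm]
  ring

/-- A point of the set deviates from the centre, in any direction, by at most `√r` standard
deviations of John's exploration. -/
theorem IsJohnExploration.sq_le {ι : Type} [Fintype ι] [DecidableEq ι] {S : Finset (Pt ι)}
    {w : Pt ι → ℝ} (h : IsJohnExploration S w) {x : Pt ι} (hx : x ∈ S) (v : Pt ι) :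
    (inner ℝ (x - mean id S w) v) ^ 2 ≤
      Fintype.card ι * ∑ z ∈ S, w z * (inner ℝ (z - mean id S w) v) ^ 2 := by
  obtain ⟨hw, c, M, hM, -, hc, hinv⟩ := h
  set V := hullDir id S
  set N := (Module.finrank ℝ V : ℝ) • covMat id S w + perpMat id S with hN
  have hmem : ∀ z ∈ S, z - mean id S w ∈ V := fun z hz => by
    have h1 : z ∈ affineSpan ℝ (S : Set (Pt ι)) := subset_affineSpan _ _ hz
    have h2 := AffineSubspace.vsub_mem_direction h1 (hc.symm ▸ hM.center_mem)
    rw [direction_affineSpan] at h2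
    simpa [V, hullDir] using h2
  set u : Pt ι := V.starProjection v with hu
  have huV : u ∈ V := Submodule.starProjection_apply_mem _ _
  have hproj : ∀ z ∈ S, inner ℝ (z - mean id S w) v = (z - mean id S w).ofLp ⬝ᵥ u.ofLp :=
    fun z hz => by
      rw [← inner_eq_dotProduct, hu, ← Submodule.inner_starProjection_left_eq_right,
        Submodule.starProjection_eq_self_iff.2 (hmem z hz)]
  have hinv' : M * N = 1 := mul_eq_one_comm.1 hinv
  have hNu : u.ofLp ⬝ᵥ N *ᵥ u.ofLp = Module.finrank ℝ V *
      ∑ z ∈ S, w z * (inner ℝ (z - mean id S w) v) ^ 2 := by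
    rw [hN, add_mulVec, dotProduct_add, perpMat_mulVec_of_mem id S huV, dotProduct_zero, add_zero,
      smul_mulVec, dotProduct_smul, dotProduct_covMat_mulVec hw, smul_eq_mul]
    congr 1
    exact Finset.sum_congr rfl fun z hz => by rw [hproj z hz]
  have hcs := sq_dotProduct_mulVec_le hM.posDef (x - mean id S w).ofLp (N *ᵥ u.ofLp)
  have h1 : M *ᵥ (N *ᵥ u.ofLp) = u.ofLp := by rw [mulVec_mulVec, hinv', one_mulVec]
  rw [h1, dotProduct_comm (N *ᵥ u.ofLp), hNu, ← hproj x hx] at hcs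
  have h2 := hM.encloses x hx
  rw [← hc] at h2
  have h3 : (0 : ℝ) ≤ ∑ z ∈ S, w z * (inner ℝ (z - mean id S w) v) ^ 2 :=
    Finset.sum_nonneg fun z hz => mul_nonneg (hw.nonneg z hz) (sq_nonneg _)
  have h4 : (Module.finrank ℝ V : ℝ) ≤ Fintype.card ι := by
    have := Submodule.finrank_le V
    rw [finrank_euclideanSpace] at this
    exact_mod_cast this
  refine hcs.trans ((mul_le_of_le_one_left (by positivity) h2).trans ?_)
  exact mul_le_mul_of_nonneg_right h4 h3

/-- John's exploration over the actions other than the candidate explores the transformed action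
set; the extra coordinate costs one dimension. -/
theorem explores_liftFrame (hxh : xh ∈ X) {π : Pt (Fin d) → ℝ}
    (h : IsJohnExploration (X.erase xh) π) : (liftFrame X xh hxh).Explores π := by
  refine ⟨h.1, fun x hx hne v => ?_⟩
  have hw := h.1
  set S := X.erase xh with hS
  set m := mean id S π with hm
  set v' : Pt (Fin d) := WithLp.toLp 2 (v ∘ Sum.inl) with hv'
  set b : ℝ := inner ℝ m v' - v (Sum.inr ()) with hb
  have hdisp : ∀ z, z ≠ xh → disp xh z ⬝ᵥ v = inner ℝ (z - m) v' + b := fun z hz => by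
    rw [disp_dotProduct_elim hz, inner_sub_left, hb, inner_eq_dotProduct z]
    ring
  have h1 := h.sq_le (Finset.mem_erase.2 ⟨hne, hx⟩) v'
  set s := ∑ z ∈ S, π z * (inner ℝ (z - m) v') ^ 2 with hs
  have hs0 : 0 ≤ s := Finset.sum_nonneg fun z hz => mul_nonneg (hw.nonneg z hz) (sq_nonneg _)
  have h2 : s + b ^ 2 ≤ v ⬝ᵥ (liftFrame X xh hxh).mom π *ᵥ v := by
    rw [Frame.quad_mom, ← Finset.add_sum_erase X _ hxh]
    simp only [liftFrame_y]
    have h0 : π xh = 0 := hw.zero_off xh (Finset.notMem_erase _ _)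
    have h3 : ∑ z ∈ S, π z * (disp xh z ⬝ᵥ v) ^ 2 = s + b ^ 2 := by
      have hlin : ∑ z ∈ S, π z * inner ℝ (z - m) v' = 0 := by
        have : ∑ z ∈ S, π z • (z - m) = 0 := by
          simp only [smul_sub, Finset.sum_sub_distrib, ← Finset.sum_smul, hw.sum_eq_one, one_smul]
          rw [hm, mean]
          simp
        calc _ = inner ℝ (∑ z ∈ S, π z • (z - m)) v' := by
              simp only [sum_inner, real_inner_smul_left]
          _ = 0 := by rw [this, inner_zero_left]
      have : ∑ z ∈ S, π z * (disp xh z ⬝ᵥ v) ^ 2 =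
          s + 2 * b * ∑ z ∈ S, π z * inner ℝ (z - m) v' + b ^ 2 * ∑ z ∈ S, π z := by
        rw [hs, Finset.mul_sum, Finset.mul_sum, ← Finset.sum_add_distrib,
          ← Finset.sum_add_distrib]
        refine Finset.sum_congr rfl fun z hz => ?_
        rw [hdisp z (Finset.ne_of_mem_erase hz)]
        ring
      rw [this, hlin, hw.sum_eq_one]
      ring
    rw [h0, h3, zero_mul, zero_add]
    have := posSemidef_quad (liftFrame X xh hxh).posSemidef v
    linarith
  rw [liftFrame_y, hdisp x hne]
  simp only [Fintype.card_sum, Fintype.card_fin, Fintype.card_unit, Nat.cast_add,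
    Nat.cast_one] at h1 ⊢
  set a : ℝ := inner ℝ (x - m) v'
  have hd : (0 : ℝ) ≤ d := Nat.cast_nonneg d
  have h3 : (a + b) ^ 2 ≤ ((d : ℝ) + 1) * (s + b ^ 2) := by
    -- `2ab ≤ s + d b²` because `a² ≤ d s`
    have h4 : 2 * (a * b) ≤ s + d * b ^ 2 := by
      refine le_of_abs_le <| abs_le_of_sq_le_sq ?_ (by positivity)
      nlinarith [sq_nonneg (s - d * b ^ 2), mul_le_mul_of_nonneg_right h1 (sq_nonneg b)]
    nlinarith
  exact h3.trans (mul_le_mul_of_nonneg_left h2 (by positivity))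

end Lift

/-! ### The learning rate -/

namespace Trajectory

variable {d : ℕ} {tr : Trajectory d} {T t : ℕ}

theorem log_horizon_pos (hT : 2 ≤ T) : 1 / 2 < Real.log T := by
  have h1 : Real.log 2 ≤ Real.log T :=
    Real.log_le_log (by norm_num) (by exact_mod_cast hT)
  linarith [Real.log_two_gt_d9]

theorem eta_pos (hT : 2 ≤ T) (hM : 0 ≤ tr.offMass t) : 0 < tr.eta T t := by
  have hL := log_horizon_pos hT
  unfold eta
  split_ifs with h
  · positivity
  · have : 0 < tr.offMass t := lt_of_le_of_ne hM (Ne.symm h)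
    exact lt_min (by positivity) (Real.sqrt_pos.2 (by positivity))

theorem eta_le : tr.eta T t ≤ 1 / (4 * ((d : ℝ) + 1)) := by
  unfold eta
  split_ifs with h
  · exact le_rfl
  · exact min_le_left _ _

theorem eta_le_sqrt (h : tr.offMass t ≠ 0) :
    tr.eta T t ≤ Real.sqrt (Real.log T / tr.offMass t) := by
  unfold eta
  rw [if_neg h]
  exact min_le_right _ _

theorem eta_anti (hT : 2 ≤ T) {t' : ℕ} (hM : 0 ≤ tr.offMass t)
    (hle : tr.offMass t ≤ tr.offMass t') : tr.eta T t' ≤ tr.eta T t := by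
  have hL := log_horizon_pos hT
  by_cases h : tr.offMass t = 0
  · refine eta_le.trans (le_of_eq ?_)
    simp [eta, h]
  · have h0 : 0 < tr.offMass t := lt_of_le_of_ne hM (Ne.symm h)
    have h' : tr.offMass t' ≠ 0 := (h0.trans_le hle).ne'
    simp only [eta, h, h', if_false]
    refine min_le_min le_rfl (Real.sqrt_le_sqrt ?_)
    exact div_le_div_of_nonneg_left (by linarith) h0 hle

theorem one_div_eta_le (hT : 2 ≤ T) (hM : 0 ≤ tr.offMass t) :
    1 / tr.eta T t ≤ 4 * ((d : ℝ) + 1) + Real.sqrt (tr.offMass t / Real.log T) := by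
  have hL := log_horizon_pos hT
  have hd : (0 : ℝ) ≤ d := Nat.cast_nonneg d
  have hs := Real.sqrt_nonneg (tr.offMass t / Real.log T)
  unfold eta
  split_ifs with h
  · rw [one_div_one_div]
    linarith
  · have h0 : 0 < tr.offMass t := lt_of_le_of_ne hM (Ne.symm h)
    rcases min_choice (1 / (4 * ((d : ℝ) + 1))) (Real.sqrt (Real.log T / tr.offMass t))
      with h1 | h1
    · rw [h1, one_div_one_div]
      linarith
    · rw [h1, one_div, ← Real.sqrt_inv, inv_div]
      linarith

/-- The learning rate is tuned so that the terms `η q` telescope against the square root of the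
accumulated mass `offMass`. -/
theorem eta_mul_le (hT : 2 ≤ T) (hM : 0 ≤ tr.offMass t) {q : ℝ} (hq : 0 < q) (hq1 : q ≤ 1) :
    tr.eta T t * q ≤ 3 * (Real.sqrt (Real.log T * (tr.offMass t + q)) -
      Real.sqrt (Real.log T * tr.offMass t)) := by
  have hL := log_horizon_pos hT
  have hη := eta_pos (tr := tr) hT hM
  set M := tr.offMass t with hMdef
  set L := Real.log T
  set η := tr.eta T t
  have hd : (0 : ℝ) ≤ d := Nat.cast_nonneg d
  have hη4 : η ≤ 1 / 4 := eta_le.trans (by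
    apply one_div_le_one_div_of_le <;> linarith)
  have h1 : η ^ 2 * (M + q) ≤ 2 * L := by
    rcases le_total 1 M with h | h
    · have h2 : η ^ 2 ≤ L / M := by
        have h3 : η ≤ Real.sqrt (L / M) := eta_le_sqrt (by linarith)
        calc η ^ 2 ≤ Real.sqrt (L / M) ^ 2 := by gcongr
          _ = L / M := Real.sq_sqrt (by positivity)
      rw [le_div_iff₀ (by linarith)] at h2
      nlinarith [sq_nonneg η]
    · nlinarith [mul_nonneg hη.le hη.le]
  set A := Real.sqrt (L * (M + q)) with hA
  set B := Real.sqrt (L * M) with hB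
  have hA2 : A ^ 2 = L * (M + q) := Real.sq_sqrt (by positivity)
  have hB2 : B ^ 2 = L * M := Real.sq_sqrt (by positivity)
  have hA0 : 0 < A := Real.sqrt_pos.2 (by positivity)
  have hB0 : 0 ≤ B := Real.sqrt_nonneg _
  have hAB : B ≤ A := Real.sqrt_le_sqrt (by nlinarith)
  have hηA : η * A ≤ 3 / 2 * L := by
    refine le_of_abs_le (abs_le_of_sq_le_sq ?_ (by positivity))
    rw [mul_pow, hA2]
    nlinarith
  -- `A - B = L q / (A + B) ≥ L q / (2 A)`
  have h4 : L * q = (A - B) * (A + B) := by nlinarith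
  have h5 : L * q ≤ (A - B) * (2 * A) := by
    rw [h4]
    exact mul_le_mul_of_nonneg_left (by linarith) (by linarith)
  have h6 : η * q * (L * A) ≤ 3 * (A - B) * (L * A) := by
    calc η * q * (L * A) = (η * A) * (L * q) := by ring
      _ ≤ (3 / 2 * L) * ((A - B) * (2 * A)) :=
          mul_le_mul hηA h5 (by positivity) (by positivity)
      _ = _ := by ring
  exact le_of_mul_le_mul_right h6 (by positivity)

/-! ### Epochs -/

variable {X : Finset (Pt (Fin d))} {J : Pt (Fin d) → Pt (Fin d) → ℝ} {c₂ : ℝ}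

namespace Follows

theorem step_cases (h : tr.Follows X J c₂ T) (ht : t < T) :
    (tr.CanSwitch X t (tr.cand (t + 1)) ∧ tr.start (t + 1) = t + 1 ∧
      tr.prevLen (t + 1) = tr.elapsed t) ∨
    ((¬ ∃ x, tr.CanSwitch X t x) ∧ tr.cand (t + 1) = tr.cand t ∧
      tr.start (t + 1) = tr.start t ∧ tr.prevLen (t + 1) = tr.prevLen t) := by
  by_cases hs : ∃ x, tr.CanSwitch X t x
  · exact Or.inl (h.switch t ht hs)
  · exact Or.inr ⟨hs, h.stay t ht hs⟩

theorem cand_mem (h : tr.Follows X J c₂ T) : ∀ t ≤ T, tr.cand t ∈ X := by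
  intro t
  induction t with
  | zero => exact fun _ => h.cand_zero
  | succ t ih =>
    intro ht
    rcases h.step_cases (Nat.lt_of_succ_le ht) with hs | hs
    · exact hs.1.2.1
    · rw [hs.2.1]; exact ih (by omega)

theorem start_le (h : tr.Follows X J c₂ T) : ∀ t ≤ T, tr.start t ≤ t := by
  intro t
  induction t with
  | zero => exact fun _ => h.start_zero.le
  | succ t ih =>
    intro ht
    rcases h.step_cases (Nat.lt_of_succ_le ht) with hs | hs
    · exact hs.2.1.le
    · rw [hs.2.2.1]; exact (ih (by omega)).trans (Nat.le_succ t)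

/-- All rounds of an epoch agree on its start, its candidate, and the length of its
predecessor. -/
theorem epoch_eq (h : tr.Follows X J c₂ T) : ∀ t ≤ T, ∀ τ, tr.start t ≤ τ → τ ≤ t →
    tr.start τ = tr.start t ∧ tr.cand τ = tr.cand t ∧ tr.prevLen τ = tr.prevLen t := by
  intro t
  induction t with
  | zero =>
    intro _ τ _ h2
    have : τ = 0 := by omega
    simp [this]
  | succ t ih =>
    intro ht τ h1 h2
    rcases Nat.lt_or_eq_of_le h2 with h3 | h3
    · rcases h.step_cases (Nat.lt_of_succ_le ht) with hs | hs
      · rw [hs.2.1] at h1; omega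
      · rw [hs.2.2.1] at h1 ⊢
        rw [hs.2.1, hs.2.2.2]
        exact ih (by omega) τ h1 (by omega)
    · simp [h3]

/-- The start of an epoch other than the first follows a switch. -/
theorem switch_at_start (h : tr.Follows X J c₂ T) (ht : t ≤ T) (h0 : 0 < tr.start t) :
    ∃ s, tr.start t = s + 1 ∧ s < T ∧ tr.CanSwitch X s (tr.cand t) ∧
      tr.prevLen t = tr.elapsed s := by
  obtain ⟨s, hs⟩ : ∃ s, tr.start t = s + 1 := ⟨tr.start t - 1, by omega⟩
  have hle := h.start_le t ht
  obtain ⟨e1, e2, e3⟩ := h.epoch_eq t ht (s + 1) (by omega) (by omega)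
  have hsT : s < T := by omega
  refine ⟨s, hs, hsT, ?_⟩
  rcases h.step_cases hsT with h1 | h1
  · rw [← e2, ← e3]
    exact ⟨h1.1, h1.2.2⟩
  · have := h.start_le s (by omega)
    rw [← h1.2.2.1, e1, hs] at this
    omega

end Follows

/-- The setting of the trajectory analysis: the rules are obeyed, the exploration is John's, there
are at least two actions, and observed losses are in `[-1, 1]`. -/
structure IsPlay (tr : Trajectory d) (X : Finset (Pt (Fin d)))
    (J : Pt (Fin d) → Pt (Fin d) → ℝ) (c₂ : ℝ) (T : ℕ) : Prop where
  follows : tr.Follows X J c₂ T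
  john : ∀ xhat ∈ X, IsJohnExploration (X.erase xhat) (J xhat)
  two_le : 2 ≤ T
  one_le_dim : 1 ≤ d
  other : ∀ xhat ∈ X, ∃ x ∈ X, x ≠ xhat
  obs_le : ∀ t < T, |tr.obs t| ≤ 1

/-- The probability of leaving the candidate in round `t`. -/
def off (tr : Trajectory d) (t : ℕ) : ℝ := 1 - tr.p t (tr.cand t)

/-- The estimated loss of `x` relative to the candidate in round `t`. -/
def gap (tr : Trajectory d) (X : Finset (Pt (Fin d))) (J : Pt (Fin d) → Pt (Fin d) → ℝ)
    (T t : ℕ) (x : Pt (Fin d)) : ℝ := disp (tr.cand t) x ⬝ᵥ (tr.est X J T t).ofLp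

/-- The estimated loss of `x` relative to the candidate, per unit of observed loss, if the action
`a` is played in round `t`. -/
def kernel (tr : Trajectory d) (X : Finset (Pt (Fin d))) (J : Pt (Fin d) → Pt (Fin d) → ℝ)
    (T t : ℕ) (a x : Pt (Fin d)) : ℝ :=
  disp (tr.cand t) x ⬝ᵥ (hullCov (lift (tr.cand t)) X (tr.samp J T t))⁻¹ *ᵥ
    (lift (tr.cand t) a - mean (lift (tr.cand t)) X (tr.samp J T t)).ofLp

theorem gap_eq_kernel (X : Finset (Pt (Fin d))) (J : Pt (Fin d) → Pt (Fin d) → ℝ) (T t : ℕ)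
    (x : Pt (Fin d)) : tr.gap X J T t x = tr.obs t * tr.kernel X J T t (tr.act t) x := by
  rw [gap, est, WithLp.ofLp_smul, dotProduct_smul, smul_eq_mul, kernel]

/-- The accumulated estimated losses, relative to the candidate, of the current epoch. -/
def cost (tr : Trajectory d) (X : Finset (Pt (Fin d))) (J : Pt (Fin d) → Pt (Fin d) → ℝ)
    (T t : ℕ) (x : Pt (Fin d)) : ℝ := ∑ τ ∈ Finset.Ico (tr.start t) t, tr.gap X J T τ x

theorem samp_eq_mix (t : ℕ) : tr.samp J T t = mix (tr.cand t) (tr.p t) (J (tr.cand t))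
    (tr.eta T t * Fintype.card (Fin d ⊕ Unit)) := by
  funext x
  simp [samp, mix]

namespace IsPlay

variable (h : tr.IsPlay X J c₂ T)

include h

theorem cand_mem (ht : t < T) : tr.cand t ∈ X := h.follows.cand_mem t ht.le

theorem start_le (ht : t < T) : tr.start t ≤ t := h.follows.start_le t ht.le

theorem cand_eq (ht : t < T) {τ : ℕ} (hτ : τ ∈ Finset.Icc (tr.start t) t) :
    tr.cand τ = tr.cand t :=
  (h.follows.epoch_eq t ht.le τ (Finset.mem_Icc.1 hτ).1 (Finset.mem_Icc.1 hτ).2).2.1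

theorem start_eq (ht : t < T) {τ : ℕ} (hτ : τ ∈ Finset.Icc (tr.start t) t) :
    tr.start τ = tr.start t :=
  (h.follows.epoch_eq t ht.le τ (Finset.mem_Icc.1 hτ).1 (Finset.mem_Icc.1 hτ).2).1

theorem isDist (ht : t < T) : IsDist X (tr.p t) := (h.follows.p_feasible t ht).1

theorem posDef_base_pos (ht : t < T) :
    ((liftFrame X (tr.cand t) (h.cand_mem ht)).mom (tr.p t)).PosDef ∧
      0 < tr.p t (tr.cand t) := by
  rw [← Frame.det_cov_pos_iff _ (h.isDist ht), ← hullCov_eq_cov (h.cand_mem ht) (h.isDist ht)]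
  exact (h.follows.p_feasible t ht).2

theorem off_pos (ht : t < T) : 0 < tr.off t := by
  obtain ⟨x, hx, hne⟩ := h.other _ (h.cand_mem ht)
  have := Frame.base_lt_one _ (h.isDist ht) (h.posDef_base_pos ht).1 hx hne
  unfold off
  linarith

theorem off_le_one (ht : t < T) : tr.off t ≤ 1 := by
  have := (h.isDist ht).nonneg _ (h.cand_mem ht)
  unfold off
  linarith

theorem offMass_eq (ht : t < T) :
    tr.offMass t = ∑ τ ∈ Finset.Ico (tr.start t) t, tr.off τ := by
  refine Finset.sum_congr rfl fun τ hτ => ?_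
  rw [off, h.cand_eq ht (Finset.Ico_subset_Icc_self hτ)]

theorem offMass_nonneg (ht : t < T) : 0 ≤ tr.offMass t := by
  rw [h.offMass_eq ht]
  exact Finset.sum_nonneg fun τ hτ =>
    (h.off_pos (by rw [Finset.mem_Ico] at hτ; omega)).le

theorem eta_pos (ht : t < T) : 0 < tr.eta T t :=
  Trajectory.eta_pos h.two_le (h.offMass_nonneg ht)

theorem isRound (ht : t < T) :
    (liftFrame X (tr.cand t) (h.cand_mem ht)).IsRound (tr.eta T t) (tr.p t)
      (J (tr.cand t)) where
  isDist := h.isDist ht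
  posDef := (h.posDef_base_pos ht).1
  base_pos := (h.posDef_base_pos ht).2
  explores := explores_liftFrame _ (h.john _ (h.cand_mem ht))
  eta_pos := h.eta_pos ht
  eta_le := by
    have h1 := eta_le (tr := tr) (T := T) (t := t)
    rw [le_div_iff₀ (by positivity)] at h1
    simp only [Fintype.card_sum, Fintype.card_fin, Fintype.card_unit, Nat.cast_add, Nat.cast_one]
    linarith
  two_le_card := by
    have := h.one_le_dim
    simp only [Fintype.card_sum, Fintype.card_fin, Fintype.card_unit]
    omega

theorem isDist_samp (ht : t < T) : IsDist X (tr.samp J T t) := by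
  rw [samp_eq_mix]
  exact (h.isRound ht).isDist_sampling

theorem kernel_eq (ht : t < T) (a x : Pt (Fin d)) : tr.kernel X J T t a x =
    (liftFrame X (tr.cand t) (h.cand_mem ht)).kap (tr.samp J T t) a x :=
  disp_dotProduct_inv_hullCov (h.cand_mem ht) (h.isDist_samp ht) a x

theorem gap_eq (ht : t < T) (x : Pt (Fin d)) : tr.gap X J T t x =
    tr.obs t * (liftFrame X (tr.cand t) (h.cand_mem ht)).kap (tr.samp J T t) (tr.act t) x := by
  rw [gap_eq_kernel, h.kernel_eq ht]

/-- Up to a constant, the objective of the algorithm is the regularised cost relative to the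
candidate. -/
theorem objective_eq (ht : t < T) : ∃ C : ℝ, ∀ w, IsDist X w →
    tr.objective X J T t w = (liftFrame X (tr.cand t) (h.cand_mem ht)).obj
      (tr.cost X J T t) (tr.eta T t) w + C := by
  refine ⟨inner ℝ (lift (tr.cand t) (tr.cand t))
    (∑ τ ∈ Finset.Ico (tr.start t) t, tr.est X J T τ), fun w hw => ?_⟩
  set E := ∑ τ ∈ Finset.Ico (tr.start t) t, tr.est X J T τ with hE
  have h1 : ∀ x, tr.cost X J T t x = inner ℝ (lift (tr.cand t) x - lift (tr.cand t) (tr.cand t)) E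
      := fun x => by
    rw [cost, hE, inner_sum]
    refine Finset.sum_congr rfl fun τ hτ => ?_
    rw [gap, h.cand_eq ht (Finset.Ico_subset_Icc_self hτ), inner_eq_dotProduct, disp]
  have h2 : inner ℝ (mean (lift (tr.cand t)) X w) E = ∑ x ∈ X, w x * tr.cost X J T t x +
      inner ℝ (lift (tr.cand t) (tr.cand t)) E := by
    have h3 : mean (lift (tr.cand t)) X w = ∑ x ∈ X, w x • (lift (tr.cand t) x -
        lift (tr.cand t) (tr.cand t)) + lift (tr.cand t) (tr.cand t) := by
      simp only [smul_sub, Finset.sum_sub_distrib, ← Finset.sum_smul, hw.sum_eq_one, one_smul,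
        mean]
      abel
    rw [h3, inner_add_left, sum_inner]
    congr 1
    exact Finset.sum_congr rfl fun x _ => by rw [real_inner_smul_left, h1]
  rw [objective, h2, Frame.obj, hullCov_eq_cov (h.cand_mem ht) hw]
  ring

theorem isMin (ht : t < T) : (liftFrame X (tr.cand t) (h.cand_mem ht)).IsMin
    (tr.cost X J T t) (tr.eta T t) (tr.p t) where
  isDist := h.isDist ht
  posDef := (h.posDef_base_pos ht).1
  base_pos := (h.posDef_base_pos ht).2
  le w hw hdet := by
    obtain ⟨C, hC⟩ := h.objective_eq ht
    have := h.follows.p_argmin t ht w ⟨hw, by rwa [hullCov_eq_cov (h.cand_mem ht) hw]⟩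
    rw [hC _ hw, hC _ (h.isDist ht)] at this
    linarith

end IsPlay

/-! ### Regret against the estimated losses within an epoch -/

/-- The bound on the stability term of round `t` if the action `a` is played. -/
def stability (tr : Trajectory d) (X : Finset (Pt (Fin d))) (J : Pt (Fin d) → Pt (Fin d) → ℝ)
    (T t : ℕ) (a : Pt (Fin d)) : ℝ :=
  open Classical in
  if a = tr.cand t then 6 * tr.eta T t * tr.off t
  else 4 * tr.eta T t * tr.off t * tr.kernel X J T t a a

/-- The distribution the learner is compared with: the action `u`, mixed with a fraction `1 / T` of
the first iterate of the epoch, which minimises the barrier. -/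
def comparator (tr : Trajectory d) (T t : ℕ) (u x : Pt (Fin d)) : ℝ :=
  open Classical in
  (1 - 1 / (T : ℝ)) * (if x = u then 1 else 0) + 1 / (T : ℝ) * tr.p (tr.start t) x

end Trajectory

/-- A distribution that dominates the fraction `ε` of another one has a barrier which is larger by at
most `(dim + 1) log (1 / ε)`. -/
theorem Frame.log_det_cov_le {α : Type*} {X : Finset α} {xh : α} {n : Type*} [Fintype n]
    [DecidableEq n] (F : Frame X xh n) {p w : α → ℝ} (hp : IsDist X p) (hw : IsDist X w)
    (hM : (F.mom p).PosDef) (h0 : 0 < p xh) {ε : ℝ} (hε0 : 0 < ε) (hε1 : ε ≤ 1)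
    (hle : ∀ x ∈ X, ε * p x ≤ w x) :
    Real.log (F.cov p).det + ((Fintype.card n : ℝ) + 1) * Real.log ε ≤
      Real.log (F.cov w).det := by
  have hMw : (F.mom w).PosDef :=
    F.posDef_mom_of_le hw.nonneg hM hε0 hε1 fun x hx _ => hle x hx
  have hw0 : 0 < w xh := (mul_pos hε0 h0).trans_le (hle xh F.base_mem)
  obtain ⟨Q, s, hQ, hs, hA, hB⟩ := exists_simultaneous_diagonalization hM hMw
  have hse : ∀ i, ε ≤ s i := by
    intro i
    have hQt : IsUnit Qᵀ.det := by rwa [det_transpose]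
    have h1 : Qᵀ *ᵥ ((Qᵀ)⁻¹ *ᵥ Pi.single i 1) = Pi.single i 1 := by
      rw [mulVec_mulVec, mul_nonsing_inv _ hQt, one_mulVec]
    have h2 := F.mul_quad_mom_le hε1 (fun x hx _ => hle x hx) ((Qᵀ)⁻¹ *ᵥ Pi.single i 1)
    rw [dotProduct_mul_transpose_mulVec hA, dotProduct_diag_mulVec hB, h1] at h2
    simpa [Pi.single_apply] using h2
  rw [F.log_det_cov hp hM h0, F.log_det_cov hw hMw hw0, log_det_simultaneous hQ hs hA hB]
  have h3 : (Fintype.card n : ℝ) * Real.log ε ≤ ∑ i, Real.log (s i) := by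
    have : ∑ _i : n, Real.log ε ≤ ∑ i, Real.log (s i) :=
      Finset.sum_le_sum fun i _ => Real.log_le_log hε0 (hse i)
    simpa using this
  have h4 : Real.log ε + Real.log (p xh) ≤ Real.log (w xh) := by
    rw [← Real.log_mul hε0.ne' h0.ne']
    exact Real.log_le_log (mul_pos hε0 h0) (hle xh F.base_mem)
  linarith

namespace Trajectory

variable {d : ℕ} {tr : Trajectory d} {T t : ℕ}
variable {X : Finset (Pt (Fin d))} {J : Pt (Fin d) → Pt (Fin d) → ℝ} {c₂ : ℝ}

namespace IsPlay

variable (h : tr.IsPlay X J c₂ T)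

include h

theorem stability_eq (ht : t < T) (a : Pt (Fin d)) : tr.stability X J T t a =
    Frame.IsRound.stab (liftFrame X (tr.cand t) (h.cand_mem ht)) (tr.eta T t) (tr.p t)
      (J (tr.cand t)) a := by
  unfold stability Frame.IsRound.stab
  rw [h.kernel_eq ht, samp_eq_mix]
  split_ifs <;> rfl

theorem one_div_horizon : 0 < 1 / (T : ℝ) ∧ 1 / (T : ℝ) ≤ 1 := by
  have h1 : (2 : ℝ) ≤ T := by exact_mod_cast h.two_le
  exact ⟨by positivity, by rw [div_le_one (by positivity)]; linarith⟩

theorem start_lt (ht : t < T) : tr.start t < T := (h.start_le ht).trans_lt ht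

theorem isDist_comparator (ht : t < T) {u : Pt (Fin d)} (hu : u ∈ X) :
    IsDist X (tr.comparator T t u) := by
  obtain ⟨h0, h1⟩ := h.one_div_horizon
  have h2 := h.isDist (h.start_lt ht)
  refine ⟨fun x hx => ?_, ?_, fun x hx => ?_⟩
  · have := h2.nonneg x hx
    unfold comparator
    refine add_nonneg (mul_nonneg (by linarith) ?_) (by positivity)
    split_ifs <;> norm_num
  · unfold comparator
    rw [Finset.sum_add_distrib, ← Finset.mul_sum, ← Finset.mul_sum, h2.sum_eq_one]
    simp [hu]
  · have : x ≠ u := fun e => hx (e ▸ hu)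
    simp [comparator, this, h2.zero_off x hx]

theorem mul_le_comparator (u x : Pt (Fin d)) :
    1 / (T : ℝ) * tr.p (tr.start t) x ≤ tr.comparator T t u x := by
  obtain ⟨h0, h1⟩ := h.one_div_horizon
  unfold comparator
  have : 0 ≤ (1 - 1 / (T : ℝ)) * (open Classical in if x = u then 1 else 0) :=
    mul_nonneg (by linarith) (by split_ifs <;> norm_num)
  linarith

theorem isMin_of_cand_eq (ht : t < T) {xh : Pt (Fin d)} (hxh : tr.cand t = xh) (hmem : xh ∈ X) :
    (liftFrame X xh hmem).IsMin (tr.cost X J T t) (tr.eta T t) (tr.p t) := by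
  subst hxh
  exact h.isMin ht

/-- The stability inequality of a round of the algorithm. -/
theorem obj_add_le (ht : t < T) {xh : Pt (Fin d)} (hxh : tr.cand t = xh) (hmem : xh ∈ X)
    {β : Pt (Fin d) → ℝ} (hβ : IsDist X β) (hM : ((liftFrame X xh hmem).mom β).PosDef)
    (hβ0 : 0 < β xh) :
    (liftFrame X xh hmem).obj (tr.cost X J T t) (tr.eta T t) (tr.p t) +
        ∑ x ∈ X, (tr.p t x - β x) * tr.gap X J T t x ≤
      (liftFrame X xh hmem).obj (tr.cost X J T t) (tr.eta T t) β +
        tr.stability X J T t (tr.act t) := by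
  subst hxh
  have := (h.isRound ht).obj_add_le (h.isMin ht) hβ hM hβ0 (h.follows.act_mem t ht) (h.obs_le t ht)
  rw [h.stability_eq ht]
  simpa only [h.gap_eq ht, samp_eq_mix] using this

/-- The regret against the estimated losses within an epoch: the iterates of the regularised leader
telescope, and the normalised barrier of the comparator is at most `(d + 2) log T`. -/
theorem sum_gap_le (ht : t < T) {u : Pt (Fin d)} (hu : u ∈ X) :
    ∑ τ ∈ Finset.Ico (tr.start t) (t + 1),
      (∑ x ∈ X, (tr.p τ x - tr.comparator T τ u x) * tr.gap X J T τ x -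
        tr.stability X J T τ (tr.act τ)) ≤
      1 / tr.eta T t * (((d : ℝ) + 2) * Real.log T) := by
  set xh := tr.cand t with hxh
  have hmem : xh ∈ X := h.cand_mem ht
  set F := liftFrame X xh hmem with hF
  set s := tr.start t with hs
  have hst : s ≤ t := h.start_le ht
  have hsT : s < T := h.start_lt ht
  have hcand : ∀ τ, s ≤ τ → τ ≤ t → tr.cand τ = xh := fun τ h1 h2 =>
    h.cand_eq ht (Finset.mem_Icc.2 ⟨h1, h2⟩)
  have hstart : ∀ τ, s ≤ τ → τ ≤ t → tr.start τ = s := fun τ h1 h2 =>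
    h.start_eq ht (Finset.mem_Icc.2 ⟨h1, h2⟩)
  have hmin : ∀ τ, s ≤ τ → τ ≤ t → F.IsMin (tr.cost X J T τ) (tr.eta T τ) (tr.p τ) := by
    intro τ h1 h2
    exact h.isMin_of_cand_eq (by omega) (hcand τ h1 h2) hmem
  have hstep : ∀ τ, s ≤ τ → τ ≤ t → ∀ β, IsDist X β → (F.mom β).PosDef → 0 < β xh →
      F.obj (tr.cost X J T τ) (tr.eta T τ) (tr.p τ) +
        ∑ x ∈ X, (tr.p τ x - β x) * tr.gap X J T τ x ≤
      F.obj (tr.cost X J T τ) (tr.eta T τ) β + tr.stability X J T τ (tr.act τ) := by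
    intro τ h1 h2 β hβ hM hβ0
    exact h.obj_add_le (by omega) (hcand τ h1 h2) hmem hβ hM hβ0
  -- the barrier, normalised to vanish at its minimiser
  set G : (Pt (Fin d) → ℝ) → ℝ := fun w =>
    Real.log (F.cov (tr.p s)).det - Real.log (F.cov w).det with hG
  have hηpos : ∀ τ, s ≤ τ → τ ≤ t → 0 < tr.eta T τ := fun τ _ h2 => h.eta_pos (by omega)
  have hG0 : ∀ w, IsDist X w → 0 < (F.cov w).det → 0 ≤ G w := by
    intro w hw hdet
    have h1 := (hmin s le_rfl hst).le w hw hdet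
    have h2 : ∀ x, tr.cost X J T s x = 0 := fun x => by
      rw [cost, hstart s le_rfl hst, Finset.Ico_self, Finset.sum_empty]
    simp only [Frame.obj, h2, mul_zero, Finset.sum_const_zero, zero_sub, neg_le_neg_iff] at h1
    have h3 := le_of_mul_le_mul_left h1 (one_div_pos.2 (hηpos s le_rfl hst))
    simp only [hG]
    linarith
  set Φ : ℕ → (Pt (Fin d) → ℝ) → ℝ := fun τ w =>
    ∑ x ∈ X, w x * tr.cost X J T τ x + 1 / tr.eta T τ * G w with hΦ
  have hΦobj : ∀ τ w, Φ τ w = F.obj (tr.cost X J T τ) (tr.eta T τ) w +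
      1 / tr.eta T τ * Real.log (F.cov (tr.p s)).det := fun τ w => by
    simp only [hΦ, hG, Frame.obj]
    ring
  have hdetp : ∀ τ, s ≤ τ → τ ≤ t → 0 < (F.cov (tr.p τ)).det := fun τ h1 h2 =>
    (F.det_cov_pos_iff (hmin τ h1 h2).isDist).2 ⟨(hmin τ h1 h2).posDef, (hmin τ h1 h2).base_pos⟩
  have hstep' : ∀ τ, s ≤ τ → τ ≤ t → ∀ β, IsDist X β → (F.mom β).PosDef → 0 < β xh →
      ∑ x ∈ X, tr.p τ x * tr.gap X J T τ x - tr.stability X J T τ (tr.act τ) ≤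
        Φ τ β + ∑ x ∈ X, β x * tr.gap X J T τ x - Φ τ (tr.p τ) := by
    intro τ h1 h2 β hβ hM hβ0
    have := hstep τ h1 h2 β hβ hM hβ0
    simp only [sub_mul, Finset.sum_sub_distrib] at this
    rw [hΦobj, hΦobj]
    linarith
  have hcost : ∀ τ, s ≤ τ → τ + 1 ≤ t → ∀ x,
      tr.cost X J T (τ + 1) x = tr.cost X J T τ x + tr.gap X J T τ x := by
    intro τ h1 h2 x
    rw [cost, cost, hstart (τ + 1) (by omega) h2, hstart τ h1 (by omega),
      Finset.sum_Ico_succ_top h1]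
  have hind : ∀ τ, s ≤ τ → τ ≤ t → ∑ σ ∈ Finset.Ico s τ,
      (∑ x ∈ X, tr.p σ x * tr.gap X J T σ x - tr.stability X J T σ (tr.act σ)) ≤
        Φ τ (tr.p τ) := by
    intro τ h1
    induction τ, h1 using Nat.le_induction with
    | base =>
      intro _
      simp [hΦ, hG, cost, hstart s le_rfl hst]
    | succ τ h1 ih =>
      intro h2
      rw [Finset.sum_Ico_succ_top h1]
      have h3 := hmin (τ + 1) (by omega) h2
      have h4 := hstep' τ h1 (by omega) (tr.p (τ + 1)) h3.isDist h3.posDef h3.base_pos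
      have h5 : Φ τ (tr.p (τ + 1)) + ∑ x ∈ X, tr.p (τ + 1) x * tr.gap X J T τ x ≤
          Φ (τ + 1) (tr.p (τ + 1)) := by
        simp only [hΦ, hcost τ h1 h2, mul_add, Finset.sum_add_distrib]
        have h6 : tr.eta T (τ + 1) ≤ tr.eta T τ := by
          refine eta_anti h.two_le (h.offMass_nonneg (by omega)) ?_
          rw [h.offMass_eq (by omega), h.offMass_eq (by omega), hstart (τ + 1) (by omega) h2,
            hstart τ h1 (by omega), Finset.sum_Ico_succ_top h1]
          have := h.off_pos (t := τ) (by omega)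
          linarith
        have h7 := one_div_le_one_div_of_le (hηpos (τ + 1) (by omega) h2) h6
        have h8 := hG0 _ h3.isDist (hdetp (τ + 1) (by omega) h2)
        have := mul_le_mul_of_nonneg_right h7 h8
        linarith
      have := ih (by omega)
      linarith
  have hcomp : ∀ τ, s ≤ τ → τ ≤ t → tr.comparator T τ u = tr.comparator T t u := by
    intro τ h1 h2
    funext x
    simp only [comparator, hstart τ h1 h2, hs]
  set w := tr.comparator T t u with hw
  have hwd : IsDist X w := h.isDist_comparator ht hu
  obtain ⟨hT0, hT1⟩ := h.one_div_horizon
  have hsmin := hmin s le_rfl hst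
  have hwle : ∀ x ∈ X, 1 / (T : ℝ) * tr.p s x ≤ w x := fun x _ => h.mul_le_comparator u x
  have hwM : (F.mom w).PosDef :=
    F.posDef_mom_of_le hwd.nonneg hsmin.posDef hT0 hT1 fun x hx _ => hwle x hx
  have hw0 : 0 < w xh := (mul_pos hT0 hsmin.base_pos).trans_le (hwle xh hmem)
  have hGw : G w ≤ ((d : ℝ) + 2) * Real.log T := by
    have h1 := F.log_det_cov_le hsmin.isDist hwd hsmin.posDef hsmin.base_pos hT0 hT1 hwle
    rw [one_div, Real.log_inv] at h1
    simp only [Fintype.card_sum, Fintype.card_fin, Fintype.card_unit, Nat.cast_add,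
      Nat.cast_one] at h1
    simp only [hG]
    linarith
  have hlast := hstep' t hst le_rfl w hwd hwM hw0
  have hsum := hind t hst le_rfl
  have hfinal : ∑ τ ∈ Finset.Ico s (t + 1), (∑ x ∈ X, tr.p τ x * tr.gap X J T τ x -
      tr.stability X J T τ (tr.act τ)) ≤ Φ t w + ∑ x ∈ X, w x * tr.gap X J T t x := by
    rw [Finset.sum_Ico_succ_top hst]
    linarith
  have hcmp : ∑ τ ∈ Finset.Ico s (t + 1), ∑ x ∈ X, w x * tr.gap X J T τ x =
      ∑ x ∈ X, w x * tr.cost X J T t x + ∑ x ∈ X, w x * tr.gap X J T t x := by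
    rw [Finset.sum_Ico_succ_top hst, Finset.sum_comm]
    simp only [cost, Finset.mul_sum, hs]
  have hsplit : ∑ τ ∈ Finset.Ico s (t + 1),
      (∑ x ∈ X, (tr.p τ x - tr.comparator T τ u x) * tr.gap X J T τ x -
        tr.stability X J T τ (tr.act τ)) =
      ∑ τ ∈ Finset.Ico s (t + 1), (∑ x ∈ X, tr.p τ x * tr.gap X J T τ x -
      tr.stability X J T τ (tr.act τ)) -
      ∑ τ ∈ Finset.Ico s (t + 1), ∑ x ∈ X, w x * tr.gap X J T τ x := by
    rw [← Finset.sum_sub_distrib]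
    refine Finset.sum_congr rfl fun τ hτ => ?_
    rw [Finset.mem_Ico] at hτ
    rw [hcomp τ hτ.1 (by omega)]
    simp only [sub_mul, Finset.sum_sub_distrib]
    ring
  rw [hsplit, hcmp]
  have h9 : 1 / tr.eta T t * G w ≤ 1 / tr.eta T t * (((d : ℝ) + 2) * Real.log T) :=
    mul_le_mul_of_nonneg_left hGw (one_div_nonneg.2 (h.eta_pos ht).le)
  simp only [hΦ] at hfinal
  linarith

/-- The learning rates are so tuned that the accumulated stability terms are of the order of the
square root of the mass placed off the candidate. -/
theorem sum_eta_off_le (ht : t < T) :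
    ∑ τ ∈ Finset.Ico (tr.start t) (t + 1), tr.eta T τ * tr.off τ ≤
      3 * Real.sqrt (Real.log T * ∑ τ ∈ Finset.Ico (tr.start t) (t + 1), tr.off τ) := by
  set s := tr.start t with hs
  have hst : s ≤ t := h.start_le ht
  have key : ∀ τ, s ≤ τ → τ ≤ t + 1 → ∑ σ ∈ Finset.Ico s τ, tr.eta T σ * tr.off σ ≤
      3 * Real.sqrt (Real.log T * ∑ σ ∈ Finset.Ico s τ, tr.off σ) := by
    intro τ h1
    induction τ, h1 using Nat.le_induction with
    | base => intro _; simp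
    | succ τ h1 ih =>
      intro h2
      have hτ : τ < T := by omega
      have h3 := eta_mul_le h.two_le (h.offMass_nonneg hτ) (h.off_pos hτ) (h.off_le_one hτ)
      rw [h.offMass_eq hτ, h.start_eq ht (Finset.mem_Icc.2 ⟨h1, by omega⟩), ← hs] at h3
      rw [Finset.sum_Ico_succ_top h1, Finset.sum_Ico_succ_top h1]
      have := ih (by omega)
      linarith
  exact key (t + 1) (by omega) le_rfl

/-- The regret of an epoch, with the excess of the stability terms over their means removed. -/
theorem sum_epoch_le (ht : t < T) {u : Pt (Fin d)} (hu : u ∈ X) :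
    ∑ τ ∈ Finset.Ico (tr.start t) (t + 1),
      (∑ x ∈ X, (tr.p τ x - tr.comparator T τ u x) * tr.gap X J T τ x -
        tr.stability X J T τ (tr.act τ) + 12 * ((d : ℝ) + 1) * (tr.eta T τ * tr.off τ)) ≤
      38 * ((d : ℝ) + 1) * Real.sqrt (Real.log T *
        ∑ τ ∈ Finset.Ico (tr.start t) (t + 1), tr.off τ) +
      8 * ((d : ℝ) + 1) ^ 2 * Real.log T := by
  have h1 := h.sum_gap_le ht hu
  have h2 := h.sum_eta_off_le ht
  have hL := log_horizon_pos h.two_le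
  have hd : (1 : ℝ) ≤ d := by exact_mod_cast h.one_le_dim
  have hM0 := h.offMass_nonneg ht
  set M := tr.offMass t with hM
  set M' := ∑ τ ∈ Finset.Ico (tr.start t) (t + 1), tr.off τ with hM'
  have hMM : M ≤ M' := by
    rw [hM, hM', h.offMass_eq ht, Finset.sum_Ico_succ_top (h.start_le ht)]
    linarith [h.off_pos ht]
  have h3 : 1 / tr.eta T t * (((d : ℝ) + 2) * Real.log T) ≤
      8 * ((d : ℝ) + 1) ^ 2 * Real.log T + 2 * ((d : ℝ) + 1) * Real.sqrt (Real.log T * M') := by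
    have h4 := one_div_eta_le h.two_le hM0
    have h5 : Real.sqrt (M / Real.log T) * Real.log T = Real.sqrt (Real.log T * M) := by
      have : Real.log T * M = M / Real.log T * (Real.log T * Real.log T) := by field_simp
      rw [this, Real.sqrt_mul (by positivity), Real.sqrt_mul_self (by linarith)]
    have h6 : Real.sqrt (Real.log T * M) ≤ Real.sqrt (Real.log T * M') :=
      Real.sqrt_le_sqrt (by gcongr)
    have h7 := Real.sqrt_nonneg (Real.log T * M)
    calc 1 / tr.eta T t * (((d : ℝ) + 2) * Real.log T)
        ≤ (4 * ((d : ℝ) + 1) + Real.sqrt (M / Real.log T)) * (((d : ℝ) + 2) * Real.log T) := by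
          gcongr
      _ = 4 * ((d : ℝ) + 1) * ((d : ℝ) + 2) * Real.log T +
          ((d : ℝ) + 2) * Real.sqrt (Real.log T * M) := by rw [← h5]; ring
      _ ≤ _ := by
          refine add_le_add ?_ ?_
          · refine mul_le_mul_of_nonneg_right ?_ (by linarith)
            nlinarith
          · exact mul_le_mul (by linarith) h6 h7 (by positivity)
  rw [Finset.sum_add_distrib, ← Finset.mul_sum]
  have h8 := mul_le_mul_of_nonneg_left h2 (by positivity : 0 ≤ 12 * ((d : ℝ) + 1))
  have h9 := Real.sqrt_nonneg (Real.log T * M')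
  nlinarith

end IsPlay

end Trajectory

/-! ### From epochs to the whole run -/

namespace Trajectory

variable {d : ℕ} {tr : Trajectory d} {T : ℕ} {X : Finset (Pt (Fin d))}
  {J : Pt (Fin d) → Pt (Fin d) → ℝ} {c₂ : ℝ}

/-- The number of rounds before `n` in which an action other than `xs` is played. -/
def misses (tr : Trajectory d) (xs : Pt (Fin d)) (n : ℕ) : ℝ :=
  open Classical in
  ∑ τ ∈ Finset.range n, if tr.act τ = xs then 0 else 1

/-- The mass placed off `xs` in the rounds in which `xs` is the candidate. -/
def candOff (tr : Trajectory d) (xs : Pt (Fin d)) (n : ℕ) : ℝ :=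
  open Classical in
  ∑ τ ∈ Finset.range n, if tr.cand τ = xs then tr.off τ else 0

theorem misses_nonneg (xs : Pt (Fin d)) (n : ℕ) : 0 ≤ tr.misses xs n :=
  Finset.sum_nonneg fun _ _ => by split_ifs <;> norm_num

theorem misses_mono (xs : Pt (Fin d)) {m n : ℕ} (hmn : m ≤ n) :
    tr.misses xs m ≤ tr.misses xs n :=
  Finset.sum_le_sum_of_subset_of_nonneg (Finset.range_mono hmn)
    fun _ _ _ => by split_ifs <;> norm_num

theorem plays_eq_sum (t : ℕ) (x : Pt (Fin d)) : (tr.plays t x : ℝ) =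
    open Classical in ∑ τ ∈ Finset.Ico (tr.start t) (t + 1), if tr.act τ = x then 1 else 0 := by
  simp [plays]

theorem sum_Ico_le_misses (xs : Pt (Fin d)) (s n : ℕ) :
    (open Classical in ∑ τ ∈ Finset.Ico s n, if tr.act τ = xs then (0 : ℝ) else 1) ≤
      tr.misses xs n := by
  refine Finset.sum_le_sum_of_subset_of_nonneg (fun τ hτ => ?_)
    fun _ _ _ => by split_ifs <;> norm_num
  rw [Finset.mem_Ico] at hτ
  exact Finset.mem_range.2 hτ.2

theorem plays_le_misses {xs x : Pt (Fin d)} (hne : x ≠ xs) (t : ℕ) :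
    (tr.plays t x : ℝ) ≤ tr.misses xs (t + 1) := by
  classical
  rw [plays_eq_sum]
  refine le_trans ?_ (sum_Ico_le_misses xs (tr.start t) (t + 1))
  refine Finset.sum_le_sum fun τ _ => ?_
  by_cases h1 : tr.act τ = x
  · simp [h1, hne]
  · simp only [h1, if_false]
    split_ifs <;> norm_num

theorem elapsed_le_plays_add_misses (xs : Pt (Fin d)) {t : ℕ} (ht : tr.start t ≤ t) :
    tr.elapsed t ≤ tr.plays t xs + tr.misses xs (t + 1) := by
  classical
  rw [plays_eq_sum]
  refine le_trans (le_of_eq ?_) (add_le_add le_rfl (sum_Ico_le_misses xs (tr.start t) (t + 1)))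
  rw [← Finset.sum_add_distrib]
  have : ∀ τ, ((if tr.act τ = xs then (1 : ℝ) else 0) + if tr.act τ = xs then 0 else 1) = 1 :=
    fun τ => by split_ifs <;> norm_num
  simp only [this, Finset.sum_const, Nat.card_Ico, nsmul_eq_mul, mul_one, elapsed]
  rw [Nat.cast_sub (by omega)]
  push_cast
  ring

namespace Follows

variable (h : tr.Follows X J c₂ T)

include h

theorem le_prevLen (h0 : 0 ≤ c₂ * Real.log T) : ∀ t ≤ T, c₂ * Real.log T ≤ tr.prevLen t := by
  intro t
  induction t with
  | zero => exact fun _ => h.prevLen_zero.ge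
  | succ t ih =>
    intro ht
    have h1 := ih (by omega)
    rcases h.step_cases (Nat.lt_of_succ_le ht) with hs | hs
    · rw [hs.2.2]
      have := hs.1.1
      linarith
    · rw [hs.2.2.2]
      exact h1

/-- A candidate other than `xs` was played in at least half of the preceding epoch. -/
theorem prevLen_le {xs : Pt (Fin d)} {t : ℕ} (ht : t ≤ T) (h0 : 0 < tr.start t)
    (hne : tr.cand t ≠ xs) : tr.prevLen t ≤ 2 * tr.misses xs (tr.start t) := by
  obtain ⟨s, hs, -, hsw, hp⟩ := h.switch_at_start ht h0
  have h1 := plays_le_misses (tr := tr) hne s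
  rw [hp, hs]
  have := hsw.2.2.2
  linarith

/-- An epoch whose candidate is not `xs` is short compared to the number of rounds in which `xs` is
not played: otherwise `xs` would have replaced the candidate. -/
theorem elapsed_le {xs : Pt (Fin d)} (hxs : xs ∈ X) (hc0 : 0 ≤ c₂ * Real.log T) {t : ℕ}
    (ht : t < T) (hne : tr.cand t ≠ xs) :
    tr.elapsed t ≤ 4 * tr.misses xs (t + 1) + 2 * (c₂ * Real.log T) + 1 := by
  have hst := h.start_le t ht.le
  have hW := misses_nonneg (tr := tr) xs (t + 1)
  rcases Nat.eq_or_lt_of_le hst with h1 | h1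
  · rw [elapsed, h1]
    linarith
  obtain ⟨s, rfl⟩ : ∃ s, t = s + 1 := ⟨t - 1, by omega⟩
  rcases h.step_cases (t := s) (by omega) with h2 | h2
  · omega
  obtain ⟨hno, hcand, hstart, hprev⟩ := h2
  have hel : tr.elapsed (s + 1) = tr.elapsed s + 1 := by
    rw [elapsed, elapsed, hstart]
    push_cast
    ring
  have hWs : tr.misses xs (s + 1) ≤ tr.misses xs (s + 1 + 1) := misses_mono xs (Nat.le_succ _)
  by_cases h3 : 2 * tr.prevLen s ≤ tr.elapsed s
  · have h4 : ¬ tr.elapsed s / 2 ≤ tr.plays s xs := fun h4 =>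
      hno ⟨xs, h3, hxs, fun e => hne (hcand.trans e.symm), h4⟩
    have h5 := elapsed_le_plays_add_misses (tr := tr) xs (h.start_le s (by omega))
    linarith
  · rcases Nat.eq_zero_or_pos (tr.start (s + 1)) with h4 | h4
    · have h5 := (h.epoch_eq (s + 1) ht.le 0 (by omega) (by omega)).2.2
      rw [h.prevLen_zero] at h5
      linarith
    · have h5 := h.prevLen_le ht.le h4 hne
      have h6 : tr.misses xs (tr.start (s + 1)) ≤ tr.misses xs (s + 1 + 1) :=
        misses_mono xs (by omega)
      linarith

end Follows

/-- An epochwise regret bound: in every prefix of an epoch, the increments `r` sum to at most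
`38 S √M + 8 S²`, with `M` the mass placed off the candidate. -/
structure EpochBound (tr : Trajectory d) (T : ℕ) (S : ℝ) (r : ℕ → ℝ) : Prop where
  off_nonneg : ∀ t < T, 0 ≤ tr.off t
  off_le_one : ∀ t < T, tr.off t ≤ 1
  sum_le : ∀ t < T, ∑ τ ∈ Finset.Ico (tr.start t) (t + 1), r τ ≤
    38 * S * Real.sqrt (∑ τ ∈ Finset.Ico (tr.start t) (t + 1), tr.off τ) + 8 * S ^ 2

namespace EpochBound

variable {S κ : ℝ} {r : ℕ → ℝ} (hb : tr.EpochBound T S r) (h : tr.Follows X J c₂ T)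
  (hS : 1 ≤ S) (hκ : 0 < κ) (hc : c₂ * Real.log T = κ * S ^ 2)

include hb h hS

theorem sum_off_le {t : ℕ} (ht : t < T) :
    ∑ τ ∈ Finset.Ico (tr.start t) (t + 1), tr.off τ ≤ tr.elapsed t := by
  have hst := h.start_le t ht.le
  calc ∑ τ ∈ Finset.Ico (tr.start t) (t + 1), tr.off τ
      ≤ ∑ _τ ∈ Finset.Ico (tr.start t) (t + 1), (1 : ℝ) :=
        Finset.sum_le_sum fun τ hτ => hb.off_le_one τ (by rw [Finset.mem_Ico] at hτ; omega)
    _ = tr.elapsed t := by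
        simp only [Finset.sum_const, Nat.card_Ico, nsmul_eq_mul, mul_one, elapsed]
        rw [Nat.cast_sub (by omega)]
        push_cast
        ring

theorem sum_range_le {t : ℕ} (ht : t < T) :
    ∑ τ ∈ Finset.range (t + 1), r τ ≤ ∑ τ ∈ Finset.range (tr.start t), r τ +
      (38 * S * Real.sqrt (tr.elapsed t) + 8 * S ^ 2) := by
  have hst := h.start_le t ht.le
  rw [← Finset.sum_range_add_sum_Ico r (by omega : tr.start t ≤ t + 1)]
  refine add_le_add le_rfl ((hb.sum_le t ht).trans ?_)
  have := Real.sqrt_le_sqrt (hb.sum_off_le h hS ht)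
  have := mul_le_mul_of_nonneg_left this (by positivity : 0 ≤ 38 * S)
  linarith

include hκ hc

/-- Epoch lengths at least double, so the completed epochs together cost no more than a constant
times the last one of them. -/
theorem sum_range_start_le : ∀ t ≤ T, 0 < tr.start t →
    ∑ τ ∈ Finset.range (tr.start t), r τ ≤
      4 * (38 + 8 / Real.sqrt κ) * S * Real.sqrt (tr.prevLen t) := by
  intro t
  induction t using Nat.strong_induction_on with
  | _ t ih =>
    intro ht h0
    have hκ' := Real.sqrt_pos.2 hκ
    obtain ⟨s, hs, hsT, hsw, hp⟩ := h.switch_at_start ht h0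
    have hst := h.start_le t ht
    have hc0 : 0 ≤ c₂ * Real.log T := by rw [hc]; positivity
    have hprev := h.le_prevLen hc0 s hsT.le
    have hlen : 2 * tr.prevLen s ≤ tr.prevLen t := by rw [hp]; exact hsw.1
    set ℓ := tr.prevLen t with hℓ
    have h1 := hb.sum_range_le h hS hsT
    rw [← hs, ← hp] at h1
    have hℓS : Real.sqrt κ * S ≤ Real.sqrt ℓ := by
      refine Real.le_sqrt_of_sq_le ?_
      rw [mul_pow, Real.sq_sqrt hκ.le, ← hc]
      linarith
    have hb8 : 8 * S ^ 2 ≤ 8 / Real.sqrt κ * S * Real.sqrt ℓ := by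
      calc 8 * S ^ 2 = 8 / Real.sqrt κ * S * (Real.sqrt κ * S) := by field_simp
        _ ≤ _ := by gcongr
    have h3 : ∑ τ ∈ Finset.range (tr.start s), r τ ≤
        4 * (38 + 8 / Real.sqrt κ) * S * (3 / 4 * Real.sqrt ℓ) := by
      have h4 : Real.sqrt (tr.prevLen s) ≤ 3 / 4 * Real.sqrt ℓ := by
        refine Real.sqrt_le_iff.2 ⟨by positivity, ?_⟩
        rw [mul_pow, Real.sq_sqrt (by linarith)]
        linarith
      rcases Nat.eq_zero_or_pos (tr.start s) with h5 | h5
      · rw [h5, Finset.range_zero, Finset.sum_empty]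
        positivity
      · refine (ih s (by omega) hsT.le h5).trans ?_
        gcongr
    linarith

/-- The bound for arbitrary losses. -/
theorem sum_le_sqrt_horizon (hT : 1 ≤ T) : ∑ τ ∈ Finset.range T, r τ ≤
    5 * (38 + 8 / Real.sqrt κ) * S * Real.sqrt T + 8 * S ^ 2 := by
  have hκ' := Real.sqrt_pos.2 hκ
  obtain ⟨t, rfl⟩ : ∃ t, T = t + 1 := ⟨T - 1, by omega⟩
  have h1 := hb.sum_range_le h hS (Nat.lt_succ_self t)
  have hel : tr.elapsed t ≤ ((t + 1 : ℕ) : ℝ) := by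
    rw [elapsed]
    push_cast
    linarith [(Nat.cast_nonneg (tr.start t) : (0 : ℝ) ≤ tr.start t)]
  have h2 : 38 * S * Real.sqrt (tr.elapsed t) ≤
      (38 + 8 / Real.sqrt κ) * S * Real.sqrt ((t + 1 : ℕ) : ℝ) := by
    have : 38 ≤ 38 + 8 / Real.sqrt κ := by linarith [div_pos (by norm_num : (0 : ℝ) < 8) hκ']
    gcongr
  have h3 : ∑ τ ∈ Finset.range (tr.start t), r τ ≤
      4 * (38 + 8 / Real.sqrt κ) * S * Real.sqrt ((t + 1 : ℕ) : ℝ) := by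
    rcases Nat.eq_zero_or_pos (tr.start t) with h5 | h5
    · rw [h5, Finset.range_zero, Finset.sum_empty]
      positivity
    · refine (hb.sum_range_start_le h hS hκ hc t (Nat.le_succ t) h5).trans ?_
      obtain ⟨s, hs, hsT, -, hp⟩ := h.switch_at_start (Nat.le_succ t) h5
      have h6 : tr.prevLen t ≤ ((t + 1 : ℕ) : ℝ) := by
        rw [hp, elapsed]
        have : ((s : ℝ) + 1) ≤ ((t + 1 : ℕ) : ℝ) := by exact_mod_cast hsT
        linarith [(Nat.cast_nonneg (tr.start s) : (0 : ℝ) ≤ tr.start s)]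
      gcongr
  linarith

/-- The bound at the end of a round whose candidate is not `xs`. -/
theorem sum_range_le_misses {xs : Pt (Fin d)} (hxs : xs ∈ X) {t : ℕ} (ht : t < T)
    (hne : tr.cand t ≠ xs) : ∑ τ ∈ Finset.range (t + 1), r τ ≤
      (8 * (38 + 8 / Real.sqrt κ) + 76) * S * Real.sqrt (tr.misses xs (t + 1)) +
      (38 * (Real.sqrt (2 * κ) + 1) + 8) * S ^ 2 := by
  have hκ' := Real.sqrt_pos.2 hκ
  have hc0 : 0 ≤ c₂ * Real.log T := by rw [hc]; positivity
  set W := tr.misses xs (t + 1) with hW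
  have hW0 : 0 ≤ W := misses_nonneg xs _
  have h1 := hb.sum_range_le h hS ht
  have h2 := h.elapsed_le hxs hc0 ht hne
  have h3 : Real.sqrt (tr.elapsed t) ≤ 2 * Real.sqrt W + (Real.sqrt (2 * κ) + 1) * S := by
    refine Real.sqrt_le_iff.2 ⟨by positivity, h2.trans ?_⟩
    have e1 := Real.sq_sqrt hW0
    have e2 := Real.sq_sqrt (by positivity : 0 ≤ 2 * κ)
    rw [hc, ← hW]
    have e3 : 4 * W + 2 * (κ * S ^ 2) + 1 ≤ 4 * W + (2 * κ) * S ^ 2 + S ^ 2 := by nlinarith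
    refine e3.trans ?_
    have e6 : 4 * W + (2 * κ) * S ^ 2 + S ^ 2 =
        4 * Real.sqrt W ^ 2 + Real.sqrt (2 * κ) ^ 2 * S ^ 2 + S ^ 2 := by rw [e1, e2]
    rw [e6]
    have e4 : 0 ≤ 2 * (Real.sqrt W * ((Real.sqrt (2 * κ) + 1) * S)) := by positivity
    have e5 : 0 ≤ Real.sqrt (2 * κ) * S ^ 2 := by positivity
    nlinarith
  have h4 := mul_le_mul_of_nonneg_left h3 (by positivity : 0 ≤ 38 * S)
  have h5 : ∑ τ ∈ Finset.range (tr.start t), r τ ≤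
      4 * (38 + 8 / Real.sqrt κ) * S * (2 * Real.sqrt W) := by
    rcases Nat.eq_zero_or_pos (tr.start t) with h5 | h5
    · rw [h5, Finset.range_zero, Finset.sum_empty]
      positivity
    · refine (hb.sum_range_start_le h hS hκ hc t ht.le h5).trans ?_
      have h6 := h.prevLen_le ht.le h5 hne
      have h7 : tr.misses xs (tr.start t) ≤ W :=
        misses_mono xs ((h.start_le t ht.le).trans (Nat.le_succ t))
      have h8 : Real.sqrt (tr.prevLen t) ≤ 2 * Real.sqrt W := by
        refine Real.sqrt_le_iff.2 ⟨by positivity, ?_⟩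
        rw [mul_pow, Real.sq_sqrt hW0]
        linarith
      gcongr
  nlinarith

/-- The self-bounding form of the total bound: all epochs but possibly the last are paid for by the
rounds in which `xs` is not played. -/
theorem sum_le_sqrt_misses {xs : Pt (Fin d)} (hxs : xs ∈ X) (hT : 1 ≤ T) :
    ∑ τ ∈ Finset.range T, r τ ≤
      (8 * (38 + 8 / Real.sqrt κ) + 76) * S * Real.sqrt (tr.misses xs T) +
      38 * S * Real.sqrt (tr.candOff xs T) +
      (38 * (Real.sqrt (2 * κ) + 1) + 16) * S ^ 2 := by
  have hκ' := Real.sqrt_pos.2 hκ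
  obtain ⟨t, rfl⟩ : ∃ t, T = t + 1 := ⟨T - 1, by omega⟩
  have ht : t < t + 1 := Nat.lt_succ_self t
  have hq := Real.sqrt_nonneg (tr.candOff xs (t + 1))
  by_cases hne : tr.cand t = xs
  · have hst := h.start_le t ht.le
    rw [← Finset.sum_range_add_sum_Ico r (by omega : tr.start t ≤ t + 1)]
    have h1 : ∑ τ ∈ Finset.range (tr.start t), r τ ≤
        (8 * (38 + 8 / Real.sqrt κ) + 76) * S * Real.sqrt (tr.misses xs (t + 1)) +
          (38 * (Real.sqrt (2 * κ) + 1) + 8) * S ^ 2 := by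
      rcases Nat.eq_zero_or_pos (tr.start t) with h5 | h5
      · rw [h5, Finset.range_zero, Finset.sum_empty]
        positivity
      · obtain ⟨s, hs, hsT, hsw, -⟩ := h.switch_at_start ht.le h5
        have h6 := hb.sum_range_le_misses h hS hκ hc hxs hsT
          (fun e => hsw.2.2.1 (hne.trans e.symm))
        rw [hs]
        refine h6.trans ?_
        have h7 : tr.misses xs (s + 1) ≤ tr.misses xs (t + 1) := misses_mono xs (by omega)
        gcongr
    have h2 : ∑ τ ∈ Finset.Ico (tr.start t) (t + 1), tr.off τ ≤ tr.candOff xs (t + 1) := by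
      have h3 : ∑ τ ∈ Finset.Ico (tr.start t) (t + 1), tr.off τ =
          open Classical in ∑ τ ∈ Finset.Ico (tr.start t) (t + 1),
            if tr.cand τ = xs then tr.off τ else 0 := by
        refine Finset.sum_congr rfl fun τ hτ => ?_
        rw [Finset.mem_Ico] at hτ
        rw [(h.epoch_eq t ht.le τ hτ.1 (by omega)).2.1, if_pos hne]
      rw [h3]
      refine Finset.sum_le_sum_of_subset_of_nonneg (fun τ hτ => ?_) fun τ hτ _ => ?_
      · rw [Finset.mem_Ico] at hτ
        exact Finset.mem_range.2 hτ.2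
      · have := hb.off_nonneg τ (Finset.mem_range.1 hτ)
        split_ifs <;> [exact this; exact le_rfl]
    have h3 := hb.sum_le t ht
    have h4 := mul_le_mul_of_nonneg_left (Real.sqrt_le_sqrt h2) (by positivity : 0 ≤ 38 * S)
    nlinarith
  · have h1 := hb.sum_range_le_misses h hS hκ hc hxs ht hne
    have h2 : 0 ≤ 38 * S * Real.sqrt (tr.candOff xs (t + 1)) := by positivity
    nlinarith [sq_nonneg S]

end EpochBound

/-- The regret of round `τ` against the estimated losses, with the stability term replaced by a
bound for its mean. Of the constant `12`, the mean of the stability term accounts for `10` and the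
exploration for `2`. -/
def increment (tr : Trajectory d) (X : Finset (Pt (Fin d))) (J : Pt (Fin d) → Pt (Fin d) → ℝ)
    (T : ℕ) (u : Pt (Fin d)) (τ : ℕ) : ℝ :=
  ∑ x ∈ X, (tr.p τ x - tr.comparator T τ u x) * tr.gap X J T τ x -
    tr.stability X J T τ (tr.act τ) + 12 * ((d : ℝ) + 1) * (tr.eta T τ * tr.off τ)

/-- The epochwise bound for the regret against the estimated losses. -/
theorem IsPlay.epochBound (h : tr.IsPlay X J c₂ T) {u : Pt (Fin d)} (hu : u ∈ X) :
    tr.EpochBound T (((d : ℝ) + 1) * Real.sqrt (Real.log T)) (tr.increment X J T u) where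
  off_nonneg _ ht := (h.off_pos ht).le
  off_le_one _ ht := h.off_le_one ht
  sum_le t ht := by
    have hL := log_horizon_pos h.two_le
    refine (h.sum_epoch_le ht hu).trans (le_of_eq ?_)
    rw [Real.sqrt_mul (by linarith), mul_pow, Real.sq_sqrt (by linarith)]
    ring

end Trajectory

/-! ### Bounds that are uniform over all trajectories -/

/-- The uniform distribution on `X`. -/
def unif {α : Type*} (X : Finset α) (x : α) : ℝ :=
  open Classical in if x ∈ X then 1 / (X.card : ℝ) else 0

theorem isDist_unif {α : Type*} {X : Finset α} (hX : X.Nonempty) : IsDist X (unif X) where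
  nonneg x hx := by simp [unif, hx]
  sum_eq_one := by
    have h1 : ∀ x ∈ X, unif X x = 1 / (X.card : ℝ) := fun x hx => by simp [unif, hx]
    have h2 : (X.card : ℝ) ≠ 0 := by exact_mod_cast hX.card_pos.ne'
    rw [Finset.sum_congr rfl h1]
    simp [h2]
  zero_off x hx := by simp [unif, hx]

/-- If the cost vector is bounded, then the regularised minimiser stays away from the boundary, both
at the candidate and off it: this is the first-order condition against the uniform distribution. -/
theorem Frame.IsMin.lower_bound {α : Type*} {X : Finset α} {xh : α} {n : Type*} [Fintype n]
    [DecidableEq n] {F : Frame X xh n} {c : α → ℝ} {η : ℝ} {p : α → ℝ} (hp : F.IsMin c η p)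
    (hX : 2 ≤ X.card) (hη : 0 < η) (hη1 : η ≤ 1) {B : ℝ} (hc : ∀ x ∈ X, |c x| ≤ B) :
    1 / (X.card * (2 * B + Fintype.card n + 1)) ≤ p xh ∧
      1 / (X.card * (2 * B + Fintype.card n + 1)) ≤ 1 - p xh := by
  have hne : X.Nonempty := ⟨xh, F.base_mem⟩
  have hβ := isDist_unif hne
  have hcard : (2 : ℝ) ≤ X.card := by exact_mod_cast hX
  have hβx : ∀ x ∈ X, unif X x = 1 / (X.card : ℝ) := fun x hx => by simp [unif, hx]
  have hM : (F.mom (unif X)).PosDef := by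
    refine F.posDef_mom_of_le hβ.nonneg hp.posDef (c := 1 / (X.card : ℝ)) (by positivity)
      (by rw [div_le_one (by linarith)]; linarith) fun x hx _ => ?_
    rw [hβx x hx]
    exact mul_le_of_le_one_right (by positivity) (hp.isDist.le_one hx)
  have hβ0 : 0 < unif X xh := by rw [hβx xh F.base_mem]; positivity
  obtain ⟨Q, s, hQ, hs, hA, hB⟩ := exists_simultaneous_diagonalization hp.posDef hM
  have h1 := hp.first_order F hβ hQ hs hA hB hβ0
  have hB0 : 0 ≤ B := (abs_nonneg _).trans (hc xh F.base_mem)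
  have h2 : ∑ x ∈ X, (unif X x - p x) * c x ≤ 2 * B := by
    calc ∑ x ∈ X, (unif X x - p x) * c x ≤ ∑ x ∈ X, (unif X x + p x) * B := by
          refine Finset.sum_le_sum fun x hx => ?_
          have hu := hβ.nonneg x hx
          have hpx := hp.isDist.nonneg x hx
          have := abs_le.1 (hc x hx)
          nlinarith
      _ = 2 * B := by
          rw [← Finset.sum_mul, Finset.sum_add_distrib, hβ.sum_eq_one, hp.isDist.sum_eq_one]
          ring
  have h3 : ∑ i, (s i - 1) + (unif X xh / p xh - 1) ≤ 2 * B := by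
    have h4 := h1.trans h2
    rw [one_div_mul_eq_div, div_le_iff₀ hη] at h4
    nlinarith
  rw [Finset.sum_sub_distrib] at h3
  simp only [Finset.sum_const, Finset.card_univ, nsmul_eq_mul, mul_one] at h3
  set N : ℝ := 2 * B + Fintype.card n + 1 with hN
  have hN0 : 0 < N := by positivity
  have hb : 0 < unif X xh / p xh := div_pos hβ0 hp.base_pos
  have hs0 : 0 ≤ ∑ i, s i := Finset.sum_nonneg fun i _ => (hs i).le
  have h5 : unif X xh / p xh ≤ N := by linarith
  have h6 : ∀ i, s i ≤ N := fun i => by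
    have := Finset.single_le_sum (f := s) (fun i _ => (hs i).le) (Finset.mem_univ i)
    linarith
  constructor
  · rw [div_le_iff₀ hp.base_pos, hβx xh F.base_mem, div_le_iff₀ (by positivity)] at h5
    rw [div_le_iff₀ (by positivity)]
    linarith
  · have h7 := F.e_mom_e_of_isDist hp.isDist
    have h8 := F.e_mom_e_of_isDist hβ
    rw [dotProduct_mul_transpose_mulVec hA] at h7
    rw [dotProduct_diag_mulVec hB, hβx xh F.base_mem] at h8
    have h9 : 1 - 1 / (X.card : ℝ) ≤ N * (1 - p xh) := by
      rw [← h7, ← h8, Finset.mul_sum]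
      exact Finset.sum_le_sum fun i _ => mul_le_mul_of_nonneg_right (h6 i) (mul_self_nonneg _)
    have h10 : 1 / (X.card : ℝ) ≤ 1 / 2 := one_div_le_one_div_of_le (by norm_num) hcard
    have h11 : 1 / (X.card : ℝ) ≤ N * (1 - p xh) := by linarith
    rw [div_le_iff₀ (by positivity)] at h11 ⊢
    linarith

namespace Trajectory

variable {d : ℕ} {T : ℕ} {X : Finset (Pt (Fin d))}
  {J : Pt (Fin d) → Pt (Fin d) → ℝ} {c₂ : ℝ}

theorem IsPlay.le_eta {tr : Trajectory d} (h : tr.IsPlay X J c₂ T) {t : ℕ} (ht : t < T) :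
    1 / (4 * ((d : ℝ) + 1) + Real.sqrt (T / Real.log T)) ≤ tr.eta T t := by
  have hL := log_horizon_pos h.two_le
  have h1 := one_div_eta_le h.two_le (h.offMass_nonneg ht)
  have h2 : tr.offMass t ≤ T := by
    rw [h.offMass_eq ht]
    calc ∑ τ ∈ Finset.Ico (tr.start t) t, tr.off τ
        ≤ ∑ _τ ∈ Finset.Ico (tr.start t) t, (1 : ℝ) :=
          Finset.sum_le_sum fun τ hτ => h.off_le_one (by rw [Finset.mem_Ico] at hτ; omega)
      _ ≤ T := by
          simp only [Finset.sum_const, Nat.card_Ico, nsmul_eq_mul, mul_one]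
          exact_mod_cast (by omega : t - tr.start t ≤ T)
  have h3 : Real.sqrt (tr.offMass t / Real.log T) ≤ Real.sqrt (T / Real.log T) := by
    apply Real.sqrt_le_sqrt
    gcongr
  rw [one_div_le (by positivity) (h.eta_pos ht)]
  linarith

theorem IsPlay.abs_kernel_le {tr : Trajectory d} (h : tr.IsPlay X J c₂ T) {t : ℕ} (ht : t < T)
    {η₀ ε : ℝ} (hη : 0 < η₀) (hε : 0 < ε) (h0 : η₀ ≤ tr.eta T t) (h1 : ε ≤ tr.p t (tr.cand t))
    (h2 : ε ≤ tr.off t) {a x : Pt (Fin d)} (ha : a ∈ X) (hx : x ∈ X) :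
    |tr.kernel X J T t a x| ≤ 1 / (η₀ * ε) + 1 / ε := by
  rw [h.kernel_eq ht, samp_eq_mix]
  refine ((h.isRound ht).abs_kap_le ha hx).trans ?_
  rw [off] at h2
  have h3 := hη.le.trans h0
  gcongr

/-- The algorithm's distributions are bounded away from the boundary, uniformly over all
trajectories; the bound deteriorates from round to round, as the estimates grow. -/
theorem exists_lower_bound (d T : ℕ) (X : Finset (Pt (Fin d)))
    (J : Pt (Fin d) → Pt (Fin d) → ℝ) (c₂ : ℝ) : ∀ n ≤ T, ∃ ε : ℝ, 0 < ε ∧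
    ∀ tr : Trajectory d, tr.IsPlay X J c₂ T → ∀ t < n, ε ≤ tr.p t (tr.cand t) ∧ ε ≤ tr.off t := by
  intro n
  induction n with
  | zero => exact fun _ => ⟨1, one_pos, fun _ _ t ht => absurd ht (Nat.not_lt_zero t)⟩
  | succ n ih =>
    intro hn
    obtain ⟨ε, hε, hlow⟩ := ih (by omega)
    set η₀ : ℝ := 1 / (4 * ((d : ℝ) + 1) + Real.sqrt (T / Real.log T)) with hη₀
    have hη₀pos : 0 < η₀ := by positivity
    set B : ℝ := T * (1 / (η₀ * ε) + 1 / ε) with hB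
    set N : ℝ := X.card * (2 * B + Fintype.card (Fin d ⊕ Unit) + 1) with hN
    have hN0 : 0 ≤ N := by positivity
    refine ⟨min ε (1 / (N + 1)), lt_min hε (by positivity), fun tr h t ht => ?_⟩
    rcases Nat.lt_succ_iff_lt_or_eq.1 ht with ht' | rfl
    · exact ⟨(min_le_left _ _).trans (hlow tr h t ht').1, (min_le_left _ _).trans (hlow tr h t ht').2⟩
    have htT : t < T := hn
    have hcost : ∀ x ∈ X, |tr.cost X J T t x| ≤ B := by
      intro x hx
      rw [cost]
      refine (Finset.abs_sum_le_sum_abs _ _).trans ?_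
      have : ∀ τ ∈ Finset.Ico (tr.start t) t,
          |tr.gap X J T τ x| ≤ 1 / (η₀ * ε) + 1 / ε := by
        intro τ hτ
        rw [Finset.mem_Ico] at hτ
        have hτT : τ < T := by omega
        rw [gap_eq_kernel, abs_mul]
        obtain ⟨l1, l2⟩ := hlow tr h τ hτ.2
        exact (mul_le_of_le_one_left (abs_nonneg _) (h.obs_le τ hτT)).trans
          (h.abs_kernel_le hτT hη₀pos hε (h.le_eta hτT) l1 l2 (h.follows.act_mem τ hτT) hx)
      refine (Finset.sum_le_sum this).trans ?_
      simp only [Finset.sum_const, Nat.card_Ico, nsmul_eq_mul, hB]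
      refine mul_le_mul_of_nonneg_right ?_ (by positivity)
      exact_mod_cast (by omega : t - tr.start t ≤ T)
    have hcard : 2 ≤ X.card := by
      obtain ⟨x, hx, hne⟩ := h.other _ (h.cand_mem htT)
      exact Finset.one_lt_card.2 ⟨x, hx, _, h.cand_mem htT, hne⟩
    have hη8 := (h.isRound htT).eta_le_eighth
    have h1 := (h.isMin htT).lower_bound hcard (h.eta_pos htT) (by linarith) hcost
    rw [← hN] at h1
    have hNpos : 0 < N := by
      have : (0 : ℝ) < X.card := by exact_mod_cast (by omega : 0 < X.card)
      positivity
    have h2 : min ε (1 / (N + 1)) ≤ 1 / N :=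
      (min_le_right _ _).trans (one_div_le_one_div_of_le hNpos (by linarith))
    exact ⟨h2.trans h1.1, h2.trans h1.2⟩

/-- The loss estimators are bounded, and hence integrable. -/
theorem exists_kernel_bound (d T : ℕ) (X : Finset (Pt (Fin d)))
    (J : Pt (Fin d) → Pt (Fin d) → ℝ) (c₂ : ℝ) : ∃ B : ℝ, ∀ tr : Trajectory d,
    tr.IsPlay X J c₂ T → ∀ t < T, ∀ a ∈ X, ∀ x ∈ X, |tr.kernel X J T t a x| ≤ B := by
  obtain ⟨ε, hε, hlow⟩ := exists_lower_bound d T X J c₂ T le_rfl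
  exact ⟨_, fun tr h t ht a ha x hx => h.abs_kernel_le ht (by positivity) hε (h.le_eta ht)
    (hlow tr h t ht).1 (hlow tr h t ht).2 ha hx⟩

end Trajectory

/-! ### Measurability -/

section Measurability

variable {Ω : Type*} {m m' : MeasurableSpace Ω}

/-- A bounded measurable real function. -/
structure BddMeas (m : MeasurableSpace Ω) (f : Ω → ℝ) : Prop where
  meas : Measurable[m] f
  bdd : ∃ C : ℝ, ∀ ω, |f ω| ≤ C

namespace BddMeas

variable {f g : Ω → ℝ}

theorem const (c : ℝ) : BddMeas m fun _ => c := ⟨measurable_const, |c|, fun _ => le_rfl⟩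

theorem add (hf : BddMeas m f) (hg : BddMeas m g) : BddMeas m fun ω => f ω + g ω := by
  obtain ⟨a, ha⟩ := hf.bdd
  obtain ⟨b, hb⟩ := hg.bdd
  exact ⟨hf.meas.add hg.meas, a + b, fun ω => (abs_add_le _ _).trans (add_le_add (ha ω) (hb ω))⟩

theorem mul (hf : BddMeas m f) (hg : BddMeas m g) : BddMeas m fun ω => f ω * g ω := by
  obtain ⟨a, ha⟩ := hf.bdd
  obtain ⟨b, hb⟩ := hg.bdd
  refine ⟨hf.meas.mul hg.meas, a * b, fun ω => ?_⟩
  rw [abs_mul]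
  exact mul_le_mul (ha ω) (hb ω) (abs_nonneg _) ((abs_nonneg _).trans (ha ω))

theorem sub (hf : BddMeas m f) (hg : BddMeas m g) : BddMeas m fun ω => f ω - g ω := by
  simpa [sub_eq_add_neg] using hf.add ((const (-1)).mul hg)

theorem sum {ι : Type*} {s : Finset ι} {F : ι → Ω → ℝ} (h : ∀ i ∈ s, BddMeas m (F i)) :
    BddMeas m fun ω => ∑ i ∈ s, F i ω := by
  classical
  induction s using Finset.induction_on with
  | empty => simpa using const 0
  | insert a s ha ih =>
    simp only [Finset.sum_insert ha]
    exact (h a (Finset.mem_insert_self a s)).add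
      (ih fun i hi => h i (Finset.mem_insert_of_mem hi))

theorem mono (hf : BddMeas m f) (hm : m ≤ m') : BddMeas m' f := ⟨hf.meas.mono hm le_rfl, hf.bdd⟩

theorem integrable {mΩ : MeasurableSpace Ω} {μ : Measure Ω} [IsFiniteMeasure μ]
    (hf : BddMeas mΩ f) : Integrable f μ := by
  obtain ⟨C, hC⟩ := hf.bdd
  exact Integrable.of_bound hf.meas.aestronglyMeasurable C (Filter.Eventually.of_forall hC)

end BddMeas

/-- A family of measurable functions evaluated at a random index with finitely many values. -/
theorem measurable_eval_of_mem_finset {β : Type*} {S : Finset β} {f : Ω → β}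
    (hf : ∀ b ∈ S, MeasurableSet[m] {ω | f ω = b}) (hmem : ∀ ω, f ω ∈ S) {F : β → Ω → ℝ}
    (hF : ∀ b ∈ S, Measurable[m] (F b)) : Measurable[m] fun ω => F (f ω) ω := by
  classical
  have h : (fun ω => F (f ω) ω) = fun ω => ∑ b ∈ S, Set.indicator {ω | f ω = b} (F b) ω := by
    funext ω
    rw [Finset.sum_eq_single_of_mem (f ω) (hmem ω)]
    · simp
    · intro b _ hb
      simp [Ne.symm hb]
  rw [h]
  exact Finset.measurable_sum S fun b hb => (hF b hb).indicator (hf b hb)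

theorem measurable_det {n : Type*} [Fintype n] [DecidableEq n] {A : Ω → Matrix n n ℝ}
    (hA : ∀ i j, Measurable[m] fun ω => A ω i j) : Measurable[m] fun ω => (A ω).det := by
  simp only [det_apply]
  exact Finset.measurable_sum _ fun σ _ =>
    (Finset.measurable_prod _ fun i _ => hA _ _).const_smul _

/-- Cramer's rule expresses the entries of the inverse by determinants. -/
theorem measurable_inv_apply {n : Type*} [Fintype n] [DecidableEq n] {A : Ω → Matrix n n ℝ}
    (hA : ∀ i j, Measurable[m] fun ω => A ω i j) (i j : n) :
    Measurable[m] fun ω => (A ω)⁻¹ i j := by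
  have h : (fun ω => (A ω)⁻¹ i j) = fun ω =>
      ((A ω).det)⁻¹ * ((A ω).updateRow j (Pi.single i 1)).det := by
    funext ω
    rw [inv_def, Matrix.smul_apply, adjugate_apply, smul_eq_mul, Ring.inverse_eq_inv']
  rw [h]
  refine (measurable_det hA).inv.mul (measurable_det fun k l => ?_)
  by_cases hk : k = j
  · simp [hk]
  · simpa [updateRow_ne hk] using hA k l

theorem measurable_estimator {α : Type*} {ι : Type} [Fintype ι] [DecidableEq ι] (φ : α → Pt ι)
    (S : Finset α) {w : Ω → α → ℝ} (hw : ∀ x ∈ S, Measurable[m] fun ω => w ω x) (u : ι → ℝ)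
    (v : Pt ι) : Measurable[m] fun ω =>
      u ⬝ᵥ (hullCov φ S (w ω))⁻¹ *ᵥ (v - mean φ S (w ω)).ofLp := by
  have hmean : ∀ i, Measurable[m] fun ω => (mean φ S (w ω)).ofLp i := fun i => by
    have : (fun ω => (mean φ S (w ω)).ofLp i) = fun ω => ∑ x ∈ S, w ω x * (φ x).ofLp i := by
      funext ω
      simp [mean]
    rw [this]
    exact Finset.measurable_sum _ fun x hx => (hw x hx).mul_const _
  have hcov : ∀ i j, Measurable[m] fun ω => hullCov φ S (w ω) i j := fun i j => by
    have : (fun ω => hullCov φ S (w ω) i j) = fun ω =>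
        ∑ x ∈ S, w ω x * ((φ x).ofLp i * (φ x).ofLp j) -
          (mean φ S (w ω)).ofLp i * (mean φ S (w ω)).ofLp j + perpMat φ S i j := by
      funext ω
      simp only [hullCov, covMat, secondMoment, Matrix.add_apply, Matrix.sub_apply,
        Matrix.sum_apply, Matrix.smul_apply, vecMulVec_apply, smul_eq_mul]
    rw [this]
    exact ((Finset.measurable_sum _ fun x hx => (hw x hx).mul_const _).sub
      ((hmean i).mul (hmean j))).add_const _
  simp only [dotProduct, mulVec, WithLp.ofLp_sub, Pi.sub_apply]
  exact Finset.measurable_sum _ fun i _ => (Finset.measurable_sum _ fun j _ =>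
    (measurable_inv_apply hcov i j).mul ((hmean j).const_sub _)).const_mul _

end Measurability

/-! ### Expectations over the run -/

section Random

variable {d : ℕ} {Ω : Type*} {mΩ : MeasurableSpace Ω} {μ : Measure Ω} {ℱ : Filtration ℕ mΩ}
  {T : ℕ} {X : Finset (Pt (Fin d))} {loss : ℕ → Ω → Pt (Fin d) → ℝ} {θ : ℕ → Ω → Pt (Fin d)}
  {c₂ : ℝ} {J : Pt (Fin d) → Pt (Fin d) → ℝ} {tr : Ω → Trajectory d}

/-- A run in an environment with at least two actions. -/
structure IsGame (μ : Measure Ω) (ℱ : Filtration ℕ mΩ) (T : ℕ) (X : Finset (Pt (Fin d)))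
    (loss : ℕ → Ω → Pt (Fin d) → ℝ) (θ : ℕ → Ω → Pt (Fin d)) (c₂ : ℝ)
    (J : Pt (Fin d) → Pt (Fin d) → ℝ) (tr : Ω → Trajectory d) : Prop where
  env : IsLinearEnv μ ℱ T X loss θ
  run : IsRun μ ℱ T X loss c₂ J tr
  two_le : 2 ≤ T
  nontriv : 2 ≤ X.card

namespace IsGame

variable (h : IsGame μ ℱ T X loss θ c₂ J tr)

include h

theorem other (xhat : Pt (Fin d)) : ∃ x ∈ X, x ≠ xhat :=
  Finset.exists_mem_ne h.nontriv xhat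

theorem one_le_dim : 1 ≤ d := by
  rcases Nat.eq_zero_or_pos d with rfl | hd
  · have h1 := h.nontriv
    have h2 : X.card ≤ 1 := Finset.card_le_one.2 fun a _ b _ => Subsingleton.elim a b
    omega
  · exact hd

theorem act_mem {t : ℕ} (ht : t < T) (ω : Ω) : (tr ω).act t ∈ X :=
  (h.run.follows ω).act_mem t ht

theorem abs_loss_le {t : ℕ} (ht : t < T) (ω : Ω) {x : Pt (Fin d)} (hx : x ∈ X) :
    |loss t ω x| ≤ 1 :=
  abs_le.2 (h.env.loss_mem t ht ω x hx)

theorem isPlay (ω : Ω) : (tr ω).IsPlay X J c₂ T where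
  follows := h.run.follows ω
  john xhat hx := h.run.john xhat hx (by
    obtain ⟨x, hx', hne⟩ := h.other xhat
    exact ⟨x, Finset.mem_erase.2 ⟨hne, hx'⟩⟩)
  two_le := h.two_le
  one_le_dim := h.one_le_dim
  other xhat _ := h.other xhat
  obs_le t ht := by
    rw [h.run.obs_eq t ht ω]
    exact h.abs_loss_le ht ω (h.act_mem ht ω)

theorem measurableSet_cand {t : ℕ} (ht : t ≤ T) (x : Pt (Fin d)) :
    MeasurableSet[ℱ t] {ω | (tr ω).cand t = x} :=
  h.run.cand_meas t ht (measurableSet_singleton x)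

theorem measurable_eval_cand {t : ℕ} (ht : t ≤ T) {F : Pt (Fin d) → Ω → ℝ}
    (hF : ∀ x ∈ X, Measurable[ℱ t] (F x)) : Measurable[ℱ t] fun ω => F ((tr ω).cand t) ω :=
  measurable_eval_of_mem_finset (fun x _ => h.measurableSet_cand ht x)
    (fun ω => (h.run.follows ω).cand_mem t ht) hF

/-- The start of the epoch is a function of the past, as an epoch begins exactly where the candidate
changes. -/
theorem measurableSet_start : ∀ t ≤ T, ∀ s, MeasurableSet[ℱ t] {ω | (tr ω).start t = s} := by
  intro t
  induction t with
  | zero =>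
    intro _ s
    have : {ω | (tr ω).start 0 = s} = {_ω | 0 = s} := by
      ext ω
      simp [(h.run.follows ω).start_zero]
    rw [this]
    exact MeasurableSet.const _
  | succ t ih =>
    intro ht s
    have hle : ℱ t ≤ ℱ (t + 1) := ℱ.mono (Nat.le_succ t)
    have hsame : MeasurableSet[ℱ (t + 1)] {ω | (tr ω).cand (t + 1) = (tr ω).cand t} :=
      measurableSet_eq_fun (h.run.cand_meas (t + 1) ht)
        ((h.run.cand_meas t (by omega)).mono hle le_rfl)
    have : {ω | (tr ω).start (t + 1) = s} =
        ({ω | (tr ω).cand (t + 1) = (tr ω).cand t} ∩ {ω | (tr ω).start t = s}) ∪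
        ({ω | (tr ω).cand (t + 1) = (tr ω).cand t}ᶜ ∩ {_ω | t + 1 = s}) := by
      ext ω
      simp only [Set.mem_ofPred_eq, Set.mem_union, Set.mem_inter_iff, Set.mem_compl_iff]
      rcases (h.run.follows ω).step_cases (Nat.lt_of_succ_le ht) with hs | hs
      · have hne := hs.1.2.2.1
        simp [hs.2.1, hne]
      · simp [hs.2.1, hs.2.2.1]
    rw [this]
    exact (hsame.inter (hle _ (ih (by omega) s))).union
      (hsame.compl.inter (MeasurableSet.const _))

theorem measurable_eval_start {t : ℕ} (ht : t ≤ T) {F : ℕ → Ω → ℝ}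
    (hF : ∀ s ≤ t, Measurable[ℱ t] (F s)) : Measurable[ℱ t] fun ω => F ((tr ω).start t) ω :=
  measurable_eval_of_mem_finset (S := Finset.range (t + 1))
    (fun s _ => h.measurableSet_start t ht s)
    (fun ω => Finset.mem_range.2 (Nat.lt_succ_of_le ((h.run.follows ω).start_le t ht)))
    fun s hs => hF s (Nat.le_of_lt_succ (Finset.mem_range.1 hs))

/-- The indicator of the event that `x` is played. -/
theorem bddMeas_act {t : ℕ} (ht : t < T) (x : Pt (Fin d)) :
    BddMeas (ℱ (t + 1)) (Set.indicator {ω | (tr ω).act t = x} fun _ => (1 : ℝ)) :=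
  ⟨measurable_const.indicator (h.run.act_meas t ht (measurableSet_singleton x)), 1, fun ω => by
    by_cases hω : ω ∈ {ω | (tr ω).act t = x} <;> simp [hω]⟩

variable {t : ℕ} (ht : t < T)

include ht

theorem measurable_p {s : ℕ} (hs : s ≤ t) {x : Pt (Fin d)} (hx : x ∈ X) :
    Measurable[ℱ t] fun ω => (tr ω).p s x :=
  (h.run.p_meas s (by omega) x hx).mono (ℱ.mono hs) le_rfl

theorem measurable_off : Measurable[ℱ t] fun ω => (tr ω).off t :=
  h.measurable_eval_cand ht.le (F := fun x ω => 1 - (tr ω).p t x)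
    fun _ hx => (h.measurable_p ht le_rfl hx).const_sub 1

theorem measurable_offMass : Measurable[ℱ t] fun ω => (tr ω).offMass t :=
  h.measurable_eval_start ht.le
    (F := fun s ω => ∑ τ ∈ Finset.Ico s t, (1 - (tr ω).p τ ((tr ω).cand t)))
    fun s _ => h.measurable_eval_cand ht.le
      (F := fun x ω => ∑ τ ∈ Finset.Ico s t, (1 - (tr ω).p τ x))
      fun _ hx => Finset.measurable_sum _ fun _ hτ =>
        (h.measurable_p ht (Finset.mem_Ico.1 hτ).2.le hx).const_sub 1

theorem measurable_eta : Measurable[ℱ t] fun ω => (tr ω).eta T t := by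
  have hM := h.measurable_offMass ht
  unfold Trajectory.eta
  refine Measurable.ite (hM (measurableSet_singleton 0)) measurable_const ?_
  exact measurable_const.min (Real.continuous_sqrt.measurable.comp (hM.const_div _))

theorem measurable_samp {x : Pt (Fin d)} (hx : x ∈ X) :
    Measurable[ℱ t] fun ω => (tr ω).samp J T t x := by
  have hη := h.measurable_eta ht
  refine h.measurable_eval_cand ht.le (F := fun xh ω =>
    open Classical in
    (1 - (tr ω).eta T t * ((d : ℝ) + 1)) * (tr ω).p t x + (tr ω).eta T t * ((d : ℝ) + 1) *
      ((1 - (tr ω).p t xh) * J xh x + (tr ω).p t xh * (if x = xh then 1 else 0)))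
    fun xh hxh => ?_
  have hp := h.measurable_p ht le_rfl hxh
  exact (((hη.mul_const _).const_sub 1).mul (h.measurable_p ht le_rfl hx)).add
    ((hη.mul_const _).mul (((hp.const_sub 1).mul_const _).add (hp.mul_const _)))

theorem measurable_kernel (a x : Pt (Fin d)) :
    Measurable[ℱ t] fun ω => (tr ω).kernel X J T t a x :=
  h.measurable_eval_cand ht.le (F := fun xh ω =>
    disp xh x ⬝ᵥ (hullCov (lift xh) X ((tr ω).samp J T t))⁻¹ *ᵥ
      (lift xh a - mean (lift xh) X ((tr ω).samp J T t)).ofLp)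
    fun xh _ => measurable_estimator (lift xh) X (fun _ hx => h.measurable_samp ht hx) _ _

theorem bddMeas_p {x : Pt (Fin d)} (hx : x ∈ X) : BddMeas (ℱ t) fun ω => (tr ω).p t x :=
  ⟨h.measurable_p ht le_rfl hx, 1, fun ω => by
    have h1 := (h.isPlay ω).isDist ht
    rw [abs_of_nonneg (h1.nonneg x hx)]
    exact h1.le_one hx⟩

theorem bddMeas_off : BddMeas (ℱ t) fun ω => (tr ω).off t :=
  ⟨h.measurable_off ht, 1, fun ω => by
    rw [abs_of_nonneg ((h.isPlay ω).off_pos ht).le]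
    exact (h.isPlay ω).off_le_one ht⟩

theorem bddMeas_eta : BddMeas (ℱ t) fun ω => (tr ω).eta T t :=
  ⟨h.measurable_eta ht, 1, fun ω => by
    have := ((h.isPlay ω).isRound ht).eta_le_eighth
    rw [abs_of_nonneg ((h.isPlay ω).eta_pos ht).le]
    linarith⟩

theorem bddMeas_samp {x : Pt (Fin d)} (hx : x ∈ X) :
    BddMeas (ℱ t) fun ω => (tr ω).samp J T t x :=
  ⟨h.measurable_samp ht hx, 1, fun ω => by
    have h1 := (h.isPlay ω).isDist_samp ht
    rw [abs_of_nonneg (h1.nonneg x hx)]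
    exact h1.le_one hx⟩

theorem bddMeas_kernel {a x : Pt (Fin d)} (ha : a ∈ X) (hx : x ∈ X) :
    BddMeas (ℱ t) fun ω => (tr ω).kernel X J T t a x := by
  obtain ⟨B, hB⟩ := Trajectory.exists_kernel_bound d T X J c₂
  exact ⟨h.measurable_kernel ht a x, B, fun ω => hB _ (h.isPlay ω) t ht a ha x hx⟩

theorem bddMeas_comparator {u x : Pt (Fin d)} (hu : u ∈ X) (hx : x ∈ X) :
    BddMeas (ℱ t) fun ω => (tr ω).comparator T t u x :=
  ⟨h.measurable_eval_start ht.le (F := fun s ω =>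
      open Classical in
      (1 - 1 / (T : ℝ)) * (if x = u then 1 else 0) + 1 / (T : ℝ) * (tr ω).p s x)
      fun _ hs => ((h.measurable_p ht hs hx).const_mul _).const_add _,
    1, fun ω => by
    have h1 := (h.isPlay ω).isDist_comparator ht hu
    rw [abs_of_nonneg (h1.nonneg x hx)]
    exact h1.le_one hx⟩

theorem bddMeas_stability {a : Pt (Fin d)} (ha : a ∈ X) :
    BddMeas (ℱ t) fun ω => (tr ω).stability X J T t a := by
  refine ⟨?_, 4, fun ω => ?_⟩
  · unfold Trajectory.stability
    refine Measurable.ite ?_ (((h.measurable_eta ht).const_mul _).mul (h.measurable_off ht))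
      ((((h.measurable_eta ht).const_mul _).mul (h.measurable_off ht)).mul
        (h.measurable_kernel ht a a))
    have := h.measurableSet_cand ht.le a
    simpa only [eq_comm] using this
  · have hr := (h.isPlay ω).isRound ht
    rw [(h.isPlay ω).stability_eq ht, abs_of_nonneg (hr.stab_nonneg ha)]
    exact hr.stab_le ha

theorem bddMeas_loss {x : Pt (Fin d)} (hx : x ∈ X) :
    BddMeas (ℱ (t + 1)) fun ω => loss t ω x :=
  ⟨h.env.loss_meas t ht x hx, 1, fun ω => h.abs_loss_le ht ω hx⟩

end IsGame

/-- The information available when the action of round `t` is drawn: the past and the losses of the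
round. -/
abbrev drawInfo (ℱ : Filtration ℕ mΩ) (X : Finset (Pt (Fin d)))
    (loss : ℕ → Ω → Pt (Fin d) → ℝ) (t : ℕ) : MeasurableSpace Ω :=
  ℱ t ⊔ ⨆ y ∈ X, MeasurableSpace.comap (fun ω => loss t ω y) inferInstance

namespace IsGame

variable (h : IsGame μ ℱ T X loss θ c₂ J tr) {t : ℕ} (ht : t < T)

include h ht

theorem drawInfo_le : drawInfo ℱ X loss t ≤ mΩ :=
  sup_le (ℱ.le t) (iSup₂_le fun y hy =>
    ((h.env.loss_meas t ht y hy).mono (ℱ.le _) le_rfl).comap_le)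

theorem bddMeas_loss_drawInfo {x : Pt (Fin d)} (hx : x ∈ X) :
    BddMeas (drawInfo ℱ X loss t) fun ω => loss t ω x :=
  ⟨(comap_measurable (fun ω => loss t ω x)).mono
    ((le_iSup₂ (f := fun y (_ : y ∈ X) =>
      MeasurableSpace.comap (fun ω => loss t ω y) inferInstance) x hx).trans le_sup_right) le_rfl,
    1, fun ω => h.abs_loss_le ht ω hx⟩

variable [IsProbabilityMeasure μ]

/-- The action is drawn from the sampling distribution, given the past and the losses. -/
theorem integral_act_mul {x : Pt (Fin d)} (hx : x ∈ X) {g : Ω → ℝ}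
    (hg : BddMeas (drawInfo ℱ X loss t) g) :
    ∫ ω, Set.indicator {ω | (tr ω).act t = x} (fun _ => (1 : ℝ)) ω * g ω ∂μ =
      ∫ ω, (tr ω).samp J T t x * g ω ∂μ := by
  have hm := h.drawInfo_le ht
  set f := Set.indicator {ω | (tr ω).act t = x} fun _ => (1 : ℝ) with hf
  have hfB : BddMeas mΩ f := (h.bddMeas_act ht x).mono (ℱ.le _)
  have hfg : Integrable (f * g) μ := (hfB.mul (hg.mono hm)).integrable
  have h1 : μ[f * g | drawInfo ℱ X loss t] =ᵐ[μ] μ[f | drawInfo ℱ X loss t] * g :=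
    condExp_mul_of_stronglyMeasurable_right hg.meas.stronglyMeasurable hfg hfB.integrable
  have h2 : ∫ ω, f ω * g ω ∂μ = ∫ ω, (μ[f * g | drawInfo ℱ X loss t]) ω ∂μ :=
    (integral_condExp hm).symm
  rw [h2]
  refine integral_congr_ae ?_
  filter_upwards [h1, h.run.act_law t ht x hx] with ω hω1 hω2
  rw [hω1, Pi.mul_apply, hω2]

/-- The conditional mean of a loss against a function of the past. -/
theorem integral_loss_mul {x : Pt (Fin d)} (hx : x ∈ X) {g : Ω → ℝ} (hg : BddMeas (ℱ t) g) :
    ∫ ω, loss t ω x * g ω ∂μ = ∫ ω, inner ℝ x (θ t ω) * g ω ∂μ := by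
  have hfB : BddMeas mΩ fun ω => loss t ω x := (h.bddMeas_loss ht hx).mono (ℱ.le _)
  have hfg : Integrable ((fun ω => loss t ω x) * g) μ := (hfB.mul (hg.mono (ℱ.le t))).integrable
  have h1 : μ[(fun ω => loss t ω x) * g | ℱ t] =ᵐ[μ] μ[fun ω => loss t ω x | ℱ t] * g :=
    condExp_mul_of_stronglyMeasurable_right hg.meas.stronglyMeasurable hfg hfB.integrable
  have h2 : ∫ ω, loss t ω x * g ω ∂μ = ∫ ω, (μ[(fun ω => loss t ω x) * g | ℱ t]) ω ∂μ :=
    (integral_condExp (ℱ.le t)).symm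
  rw [h2]
  refine integral_congr_ae ?_
  filter_upwards [h1, h.env.loss_mean t ht x hx] with ω hω1 hω2
  rw [hω1, Pi.mul_apply, hω2]

theorem integrable_inner_mul {x : Pt (Fin d)} (hx : x ∈ X) {g : Ω → ℝ} (hg : BddMeas (ℱ t) g) :
    Integrable (fun ω => inner ℝ x (θ t ω) * g ω) μ := by
  have h1 : Integrable (fun ω => (inner ℝ x (θ t ω) : ℝ)) μ :=
    integrable_condExp.congr (h.env.loss_mean t ht x hx)
  obtain ⟨C, hC⟩ := hg.bdd
  exact h1.mul_bdd (c := C) (hg.mono (ℱ.le t)).meas.aestronglyMeasurable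
    (Filter.Eventually.of_forall hC)

end IsGame

end Random

/-! ### The regret in terms of the increments -/

namespace Trajectory.IsPlay

variable {d : ℕ} {tr : Trajectory d} {T t : ℕ} {X : Finset (Pt (Fin d))}
  {J : Pt (Fin d) → Pt (Fin d) → ℝ} {c₂ : ℝ} (h : tr.IsPlay X J c₂ T) (ht : t < T)

include h ht

/-- Unbiasedness of the loss estimator, tested against weights `a` of total mass zero. -/
theorem sum_inner_mul_kernel {a : Pt (Fin d) → ℝ} (ha : ∑ x ∈ X, a x = 0) (θ : Pt (Fin d)) :
    ∑ b ∈ X, inner ℝ b θ * (tr.samp J T t b * ∑ x ∈ X, a x * tr.kernel X J T t b x) =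
      ∑ x ∈ X, inner ℝ x θ * a x := by
  have hr := h.isRound ht
  set F := liftFrame X (tr.cand t) (h.cand_mem ht) with hF
  set θ' : Fin d ⊕ Unit → ℝ := Sum.elim θ.ofLp (fun _ => (inner ℝ (tr.cand t) θ : ℝ)) with hθ'
  have haff : ∀ x ∈ X, (inner ℝ x θ : ℝ) = inner ℝ (tr.cand t) θ + F.y x ⬝ᵥ θ' := fun x _ =>
    inner_eq_add_disp x θ
  have hun : ∀ x ∈ X, ∑ b ∈ X, tr.samp J T t b * inner ℝ b θ * tr.kernel X J T t b x =
      F.y x ⬝ᵥ θ' := fun x hx => by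
    simp only [h.kernel_eq ht, samp_eq_mix]
    exact F.sum_mul_kap hr.isDist_sampling hr.posDef_sampling
      (by rw [hr.sampling_base]; exact hr.base_pos) haff hx
  calc ∑ b ∈ X, inner ℝ b θ * (tr.samp J T t b * ∑ x ∈ X, a x * tr.kernel X J T t b x)
      = ∑ x ∈ X, a x *
          ∑ b ∈ X, tr.samp J T t b * inner ℝ b θ * tr.kernel X J T t b x := by
        simp only [Finset.mul_sum]
        rw [Finset.sum_comm]
        exact Finset.sum_congr rfl fun x _ => Finset.sum_congr rfl fun b _ => by ring
    _ = ∑ x ∈ X, (inner ℝ x θ * a x - inner ℝ (tr.cand t) θ * a x) :=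
        Finset.sum_congr rfl fun x hx => by rw [hun x hx, haff x hx]; ring
    _ = ∑ x ∈ X, inner ℝ x θ * a x := by
        rw [Finset.sum_sub_distrib, ← Finset.mul_sum, ha, mul_zero, sub_zero]

theorem sum_abs_samp_sub_le : ∑ x ∈ X, |tr.samp J T t x - tr.p t x| ≤
    2 * (((d : ℝ) + 1) * (tr.eta T t * tr.off t)) := by
  have hr := h.isRound ht
  have := sum_abs_mix_sub_le (h.cand_mem ht) hr.isDist hr.explores.1 hr.mixing_nonneg
  rw [samp_eq_mix]
  refine this.trans (le_of_eq ?_)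
  simp only [Fintype.card_sum, Fintype.card_fin, Fintype.card_unit, Nat.cast_add, Nat.cast_one, off]
  ring

theorem sum_samp_mul_stability_le : ∑ a ∈ X, tr.samp J T t a * tr.stability X J T t a ≤
    10 * (((d : ℝ) + 1) * (tr.eta T t * tr.off t)) := by
  simp only [h.stability_eq ht, samp_eq_mix]
  refine (h.isRound ht).sum_mul_stab_le.trans (le_of_eq ?_)
  simp only [Fintype.card_sum, Fintype.card_fin, Fintype.card_unit, Nat.cast_add, Nat.cast_one, off]
  ring

theorem abs_sum_comparator_le {u : Pt (Fin d)} (hu : u ∈ X) {f : Pt (Fin d) → ℝ}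
    (hf : ∀ x ∈ X, |f x| ≤ 1) :
    |∑ x ∈ X, tr.comparator T t u x * f x - f u| ≤ 2 / T := by
  classical
  obtain ⟨h0, -⟩ := h.one_div_horizon
  have h2 := h.isDist (h.start_lt ht)
  have h3 : ∑ x ∈ X, tr.comparator T t u x * f x - f u =
      1 / (T : ℝ) * (∑ x ∈ X, tr.p (tr.start t) x * f x - f u) := by
    have h4 : ∑ x ∈ X, tr.comparator T t u x * f x = (1 - 1 / (T : ℝ)) * f u +
        1 / (T : ℝ) * ∑ x ∈ X, tr.p (tr.start t) x * f x := by
      rw [Finset.mul_sum, ← Finset.add_sum_erase X _ hu, ← Finset.add_sum_erase X _ hu, ← add_assoc]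
      congr 1
      · simp [comparator]
        ring
      · refine Finset.sum_congr rfl fun x hx => ?_
        simp [comparator, Finset.ne_of_mem_erase hx]
        ring
    rw [h4]
    ring
  have h5 : |∑ x ∈ X, tr.p (tr.start t) x * f x| ≤ 1 := by
    refine (Finset.abs_sum_le_sum_abs _ _).trans ?_
    rw [← h2.sum_eq_one]
    refine Finset.sum_le_sum fun x hx => ?_
    rw [abs_mul, abs_of_nonneg (h2.nonneg x hx)]
    exact mul_le_of_le_one_right (h2.nonneg x hx) (hf x hx)
  rw [h3, abs_mul, abs_of_pos h0]
  have h6 : |∑ x ∈ X, tr.p (tr.start t) x * f x - f u| ≤ 2 := by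
    refine (abs_sub _ _).trans ?_
    linarith [hf u hu]
  calc 1 / (T : ℝ) * _ ≤ 1 / (T : ℝ) * 2 := mul_le_mul_of_nonneg_left h6 h0.le
    _ = 2 / T := by ring

/-- The loss of a round exceeds the mean of its increment only by what the comparator loses. -/
theorem sum_samp_mul_le {u : Pt (Fin d)} (hu : u ∈ X) {f : Pt (Fin d) → ℝ}
    (hf : ∀ x ∈ X, |f x| ≤ 1) :
    ∑ x ∈ X, tr.samp J T t x * (f x - f u) ≤
      ∑ x ∈ X, f x * (tr.p t x - tr.comparator T t u x) -
        ∑ a ∈ X, tr.samp J T t a * tr.stability X J T t a +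
        12 * ((d : ℝ) + 1) * (tr.eta T t * tr.off t) + 2 / T := by
  have h1 := h.sum_abs_samp_sub_le ht
  have h2 := h.sum_samp_mul_stability_le ht
  have h3 := (abs_le.1 (h.abs_sum_comparator_le ht hu hf)).2
  have h4 : ∑ x ∈ X, tr.samp J T t x * (f x - f u) =
      ∑ x ∈ X, (tr.samp J T t x - tr.p t x) * f x +
      ∑ x ∈ X, f x * (tr.p t x - tr.comparator T t u x) +
      (∑ x ∈ X, tr.comparator T t u x * f x - f u) := by
    have h5 : ∑ x ∈ X, tr.samp J T t x * (f x - f u) =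
        ∑ x ∈ X, tr.samp J T t x * f x - (∑ x ∈ X, tr.samp J T t x) * f u := by
      rw [Finset.sum_mul, ← Finset.sum_sub_distrib]
      exact Finset.sum_congr rfl fun x _ => by ring
    rw [h5, (h.isDist_samp ht).sum_eq_one, one_mul, ← add_sub_assoc, ← Finset.sum_add_distrib,
      ← Finset.sum_add_distrib]
    congr 1
    exact Finset.sum_congr rfl fun x _ => by ring
  have h6 : ∑ x ∈ X, (tr.samp J T t x - tr.p t x) * f x ≤
      ∑ x ∈ X, |tr.samp J T t x - tr.p t x| := by
    refine Finset.sum_le_sum fun x hx => (le_abs_self _).trans ?_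
    rw [abs_mul]
    exact mul_le_of_le_one_right (abs_nonneg _) (hf x hx)
  linarith

end Trajectory.IsPlay

section Random

variable {d : ℕ} {Ω : Type*} {mΩ : MeasurableSpace Ω} {μ : Measure Ω} {ℱ : Filtration ℕ mΩ}
  {T : ℕ} {X : Finset (Pt (Fin d))} {loss : ℕ → Ω → Pt (Fin d) → ℝ} {θ : ℕ → Ω → Pt (Fin d)}
  {c₂ : ℝ} {J : Pt (Fin d) → Pt (Fin d) → ℝ} {tr : Ω → Trajectory d}

namespace IsGame

variable (h : IsGame μ ℱ T X loss θ c₂ J tr) {t : ℕ} (ht : t < T)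

include h ht

theorem eval_act (f : Pt (Fin d) → ℝ) (ω : Ω) : f ((tr ω).act t) =
    ∑ x ∈ X, Set.indicator {ω | (tr ω).act t = x} (fun _ => (1 : ℝ)) ω * f x := by
  rw [Finset.sum_eq_single_of_mem _ (h.act_mem ht ω)]
  · simp
  · intro b _ hb
    simp [Ne.symm hb]

theorem bddMeas_eval_act {F : Pt (Fin d) → Ω → ℝ} (hF : ∀ x ∈ X, BddMeas mΩ (F x)) :
    BddMeas mΩ fun ω => F ((tr ω).act t) ω := by
  have : (fun ω => F ((tr ω).act t) ω) = fun ω => ∑ x ∈ X,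
      Set.indicator {ω | (tr ω).act t = x} (fun _ => (1 : ℝ)) ω * F x ω := by
    funext ω
    exact h.eval_act ht (fun x => F x ω) ω
  rw [this]
  exact BddMeas.sum fun x hx => ((h.bddMeas_act ht x).mono (ℱ.le _)).mul (hF x hx)

variable [IsProbabilityMeasure μ]

theorem integral_eval_act {F : Pt (Fin d) → Ω → ℝ}
    (hF : ∀ x ∈ X, BddMeas (drawInfo ℱ X loss t) (F x)) :
    ∫ ω, F ((tr ω).act t) ω ∂μ = ∫ ω, ∑ x ∈ X, (tr ω).samp J T t x * F x ω ∂μ := by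
  have hF' : ∀ x ∈ X, BddMeas mΩ (F x) := fun x hx => (hF x hx).mono (h.drawInfo_le ht)
  have : (fun ω => F ((tr ω).act t) ω) = fun ω => ∑ x ∈ X,
      Set.indicator {ω | (tr ω).act t = x} (fun _ => (1 : ℝ)) ω * F x ω := by
    funext ω
    exact h.eval_act ht (fun x => F x ω) ω
  rw [this, integral_finsetSum, integral_finsetSum]
  · exact Finset.sum_congr rfl fun x hx => h.integral_act_mul ht hx (hF x hx)
  · exact fun x hx => (((h.bddMeas_samp ht hx).mono (ℱ.le _)).mul (hF' x hx)).integrable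
  · exact fun x hx => (((h.bddMeas_act ht x).mono (ℱ.le _)).mul (hF' x hx)).integrable

theorem past_le_drawInfo : ℱ t ≤ drawInfo ℱ X loss t := le_sup_left

theorem bddMeas_weight {u x : Pt (Fin d)} (hu : u ∈ X) (hx : x ∈ X) :
    BddMeas (ℱ t) fun ω => (tr ω).p t x - (tr ω).comparator T t u x :=
  (h.bddMeas_p ht hx).sub (h.bddMeas_comparator ht hu hx)

theorem gap_eq (ω : Ω) (x : Pt (Fin d)) : (tr ω).gap X J T t x =
    loss t ω ((tr ω).act t) * (tr ω).kernel X J T t ((tr ω).act t) x := by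
  rw [Trajectory.gap_eq_kernel, h.run.obs_eq t ht ω]

theorem bddMeas_estimate {u b : Pt (Fin d)} (hu : u ∈ X) (hb : b ∈ X) :
    BddMeas (drawInfo ℱ X loss t) fun ω => ∑ x ∈ X,
      ((tr ω).p t x - (tr ω).comparator T t u x) *
        (loss t ω b * (tr ω).kernel X J T t b x) :=
  BddMeas.sum fun _ hx => ((h.bddMeas_weight ht hu hx).mono (h.past_le_drawInfo ht)).mul
    ((h.bddMeas_loss_drawInfo ht hb).mul
      ((h.bddMeas_kernel ht hb hx).mono (h.past_le_drawInfo ht)))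

/-- In expectation the estimated losses may be replaced by the true ones. -/
theorem integral_estimate {u : Pt (Fin d)} (hu : u ∈ X) :
    ∫ ω, ∑ x ∈ X, ((tr ω).p t x - (tr ω).comparator T t u x) * (tr ω).gap X J T t x ∂μ =
      ∫ ω, ∑ x ∈ X, loss t ω x * ((tr ω).p t x - (tr ω).comparator T t u x) ∂μ := by
  have hw : ∀ x ∈ X, BddMeas (ℱ t) fun ω => (tr ω).p t x - (tr ω).comparator T t u x :=
    fun x hx => h.bddMeas_weight ht hu hx
  have hc : ∀ b ∈ X, BddMeas (ℱ t) fun ω => (tr ω).samp J T t b *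
      ∑ x ∈ X, ((tr ω).p t x - (tr ω).comparator T t u x) * (tr ω).kernel X J T t b x :=
    fun b hb => (h.bddMeas_samp ht hb).mul
      (BddMeas.sum fun x hx => (hw x hx).mul (h.bddMeas_kernel ht hb hx))
  have hloss : ∀ x ∈ X, BddMeas mΩ fun ω => loss t ω x :=
    fun x hx => (h.bddMeas_loss ht hx).mono (ℱ.le _)
  simp only [h.gap_eq ht]
  rw [h.integral_eval_act ht fun b hb => h.bddMeas_estimate ht hu hb]
  calc ∫ ω, ∑ b ∈ X, (tr ω).samp J T t b * ∑ x ∈ X,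
        ((tr ω).p t x - (tr ω).comparator T t u x) *
          (loss t ω b * (tr ω).kernel X J T t b x) ∂μ
      = ∫ ω, ∑ b ∈ X, loss t ω b * ((tr ω).samp J T t b * ∑ x ∈ X,
        ((tr ω).p t x - (tr ω).comparator T t u x) * (tr ω).kernel X J T t b x) ∂μ := by
        refine integral_congr_ae (Filter.Eventually.of_forall fun ω => ?_)
        refine Finset.sum_congr rfl fun b _ => ?_
        simp only [Finset.mul_sum]
        exact Finset.sum_congr rfl fun x _ => by ring
    _ = ∫ ω, ∑ b ∈ X, inner ℝ b (θ t ω) * ((tr ω).samp J T t b * ∑ x ∈ X,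
        ((tr ω).p t x - (tr ω).comparator T t u x) * (tr ω).kernel X J T t b x) ∂μ := by
        rw [integral_finsetSum, integral_finsetSum]
        · exact Finset.sum_congr rfl fun b hb => h.integral_loss_mul ht hb (hc b hb)
        · exact fun b hb => h.integrable_inner_mul ht hb (hc b hb)
        · exact fun b hb => ((hloss b hb).mul ((hc b hb).mono (ℱ.le _))).integrable
    _ = ∫ ω, ∑ x ∈ X, inner ℝ x (θ t ω) *
          ((tr ω).p t x - (tr ω).comparator T t u x) ∂μ := by
        refine integral_congr_ae (Filter.Eventually.of_forall fun ω => ?_)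
        refine (h.isPlay ω).sum_inner_mul_kernel ht ?_ (θ t ω)
        rw [Finset.sum_sub_distrib, ((h.isPlay ω).isDist ht).sum_eq_one,
          ((h.isPlay ω).isDist_comparator ht hu).sum_eq_one, sub_self]
    _ = ∫ ω, ∑ x ∈ X, loss t ω x * ((tr ω).p t x - (tr ω).comparator T t u x) ∂μ := by
        rw [integral_finsetSum, integral_finsetSum]
        · exact Finset.sum_congr rfl fun x hx => (h.integral_loss_mul ht hx (hw x hx)).symm
        · exact fun x hx => ((hloss x hx).mul ((hw x hx).mono (ℱ.le _))).integrable
        · exact fun x hx => h.integrable_inner_mul ht hx (hw x hx)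

theorem bddMeas_gapSum {u : Pt (Fin d)} (hu : u ∈ X) : BddMeas mΩ fun ω =>
    ∑ x ∈ X, ((tr ω).p t x - (tr ω).comparator T t u x) * (tr ω).gap X J T t x := by
  simp only [h.gap_eq ht]
  exact h.bddMeas_eval_act ht fun b hb => (h.bddMeas_estimate ht hu hb).mono (h.drawInfo_le ht)

theorem bddMeas_stability_act : BddMeas mΩ fun ω => (tr ω).stability X J T t ((tr ω).act t) :=
  h.bddMeas_eval_act ht (F := fun a ω => (tr ω).stability X J T t a)
    fun _ ha => (h.bddMeas_stability ht ha).mono (ℱ.le _)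

theorem bddMeas_eta_off : BddMeas mΩ fun ω =>
    12 * ((d : ℝ) + 1) * ((tr ω).eta T t * (tr ω).off t) :=
  ((BddMeas.const _).mul ((h.bddMeas_eta ht).mul (h.bddMeas_off ht))).mono (ℱ.le t)

theorem bddMeas_increment {u : Pt (Fin d)} (hu : u ∈ X) :
    BddMeas mΩ fun ω => (tr ω).increment X J T u t :=
  ((h.bddMeas_gapSum ht hu).sub (h.bddMeas_stability_act ht)).add (h.bddMeas_eta_off ht)

theorem bddMeas_loss_act {u : Pt (Fin d)} (hu : u ∈ X) :
    BddMeas mΩ fun ω => loss t ω ((tr ω).act t) - loss t ω u :=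
  h.bddMeas_eval_act ht (F := fun x ω => loss t ω x - loss t ω u)
    fun _ hx => ((h.bddMeas_loss ht hx).mono (ℱ.le _)).sub ((h.bddMeas_loss ht hu).mono (ℱ.le _))

theorem integral_loss_act {u : Pt (Fin d)} (hu : u ∈ X) :
    ∫ ω, (loss t ω ((tr ω).act t) - loss t ω u) ∂μ =
      ∫ ω, ∑ x ∈ X, (tr ω).samp J T t x * (loss t ω x - loss t ω u) ∂μ :=
  h.integral_eval_act ht (F := fun x ω => loss t ω x - loss t ω u)
    fun _ hx => (h.bddMeas_loss_drawInfo ht hx).sub (h.bddMeas_loss_drawInfo ht hu)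

/-- The expected regret of a round is bounded by its expected increment. -/
theorem integral_loss_act_le {u : Pt (Fin d)} (hu : u ∈ X) :
    ∫ ω, (loss t ω ((tr ω).act t) - loss t ω u) ∂μ ≤
      ∫ ω, (tr ω).increment X J T u t ∂μ + 2 / T := by
  have hloss : ∀ x ∈ X, BddMeas mΩ fun ω => loss t ω x :=
    fun x hx => (h.bddMeas_loss ht hx).mono (ℱ.le _)
  have b1 : BddMeas mΩ fun ω => ∑ x ∈ X, (tr ω).samp J T t x * (loss t ω x - loss t ω u) :=
    BddMeas.sum fun x hx => ((h.bddMeas_samp ht hx).mono (ℱ.le _)).mul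
      ((hloss x hx).sub (hloss u hu))
  have b2 : BddMeas mΩ fun ω =>
      ∑ x ∈ X, loss t ω x * ((tr ω).p t x - (tr ω).comparator T t u x) :=
    BddMeas.sum fun x hx => (hloss x hx).mul ((h.bddMeas_weight ht hu hx).mono (ℱ.le _))
  have b3 : BddMeas mΩ fun ω => ∑ a ∈ X, (tr ω).samp J T t a * (tr ω).stability X J T t a :=
    BddMeas.sum fun x hx => ((h.bddMeas_samp ht hx).mul (h.bddMeas_stability ht hx)).mono (ℱ.le _)
  have b4 := h.bddMeas_eta_off ht
  have e1 : ∫ ω, (tr ω).increment X J T u t ∂μ =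
      ∫ ω, (∑ x ∈ X, loss t ω x * ((tr ω).p t x - (tr ω).comparator T t u x) -
        ∑ a ∈ X, (tr ω).samp J T t a * (tr ω).stability X J T t a +
        12 * ((d : ℝ) + 1) * ((tr ω).eta T t * (tr ω).off t)) ∂μ := by
    unfold Trajectory.increment
    rw [integral_add ((h.bddMeas_gapSum ht hu).sub (h.bddMeas_stability_act ht)).integrable
      b4.integrable, integral_sub (h.bddMeas_gapSum ht hu).integrable
      (h.bddMeas_stability_act ht).integrable, integral_add (b2.sub b3).integrable b4.integrable,
      integral_sub b2.integrable b3.integrable, h.integral_estimate ht hu,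
      h.integral_eval_act ht (F := fun a ω => (tr ω).stability X J T t a)
        fun _ ha => (h.bddMeas_stability ht ha).mono (h.past_le_drawInfo ht)]
  have e2 : ∫ _ω : Ω, (2 / (T : ℝ)) ∂μ = 2 / T := by simp
  rw [h.integral_loss_act ht hu, e1, ← e2,
    ← integral_add ((b2.sub b3).add b4).integrable (integrable_const _)]
  refine integral_mono b1.integrable
    (((b2.sub b3).add b4).add (BddMeas.const _)).integrable fun ω => ?_
  exact (h.isPlay ω).sum_samp_mul_le ht hu fun x hx => h.abs_loss_le ht ω hx

end IsGame

/-- The regret is bounded by the expectation of any pathwise bound on the sum of the increments. -/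
theorem IsGame.regret_le_of_sum_increment_le [IsProbabilityMeasure μ]
    (h : IsGame μ ℱ T X loss θ c₂ J tr) {u : Pt (Fin d)} (hu : u ∈ X) {P : Ω → ℝ}
    (hP : Integrable P μ)
    (hle : ∀ ω, ∑ t ∈ Finset.range T, (tr ω).increment X J T u t ≤ P ω) :
    regret μ T loss tr u ≤ ∫ ω, P ω ∂μ + 2 := by
  have hT : (T : ℝ) ≠ 0 := by
    have := h.two_le
    exact_mod_cast (by omega : T ≠ 0)
  rw [regret, integral_finsetSum _ fun t ht =>
    (h.bddMeas_loss_act (Finset.mem_range.1 ht) hu).integrable]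
  calc ∑ t ∈ Finset.range T, ∫ ω, (loss t ω ((tr ω).act t) - loss t ω u) ∂μ
      ≤ ∑ t ∈ Finset.range T, (∫ ω, (tr ω).increment X J T u t ∂μ + 2 / T) :=
        Finset.sum_le_sum fun t ht => h.integral_loss_act_le (Finset.mem_range.1 ht) hu
    _ = ∫ ω, ∑ t ∈ Finset.range T, (tr ω).increment X J T u t ∂μ + 2 := by
        rw [Finset.sum_add_distrib, integral_finsetSum _ fun t ht =>
          (h.bddMeas_increment (Finset.mem_range.1 ht) hu).integrable]
        simp only [Finset.sum_const, Finset.card_range, nsmul_eq_mul]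
        congr 1
        field_simp
    _ ≤ _ := by
        refine add_le_add (integral_mono ?_ hP hle) le_rfl
        exact (BddMeas.sum fun t ht => h.bddMeas_increment (Finset.mem_range.1 ht) hu).integrable

end Random

/-! ### The corrupted stochastic regime -/

section Random

variable {d : ℕ} {Ω : Type*} {mΩ : MeasurableSpace Ω} {μ : Measure Ω} {ℱ : Filtration ℕ mΩ}
  {T : ℕ} {X : Finset (Pt (Fin d))} {loss : ℕ → Ω → Pt (Fin d) → ℝ} {θ : ℕ → Ω → Pt (Fin d)}
  {c₂ : ℝ} {J : Pt (Fin d) → Pt (Fin d) → ℝ} {tr : Ω → Trajectory d}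

namespace IsGame

variable (h : IsGame μ ℱ T X loss θ c₂ J tr)

include h

theorem bddMeas_misses (xs : Pt (Fin d)) : BddMeas mΩ fun ω => (tr ω).misses xs T := by
  have h1 : (fun ω => (tr ω).misses xs T) = fun ω => ∑ t ∈ Finset.range T,
      (1 - Set.indicator {ω | (tr ω).act t = xs} (fun _ => (1 : ℝ)) ω) := by
    funext ω
    refine Finset.sum_congr rfl fun t _ => ?_
    by_cases hx : (tr ω).act t = xs <;> simp [hx]
  rw [h1]
  exact BddMeas.sum fun t ht =>
    (BddMeas.const 1).sub ((h.bddMeas_act (Finset.mem_range.1 ht) xs).mono (ℱ.le _))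

theorem bddMeas_candOff_round (xs : Pt (Fin d)) {t : ℕ} (ht : t < T) : BddMeas mΩ fun ω =>
    open Classical in if (tr ω).cand t = xs then (tr ω).off t else 0 := by
  obtain ⟨c, hc⟩ := (h.bddMeas_off ht).bdd
  refine BddMeas.mono (m := ℱ t) ⟨Measurable.ite (h.measurableSet_cand ht.le xs)
    (h.bddMeas_off ht).meas measurable_const, c, fun ω => ?_⟩ (ℱ.le t)
  split_ifs
  · exact hc ω
  · simpa using (abs_nonneg _).trans (hc ω)

theorem bddMeas_candOff (xs : Pt (Fin d)) : BddMeas mΩ fun ω => (tr ω).candOff xs T :=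
  BddMeas.sum fun _ ht => h.bddMeas_candOff_round xs (Finset.mem_range.1 ht)

variable [IsProbabilityMeasure μ]

theorem integral_misses {xs : Pt (Fin d)} (hxs : xs ∈ X) : ∫ ω, (tr ω).misses xs T ∂μ =
    ∑ t ∈ Finset.range T, ∫ ω, (1 - (tr ω).samp J T t xs) ∂μ := by
  have h1 : (fun ω => (tr ω).misses xs T) = fun ω => ∑ t ∈ Finset.range T,
      (1 - Set.indicator {ω | (tr ω).act t = xs} (fun _ => (1 : ℝ)) ω) := by
    funext ω
    refine Finset.sum_congr rfl fun t _ => ?_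
    by_cases hx : (tr ω).act t = xs <;> simp [hx]
  have h2 : ∀ t < T, BddMeas mΩ (Set.indicator {ω | (tr ω).act t = xs} fun _ => (1 : ℝ)) :=
    fun t ht => (h.bddMeas_act ht xs).mono (ℱ.le _)
  rw [h1, integral_finsetSum _ fun t ht =>
    ((BddMeas.const 1).sub (h2 t (Finset.mem_range.1 ht))).integrable]
  refine Finset.sum_congr rfl fun t ht => ?_
  rw [Finset.mem_range] at ht
  have h3 := h.integral_act_mul ht hxs (BddMeas.const 1)
  simp only [mul_one] at h3
  rw [integral_sub (integrable_const _) (h2 t ht).integrable, h3,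
    integral_sub (integrable_const _) ((h.bddMeas_samp ht hxs).mono (ℱ.le _)).integrable]

/-- The exploration leaves the mass of the candidate unchanged, so that the mass placed off `xs`
while `xs` is the candidate is the probability that another action is played. -/
theorem integral_candOff_le {xs : Pt (Fin d)} (hxs : xs ∈ X) :
    ∫ ω, (tr ω).candOff xs T ∂μ ≤ ∫ ω, (tr ω).misses xs T ∂μ := by
  rw [h.integral_misses hxs]
  unfold Trajectory.candOff
  rw [integral_finsetSum _ fun t ht =>
    (h.bddMeas_candOff_round xs (Finset.mem_range.1 ht)).integrable]
  refine Finset.sum_le_sum fun t ht => ?_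
  rw [Finset.mem_range] at ht
  refine integral_mono (h.bddMeas_candOff_round xs ht).integrable
    ((BddMeas.const 1).sub ((h.bddMeas_samp ht hxs).mono (ℱ.le _))).integrable fun ω => ?_
  dsimp only
  split_ifs with hc
  · have h1 := ((h.isPlay ω).isRound ht).sampling_base
    rw [← hc, Trajectory.off, Trajectory.samp_eq_mix, ← h1]
  · exact sub_nonneg.2 (((h.isPlay ω).isDist_samp ht).le_one hxs)

theorem regret_eq_sum {u : Pt (Fin d)} (hu : u ∈ X) : regret μ T loss tr u =
    ∑ t ∈ Finset.range T, ∫ ω, (loss t ω ((tr ω).act t) - loss t ω u) ∂μ :=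
  integral_finsetSum _ fun _ ht => (h.bddMeas_loss_act (Finset.mem_range.1 ht) hu).integrable

theorem regret_le_two_mul {u : Pt (Fin d)} (hu : u ∈ X) : regret μ T loss tr u ≤ 2 * T := by
  have h1 : ∀ t ∈ Finset.range T, ∫ ω, (loss t ω ((tr ω).act t) - loss t ω u) ∂μ ≤ 2 := by
    intro t ht
    rw [Finset.mem_range] at ht
    have e : ∫ _ω : Ω, (2 : ℝ) ∂μ = 2 := by simp
    rw [← e]
    refine integral_mono (h.bddMeas_loss_act ht hu).integrable (integrable_const _) fun ω => ?_
    have h2 := abs_le.1 (h.abs_loss_le ht ω (h.act_mem ht ω))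
    have h3 := abs_le.1 (h.abs_loss_le ht ω hu)
    dsimp only
    linarith
  rw [h.regret_eq_sum hu]
  refine (Finset.sum_le_sum h1).trans (le_of_eq ?_)
  simp [mul_comm]

variable {xs : Pt (Fin d)} {Δ : ℝ} {C : ℕ → ℝ} (hC : IsCorruptedStochastic μ ℱ T X loss xs Δ C)

include hC

/-- The gap condition, tested against a nonnegative function of the past. -/
theorem gap_mul_integral_le {t : ℕ} (ht : t < T) {x : Pt (Fin d)} (hx : x ∈ X) (hne : x ≠ xs)
    {g : Ω → ℝ} (hg : BddMeas (ℱ t) g) (h0 : ∀ ω, 0 ≤ g ω) :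
    (Δ - C t) * ∫ ω, g ω ∂μ ≤ ∫ ω, g ω * (loss t ω x - loss t ω xs) ∂μ := by
  have hf : BddMeas mΩ fun ω => loss t ω x - loss t ω xs :=
    ((h.bddMeas_loss ht hx).sub (h.bddMeas_loss ht hC.xstar_mem)).mono (ℱ.le _)
  have hg' : BddMeas mΩ g := hg.mono (ℱ.le t)
  have hgf : Integrable (g * fun ω => loss t ω x - loss t ω xs) μ := (hg'.mul hf).integrable
  have h1 := condExp_mul_of_stronglyMeasurable_left hg.meas.stronglyMeasurable hgf hf.integrable
  have h2 : ∫ ω, g ω * (loss t ω x - loss t ω xs) ∂μ =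
      ∫ ω, (μ[g * fun ω => loss t ω x - loss t ω xs | ℱ t]) ω ∂μ :=
    (integral_condExp (ℱ.le t)).symm
  rw [h2, ← integral_const_mul]
  refine integral_mono_ae (hg'.integrable.const_mul _) integrable_condExp ?_
  filter_upwards [h1, hC.gap t ht x hx hne] with ω hω1 hω2
  rw [hω1, Pi.mul_apply, mul_comm]
  exact mul_le_mul_of_nonneg_left hω2 (h0 ω)

theorem gap_le {t : ℕ} (ht : t < T) {x : Pt (Fin d)} (hx : x ∈ X) (hne : x ≠ xs) :
    Δ - C t ≤ ∫ ω, (loss t ω x - loss t ω xs) ∂μ := by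
  simpa using h.gap_mul_integral_le hC ht hx hne (BddMeas.const 1) fun _ => zero_le_one

/-- The gap condition of a round, tested against the sampling probabilities. -/
theorem gap_mul_miss_le {t : ℕ} (ht : t < T) :
    Δ * ∫ ω, (1 - (tr ω).samp J T t xs) ∂μ ≤
      ∫ ω, (loss t ω ((tr ω).act t) - loss t ω xs) ∂μ + C t := by
  classical
  have hxs := hC.xstar_mem
  have hs : ∀ x ∈ X, BddMeas (ℱ t) fun ω => (tr ω).samp J T t x :=
    fun x hx => h.bddMeas_samp ht hx
  have hf : ∀ x ∈ X, BddMeas mΩ fun ω => loss t ω x - loss t ω xs := fun x hx =>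
    ((h.bddMeas_loss ht hx).sub (h.bddMeas_loss ht hxs)).mono (ℱ.le _)
  have h0 : ∀ x ∈ X, ∀ ω, 0 ≤ (tr ω).samp J T t x :=
    fun x hx ω => ((h.isPlay ω).isDist_samp ht).nonneg x hx
  set M := ∫ ω, (1 - (tr ω).samp J T t xs) ∂μ with hM
  have hsum : M = ∑ x ∈ X.erase xs, ∫ ω, (tr ω).samp J T t x ∂μ := by
    rw [hM, ← integral_finsetSum _ fun x hx =>
      ((hs x (Finset.mem_of_mem_erase hx)).mono (ℱ.le t)).integrable]
    refine integral_congr_ae (Filter.Eventually.of_forall fun ω => ?_)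
    have := ((h.isPlay ω).isDist_samp ht).sum_eq_one
    rw [← Finset.add_sum_erase X _ hxs] at this
    dsimp only
    linarith
  have hM1 : M ≤ 1 := by
    have e : ∫ _ω : Ω, (1 : ℝ) ∂μ = 1 := by simp
    rw [← e]
    refine integral_mono ((BddMeas.const 1).sub ((hs xs hxs).mono (ℱ.le t))).integrable
      (integrable_const _) fun ω => ?_
    have := h0 xs hxs ω
    dsimp only
    linarith
  have h1 : (Δ - C t) * M ≤ ∫ ω, (loss t ω ((tr ω).act t) - loss t ω xs) ∂μ := by
    rw [h.integral_loss_act ht hxs, integral_finsetSum _ fun x hx =>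
      (((hs x hx).mono (ℱ.le t)).mul (hf x hx)).integrable, ← Finset.add_sum_erase X _ hxs, hsum,
      Finset.mul_sum]
    simp only [sub_self, mul_zero, integral_zero, zero_add]
    exact Finset.sum_le_sum fun x hx => h.gap_mul_integral_le hC ht
      (Finset.mem_of_mem_erase hx) (Finset.ne_of_mem_erase hx)
      (hs x (Finset.mem_of_mem_erase hx)) (h0 x (Finset.mem_of_mem_erase hx))
  have h2 := mul_le_of_le_one_right (hC.corr_nonneg t ht) hM1
  linarith [sub_mul Δ (C t) M]

/-- Every round in which `xs` is missed costs at least the gap, up to the corruption. -/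
theorem gap_mul_misses_le : Δ * ∫ ω, (tr ω).misses xs T ∂μ ≤
    regret μ T loss tr xs + ∑ t ∈ Finset.range T, C t := by
  rw [h.integral_misses hC.xstar_mem, h.regret_eq_sum hC.xstar_mem, Finset.mul_sum,
    ← Finset.sum_add_distrib]
  exact Finset.sum_le_sum fun t ht => h.gap_mul_miss_le hC (Finset.mem_range.1 ht)

/-- Any action but `xs` is a weaker competitor than `xs`, up to the corruption. -/
theorem regret_add_le {u : Pt (Fin d)} (hu : u ∈ X) (hne : u ≠ xs) :
    regret μ T loss tr u + (Δ * T - ∑ t ∈ Finset.range T, C t) ≤ regret μ T loss tr xs := by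
  have e : Δ * T - ∑ t ∈ Finset.range T, C t = ∑ t ∈ Finset.range T, (Δ - C t) := by
    simp [Finset.sum_sub_distrib, mul_comm]
  rw [h.regret_eq_sum hC.xstar_mem, h.regret_eq_sum hu, e, ← Finset.sum_add_distrib]
  refine Finset.sum_le_sum fun t ht => ?_
  rw [Finset.mem_range] at ht
  have hl : ∀ x ∈ X, BddMeas mΩ fun ω => loss t ω x :=
    fun x hx => (h.bddMeas_loss ht hx).mono (ℱ.le _)
  have h1 : ∫ ω, (loss t ω ((tr ω).act t) - loss t ω xs) ∂μ =
      ∫ ω, (loss t ω ((tr ω).act t) - loss t ω u) ∂μ + ∫ ω, (loss t ω u - loss t ω xs) ∂μ := by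
    rw [← integral_add (h.bddMeas_loss_act ht hu).integrable
      ((hl u hu).sub (hl xs hC.xstar_mem)).integrable]
    simp
  rw [h1]
  exact add_le_add le_rfl (h.gap_le hC ht hu hne)

/-- The gap cannot exceed the range of the losses, up to the corruption. -/
theorem gap_mul_horizon_le : Δ * T - ∑ t ∈ Finset.range T, C t ≤ 2 * T := by
  obtain ⟨x, hx, hne⟩ := h.other xs
  have h1 : ∀ t ∈ Finset.range T, Δ - C t ≤ 2 := by
    intro t ht
    rw [Finset.mem_range] at ht
    refine (h.gap_le hC ht hx hne).trans ?_
    have e : ∫ _ω : Ω, (2 : ℝ) ∂μ = 2 := by simp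
    rw [← e]
    refine integral_mono (((h.bddMeas_loss ht hx).sub
      (h.bddMeas_loss ht hC.xstar_mem)).mono (ℱ.le _)).integrable (integrable_const _) fun ω => ?_
    have h2 := abs_le.1 (h.abs_loss_le ht ω hx)
    have h3 := abs_le.1 (h.abs_loss_le ht ω hC.xstar_mem)
    dsimp only
    linarith
  have h2 := Finset.sum_le_sum h1
  rw [Finset.sum_sub_distrib] at h2
  simp only [Finset.sum_const, Finset.card_range, nsmul_eq_mul] at h2
  linarith

end IsGame

/-! ### The two regret bounds -/

theorem integrable_sqrt [IsProbabilityMeasure μ] {f : Ω → ℝ} (hf : BddMeas mΩ f) :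
    Integrable (fun ω => Real.sqrt (f ω)) μ := by
  obtain ⟨c, hc⟩ := hf.bdd
  refine Integrable.of_bound (Real.continuous_sqrt.measurable.comp hf.meas).aestronglyMeasurable
    (Real.sqrt c) (Filter.Eventually.of_forall fun ω => ?_)
  rw [Real.norm_of_nonneg (Real.sqrt_nonneg _)]
  exact Real.sqrt_le_sqrt ((le_abs_self _).trans (hc ω))

theorem integral_sqrt_le [IsProbabilityMeasure μ] {f : Ω → ℝ} (hf : BddMeas mΩ f)
    (h0 : ∀ ω, 0 ≤ f ω) : ∫ ω, Real.sqrt (f ω) ∂μ ≤ Real.sqrt (∫ ω, f ω ∂μ) := by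
  exact Real.strictConcaveOn_sqrt.concaveOn.le_map_integral Real.continuous_sqrt.continuousOn
    isClosed_Ici (Filter.Eventually.of_forall h0) hf.integrable (integrable_sqrt hf)

/-- If `R` is bounded by the square root of a quantity which `R` itself controls, then `R` is
bounded. -/
theorem le_of_self_bounding {R A B w Δ C : ℝ} (hA : 0 ≤ A) (hB : 0 ≤ B) (hΔ : 0 < Δ) (hC : 0 ≤ C)
    (h1 : R ≤ A * Real.sqrt w + B) (h2 : Δ * w ≤ R + C) :
    R ≤ 2 * A * Real.sqrt (C / Δ) + A ^ 2 / Δ + 2 * B := by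
  rcases le_total R 0 with hR | hR
  · exact hR.trans (by positivity)
  have h3 : w ≤ R / Δ + C / Δ := by
    rw [← add_div, le_div_iff₀ hΔ]
    linarith
  have h4 : Real.sqrt w ≤ Real.sqrt (R / Δ) + Real.sqrt (C / Δ) :=
    Real.sqrt_le_iff.2 ⟨by positivity, by
      have e1 := Real.sq_sqrt (by positivity : 0 ≤ R / Δ)
      have e2 := Real.sq_sqrt (by positivity : 0 ≤ C / Δ)
      nlinarith [Real.sqrt_nonneg (R / Δ), Real.sqrt_nonneg (C / Δ)]⟩
  have h5 : A * Real.sqrt (R / Δ) ≤ R / 2 + A ^ 2 / Δ / 2 := by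
    have e1 : Real.sqrt R ^ 2 = R := Real.sq_sqrt hR
    have e2 : Real.sqrt Δ ^ 2 = Δ := Real.sq_sqrt hΔ.le
    have e3 : A ^ 2 / Δ = (A / Real.sqrt Δ) ^ 2 := by rw [div_pow, e2]
    have e4 : A * Real.sqrt (R / Δ) = Real.sqrt R * (A / Real.sqrt Δ) := by
      rw [Real.sqrt_div hR]
      ring
    rw [e4, e3]
    nlinarith [sq_nonneg (Real.sqrt R - A / Real.sqrt Δ)]
  nlinarith [mul_le_mul_of_nonneg_left h4 hA]

namespace IsGame

variable {κ : ℝ} (h : IsGame μ ℱ T X loss θ (κ * ((d : ℝ) + 1) ^ 2) J tr) (hκ : 0 < κ)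
  [IsProbabilityMeasure μ]

include h

/-- In terms of `S = (d + 1) √(log T)`, the natural scale of the bounds, the parameter of the
reduction is `κ S²`. -/
theorem scale_sq : κ * ((d : ℝ) + 1) ^ 2 * Real.log T =
    κ * (((d : ℝ) + 1) * Real.sqrt (Real.log T)) ^ 2 := by
  have := Trajectory.log_horizon_pos h.two_le
  rw [mul_pow, Real.sq_sqrt (by linarith)]
  ring

theorem one_le_scale : 1 ≤ ((d : ℝ) + 1) * Real.sqrt (Real.log T) := by
  have h1 : (1 : ℝ) ≤ d := by exact_mod_cast h.one_le_dim
  have h2 : (1 / 2 : ℝ) ≤ Real.sqrt (Real.log T) :=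
    Real.le_sqrt_of_sq_le (by linarith [Trajectory.log_horizon_pos h.two_le])
  nlinarith

theorem scale_le : ((d : ℝ) + 1) * Real.sqrt (Real.log T) ≤
    2 * (d * Real.sqrt (Real.log T)) := by
  have h1 : (1 : ℝ) ≤ d := by exact_mod_cast h.one_le_dim
  nlinarith [Real.sqrt_nonneg (Real.log T)]

include hκ

theorem regret_le_sqrt_horizon {u : Pt (Fin d)} (hu : u ∈ X) : regret μ T loss tr u ≤
    2 * (5 * (38 + 8 / Real.sqrt κ) + 10) * (d * Real.sqrt (T * Real.log T)) := by
  have hκ' := Real.sqrt_pos.2 hκ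
  set S := ((d : ℝ) + 1) * Real.sqrt (Real.log T) with hSdef
  have hS : 1 ≤ S := h.one_le_scale
  have hT1 : 1 ≤ T := by have := h.two_le; omega
  have hT : (1 : ℝ) ≤ T := by exact_mod_cast hT1
  have hsT : 1 ≤ Real.sqrt (T : ℝ) := Real.one_le_sqrt.2 hT
  have hsq : Real.sqrt T ^ 2 = T := Real.sq_sqrt (by linarith)
  have h1 : regret μ T loss tr u ≤
      (5 * (38 + 8 / Real.sqrt κ) * S * Real.sqrt T + 8 * S ^ 2) + 2 := by
    refine (h.regret_le_of_sum_increment_le hu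
      (integrable_const (5 * (38 + 8 / Real.sqrt κ) * S * Real.sqrt T + 8 * S ^ 2)) fun ω =>
      ((h.isPlay ω).epochBound hu).sum_le_sqrt_horizon (h.run.follows ω) hS hκ h.scale_sq
        hT1).trans (le_of_eq ?_)
    simp
  have h2 : regret μ T loss tr u ≤ (5 * (38 + 8 / Real.sqrt κ) + 10) * (S * Real.sqrt T) := by
    have hq : 0 ≤ 8 / Real.sqrt κ := by positivity
    rcases le_total S (Real.sqrt T) with hle | hle
    · nlinarith
    · -- the horizon is so short that the trivial bound suffices
      have h3 := h.regret_le_two_mul hu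
      have h4 : (T : ℝ) ≤ S * Real.sqrt T := by nlinarith
      nlinarith [mul_nonneg hq (by positivity : 0 ≤ S * Real.sqrt T)]
  refine h2.trans ?_
  rw [Real.sqrt_mul (by linarith)]
  have h3 : S * Real.sqrt T ≤ 2 * (d * (Real.sqrt T * Real.sqrt (Real.log T))) := by
    nlinarith [h.scale_le]
  calc _ ≤ (5 * (38 + 8 / Real.sqrt κ) + 10) *
        (2 * (d * (Real.sqrt T * Real.sqrt (Real.log T)))) :=
        mul_le_mul_of_nonneg_left h3 (by positivity)
    _ = _ := by ring

/-- The self-bounding regret bound: the regret is controlled by the expected number of rounds in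
which `xs` is not played. -/
theorem regret_le_sqrt_misses {u xs : Pt (Fin d)} (hu : u ∈ X) (hxs : xs ∈ X) :
    regret μ T loss tr u ≤
      (8 * (38 + 8 / Real.sqrt κ) + 114) * (((d : ℝ) + 1) * Real.sqrt (Real.log T)) *
        Real.sqrt (∫ ω, (tr ω).misses xs T ∂μ) +
      (38 * (Real.sqrt (2 * κ) + 1) + 18) * (((d : ℝ) + 1) * Real.sqrt (Real.log T)) ^ 2 := by
  have hκ' := Real.sqrt_pos.2 hκ
  set S := ((d : ℝ) + 1) * Real.sqrt (Real.log T) with hSdef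
  have hS : 1 ≤ S := h.one_le_scale
  have hT1 : 1 ≤ T := by have := h.two_le; omega
  have hm := h.bddMeas_misses xs
  have hc := h.bddMeas_candOff xs
  have hc0 : ∀ ω, 0 ≤ (tr ω).candOff xs T := fun ω => Finset.sum_nonneg fun t ht => by
    split_ifs
    · exact ((h.isPlay ω).off_pos (Finset.mem_range.1 ht)).le
    · exact le_rfl
  set a := 8 * (38 + 8 / Real.sqrt κ) + 76 with ha
  set b := 38 * (Real.sqrt (2 * κ) + 1) + 16 with hb
  have ha0 : 0 ≤ a := by positivity
  have i1 := (integrable_sqrt (μ := μ) hm).const_mul (a * S)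
  have i2 := (integrable_sqrt (μ := μ) hc).const_mul (38 * S)
  have h1 := h.regret_le_of_sum_increment_le hu ((i1.add i2).add (integrable_const (b * S ^ 2)))
    fun ω => ((h.isPlay ω).epochBound hu).sum_le_sqrt_misses (h.run.follows ω) hS hκ h.scale_sq
      hxs hT1
  rw [integral_add' (i1.add i2) (integrable_const _), integral_add' i1 i2, integral_const_mul,
    integral_const_mul] at h1
  simp only [integral_const, probReal_univ, one_smul] at h1
  have h2 := integral_sqrt_le (μ := μ) hm fun ω => Trajectory.misses_nonneg xs T
  have h3 := (integral_sqrt_le (μ := μ) hc hc0).trans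
    (Real.sqrt_le_sqrt (h.integral_candOff_le hxs))
  have h4 := mul_le_mul_of_nonneg_left h2 (by positivity : 0 ≤ a * S)
  have h5 := mul_le_mul_of_nonneg_left h3 (by positivity : 0 ≤ 38 * S)
  have h6 : (1 : ℝ) ≤ S ^ 2 := one_le_pow₀ hS
  have e1 : 8 * (38 + 8 / Real.sqrt κ) + 114 = a + 38 := by rw [ha]; ring
  have e2 : 38 * (Real.sqrt (2 * κ) + 1) + 18 = b + 2 := by rw [hb]; ring
  rw [e1, e2]
  linarith

theorem regret_le_corrupted {A B : ℝ} (hA : A = 8 * (38 + 8 / Real.sqrt κ) + 114)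
    (hB : B = 38 * (Real.sqrt (2 * κ) + 1) + 18) {xs : Pt (Fin d)} {Δ : ℝ} {C : ℕ → ℝ}
    (hC : IsCorruptedStochastic μ ℱ T X loss xs Δ C) {u : Pt (Fin d)} (hu : u ∈ X) :
    regret μ T loss tr u ≤ (4 * A ^ 2 + 4 * A + 32 * B) * ((d : ℝ) ^ 2 * Real.log T / Δ +
      d * Real.sqrt ((∑ t ∈ Finset.range T, C t) * Real.log T / Δ)) := by
  have hκ' := Real.sqrt_pos.2 hκ
  have hA0 : 0 ≤ A := by rw [hA]; positivity
  have hB0 : 0 ≤ B := by rw [hB]; positivity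
  have hΔ := hC.gap_pos
  have hL := Trajectory.log_horizon_pos h.two_le
  have hL0 : 0 ≤ Real.log T := by linarith
  have hT : (0 : ℝ) < T := by
    have := h.two_le
    exact_mod_cast (by omega : 0 < T)
  set c := ∑ t ∈ Finset.range T, C t with hc
  have hc0 : 0 ≤ c := Finset.sum_nonneg fun t ht => hC.corr_nonneg t (Finset.mem_range.1 ht)
  set S := ((d : ℝ) + 1) * Real.sqrt (Real.log T) with hSdef
  have hS : 1 ≤ S := h.one_le_scale
  set P := (d : ℝ) ^ 2 * Real.log T / Δ with hP
  set Q := (d : ℝ) * Real.sqrt (c * Real.log T / Δ) with hQ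
  have hP0 : 0 ≤ P := by positivity
  have hQ0 : 0 ≤ Q := by positivity
  rcases le_or_gt (Δ * T / 2) c with hbig | hsmall
  · -- so much corruption that the adversarial bound suffices
    have h1 := h.regret_le_sqrt_horizon hκ hu
    have h2 : (d : ℝ) * Real.sqrt (T * Real.log T) ≤ 2 * Q := by
      have h3 : Real.sqrt (T * Real.log T) ≤ 2 * Real.sqrt (c * Real.log T / Δ) := by
        refine Real.sqrt_le_iff.2 ⟨by positivity, ?_⟩
        rw [mul_pow, Real.sq_sqrt (by positivity)]
        have h4 : (T : ℝ) ≤ 2 * (c / Δ) := by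
          rw [← mul_div_assoc, le_div_iff₀ hΔ]
          linarith
        have h5 : c * Real.log T / Δ = c / Δ * Real.log T := by ring
        rw [h5]
        nlinarith [div_nonneg hc0 hΔ.le]
      rw [hQ]
      nlinarith [mul_le_mul_of_nonneg_left h3 (Nat.cast_nonneg (α := ℝ) d)]
    have h6 : 2 * (5 * (38 + 8 / Real.sqrt κ) + 10) ≤ 2 * A := by
      rw [hA]
      have : 0 ≤ 8 / Real.sqrt κ := by positivity
      linarith
    have h7 : 2 * (5 * (38 + 8 / Real.sqrt κ) + 10) * (d * Real.sqrt (T * Real.log T)) ≤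
        2 * A * (2 * Q) := mul_le_mul h6 h2 (by positivity) (by positivity)
    nlinarith [mul_nonneg (sq_nonneg A) hP0, mul_nonneg hA0 hP0, mul_nonneg hB0 hP0,
      mul_nonneg (sq_nonneg A) hQ0, mul_nonneg hA0 hQ0, mul_nonneg hB0 hQ0]
  · -- the gap is bounded, so that a term `S²` may be replaced by `S² / Δ`
    have hΔ4 : Δ ≤ 4 := by
      have h1 := h.gap_mul_horizon_le hC
      by_contra! h2
      nlinarith
    have h1 : regret μ T loss tr u ≤ regret μ T loss tr xs := by
      by_cases hne : u = xs
      · rw [hne]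
      · have := h.regret_add_le hC hu hne
        nlinarith
    have h2 := le_of_self_bounding (A := A * S) (B := B * S ^ 2) (by positivity) (by positivity)
      hΔ hc0 (by simpa only [hA, hB] using h.regret_le_sqrt_misses hκ hC.xstar_mem hC.xstar_mem)
      (h.gap_mul_misses_le hC)
    have hs := h.scale_le
    have h3 : S ^ 2 / Δ ≤ 4 * P := by
      have e : 4 * P = (2 * (d * Real.sqrt (Real.log T))) ^ 2 / Δ := by
        rw [mul_pow, mul_pow, Real.sq_sqrt hL0, hP]
        ring
      rw [e]
      gcongr
    have h4 : S ^ 2 ≤ 4 * (S ^ 2 / Δ) := by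
      rw [← mul_div_assoc, le_div_iff₀ hΔ]
      nlinarith [sq_nonneg S]
    have h5 : S * Real.sqrt (c / Δ) ≤ 2 * Q := by
      have e : 2 * Q = 2 * (d * Real.sqrt (Real.log T)) * Real.sqrt (c / Δ) := by
        rw [hQ, show c * Real.log T / Δ = Real.log T * (c / Δ) by ring, Real.sqrt_mul hL0]
        ring
      rw [e]
      gcongr
    have h6 : (A * S) ^ 2 / Δ = A ^ 2 * (S ^ 2 / Δ) := by ring
    have h7 := mul_le_mul_of_nonneg_left h3 (sq_nonneg A)
    have h8 := mul_le_mul_of_nonneg_left h5 hA0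
    have h9 := mul_le_mul_of_nonneg_left (h4.trans (mul_le_mul_of_nonneg_left h3 (by norm_num)))
      hB0
    rw [h6] at h2
    nlinarith [mul_nonneg hA0 hP0, mul_nonneg (sq_nonneg A) hQ0, mul_nonneg hB0 hQ0]

end IsGame

/-- With a single action there is nothing to regret. -/
theorem regret_eq_zero_of_card_le_one (hrun : IsRun μ ℱ T X loss c₂ J tr) (hX : X.card ≤ 1)
    {u : Pt (Fin d)} (hu : u ∈ X) : regret μ T loss tr u = 0 := by
  have h1 : ∀ ω, ∑ t ∈ Finset.range T, (loss t ω ((tr ω).act t) - loss t ω u) = 0 := fun ω =>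
    Finset.sum_eq_zero fun t ht => by
      rw [Finset.card_le_one.1 hX _ ((hrun.follows ω).act_mem t (Finset.mem_range.1 ht)) u hu,
        sub_self]
  simp [regret, h1]

end Random

end LinBandit

end

theorem mainTheorem3 (κ : ℝ) (hκ : 0 < κ) :
    ∃ K : ℝ, 0 < K ∧
      ∀ (d T : ℕ) (_ : 2 ≤ T) (X : Finset (LinBandit.Pt (Fin d)))
        (Ω : Type*) (mΩ : MeasurableSpace Ω) (μ : Measure Ω) (_ : IsProbabilityMeasure μ)
        (ℱ : Filtration ℕ mΩ)
        (loss : ℕ → Ω → LinBandit.Pt (Fin d) → ℝ) (θ : ℕ → Ω → LinBandit.Pt (Fin d))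
        (J : LinBandit.Pt (Fin d) → LinBandit.Pt (Fin d) → ℝ)
        (tr : Ω → LinBandit.Trajectory d),
        LinBandit.IsLinearEnv μ ℱ T X loss θ →
        LinBandit.IsRun μ ℱ T X loss (κ * ((d : ℝ) + 1) ^ 2) J tr →
        (∀ u ∈ X, LinBandit.regret μ T loss tr u ≤
            K * ((d : ℝ) * Real.sqrt ((T : ℝ) * Real.log T))) ∧
        (∀ (xstar : LinBandit.Pt (Fin d)) (Δ : ℝ) (C : ℕ → ℝ),
          LinBandit.IsCorruptedStochastic μ ℱ T X loss xstar Δ C →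
          ∀ u ∈ X, LinBandit.regret μ T loss tr u ≤
            K * ((d : ℝ) ^ 2 * Real.log T / Δ +
              (d : ℝ) * Real.sqrt ((∑ t ∈ Finset.range T, C t) * Real.log T / Δ))) := by
  have hκ' := Real.sqrt_pos.2 hκ
  obtain ⟨A, hA⟩ : ∃ A, A = 8 * (38 + 8 / Real.sqrt κ) + 114 := ⟨_, rfl⟩
  obtain ⟨B, hB⟩ : ∃ B, B = 38 * (Real.sqrt (2 * κ) + 1) + 18 := ⟨_, rfl⟩
  have hq : 0 ≤ 8 / Real.sqrt κ := by positivity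
  have hA0 : 0 < A := by rw [hA]; positivity
  have hB0 : 0 < B := by rw [hB]; positivity
  refine ⟨4 * A ^ 2 + 4 * A + 32 * B, by positivity, ?_⟩
  intro d T hT X Ω mΩ μ hμ ℱ loss θ J tr henv hrun
  have hL0 : 0 ≤ Real.log T := by linarith [LinBandit.Trajectory.log_horizon_pos hT]
  rcases Nat.lt_or_ge X.card 2 with hX | hX
  · have h0 := fun u hu => LinBandit.regret_eq_zero_of_card_le_one hrun (by omega) (u := u) hu
    refine ⟨fun u hu => ?_, fun xstar Δ C hC u hu => ?_⟩
    · rw [h0 u hu]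
      positivity
    · have := hC.gap_pos
      rw [h0 u hu]
      positivity
  have h : LinBandit.IsGame μ ℱ T X loss θ (κ * ((d : ℝ) + 1) ^ 2) J tr := ⟨henv, hrun, hT, hX⟩
  refine ⟨fun u hu => (h.regret_le_sqrt_horizon hκ hu).trans ?_,
    fun xstar Δ C hC u hu => h.regret_le_corrupted hκ hA hB hC hu⟩
  refine mul_le_mul_of_nonneg_right ?_ (by positivity)
  nlinarith [sq_nonneg A]
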